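/- Let $L/K$ be a finite Galois extension of fields with group $\Gamma=\mathrm{Gal}(L/K)$, and let $C$ be a semisimple $L$-linear abelian category (abelian, every object a finite direct sum of simple objects) with finite-dimensional spaces of morphisms. The statements below hold in three settings: (i) $C$ without additional structure; (ii) $C$ a tensor category (a monoidal category with $L$-bilinear tensor product); (iii) $C$ a braided tensor category. In setting (ii), resp. (iii), all functors are monoidal, resp. braided monoidal, and all natural transformations are monoidal. **Definitions.** * For a $K$-linear category $D$, $D\otimes_K L$ is the Karoubian envelope of the category with the objects of $D$ and with morphisms $\mathrm{Hom}_D(X,Y)\otimes_K L$. A *form* of $C$ over $K$ is a semisimple $K$-linear abelian category $D$ with finite-dimensional spaces of morphisms (in (ii), (iii) a tensor, resp. braided tensor category with $K$-bilinear tensor product), together with an $L$-linear equivalence $\Xi: D\otimes_K L\to C$ (monoidal, resp. braided, in (ii), (iii)). * For $g\in\Gamma$ let ${}^gC$ be the category $C$ in which $a\in L$ acts on morphisms as $g^{-1}(a)$ does in $C$. $\mathbf{Aut}_K(C)$ is the categorical group of pairs $(g,\Phi)$ with $g\in\Gamma$ and $\Phi:{}^gC\to C$ an $L$-linear equivalence;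 morphisms $(g,\Phi)\to(h,\Phi')$ exist only if $g=h$, and are then the isomorphisms $\Phi\cong\Phi'$; the tensor product is $(g,\Phi)\circ(h,\Phi')=(gh,\Phi\circ g(\Phi'))$. Let $\Psi:\mathbf{Aut}_K(C)\to\Gamma$, $(g,\Phi)\mapsto g$. Its kernel is the categorical group $\mathbf{Aut}(C)$ of $L$-linear auto-equivalences, which gives the extension $1\to\mathbf{Aut}(C)\to\mathbf{Aut}_K(C)\to\Gamma\to1$ ($\Psi$ need not be surjective; it is if there is a splitting). The automorphism group of the unit object of $\mathbf{Aut}_K(C)$ is $\mathrm{Aut}(\mathrm{Id}_C)$, the group of automorphisms (monoidal ones in (ii), (iii)) of the identity functor; it is abelian. * A *splitting* is a monoidal functor $S:\Gamma\to\mathbf{Aut}_K(C)$ ($\Gamma$ being viewed as a discrete monoidal category) with $\Psi\circ S=\mathrm{id}$. It provides functors $\Phi_g$ and isomorphisms $J_{g,h}:\Phi_g\circ g(\Phi_h)\to\Phi_{gh}$. * $B\mathbf{Aut}_K(C)$ is the simplicial set whose $n$-simplices are the families of objects $X_{ij}$ of $\mathbf{Aut}_K(C)$ ($0\le i\le j\le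 n$, $X_{ii}=\mathbf 1$) and isomorphisms $X_{jk}\otimes X_{ij}\cong X_{ik}$ compatible with the associativity and unit isomorphisms, and $B\Gamma$ is the nerve of $\Gamma$. $\Psi$ induces the fibration $B\Psi: B\mathbf{Aut}_K(C)\to B\Gamma$. A section of it is a simplicial map $\sigma$ with $B\Psi\circ\sigma=\mathrm{id}$. * A *weak splitting* is a choice of objects $(g,\Phi_g)$ of $\mathbf{Aut}_K(C)$, $g\in\Gamma$, such that $\Phi_g\circ g(\Phi_h)\cong\Phi_{gh}$ for all $g,h$. * For a splitting $(\Phi_g,J_{g,h})$, a *$\Gamma$-stable object* is an object $X$ of $C$ with isomorphisms $\alpha_g:\Phi_g(X)\to X$, $g\in\Gamma$, such that $\alpha_{gh}\circ (J_{g,h})_X=\alpha_g\circ\Phi_g(\alpha_h)$. Morphisms from $(X,\alpha)$ to $(Y,\beta)$ are the elements of $\mathrm{Hom}_C(X,Y)^\Gamma$, i.e. the $f$ with $\beta_g\circ\Phi_g(f)\circ\alpha_g^{-1}=f$ for all $g$. The $\Gamma$-stable objects form a $K$-linear category $C^\Gamma$, with a tensor product in (ii), (iii) and a braiding in (iii),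 defined on the underlying objects of $C$. **Proposition.** In each of the settings (i), (ii), (iii): 1. $C$ has a form over $K$ if and only if there is a splitting of $\Psi$, if and only if the fibration $B\Psi$ has a section. 2. Let $\Phi$ be a weak splitting. There is an action of $\Gamma$ on $\mathrm{Aut}(\mathrm{Id}_C)$ given by conjugation with the $\Phi_g$: $(g\cdot a)\otimes\Phi_g=\Phi_g\otimes a$. For any choice of isomorphisms $J_{g,h}:\Phi_g\circ g(\Phi_h)\to\Phi_{gh}$, the equation $\omega_{g,h,k}\circ J_{gh,k}\circ J_{g,h}=J_{g,hk}\circ g(J_{h,k})$ is solved by a $3$-cocycle $\omega$ of $\Gamma$ with values in $\mathrm{Aut}(\mathrm{Id}_C)$, whose class $o_\Phi\in H^3(\Gamma,\mathrm{Aut}(\mathrm{Id}_C))$ does not depend on $J$. There is a splitting $S$ with $S(g)\cong\Phi_g$ for all $g$ if and only if $o_\Phi$ is trivial. 3. For any splitting, the category $C^\Gamma$ of $\Gamma$-stable objects is semisimple abelian with finite-dimensional spaces of morphisms, and is a form of $C$ over $K$, by an equivalence $\Xi:C^\Gamma\otimes_KL\to C$ whose composition with $C^\Gamma\to C^\Gamma\otimes_KL$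 is isomorphic (monoidally in (ii), (iii)) to the forgetful functor $(X,\alpha)\mapsto X$. In (ii), (iii): if $C$ is rigid then so is $C^\Gamma$, and if $\mathrm{End}_C(\mathbf 1)=L$ then $\mathrm{End}_{C^\Gamma}(\mathbf 1)=K$. In (iii): if $C$ is symmetric then so is $C^\Gamma$. -/

import Mathlib

open CategoryTheory MonoidalCategory Limits
open scoped TensorProduct
universe w u v
namespace CategoricalDescent


/-! ### Categorical groups over a group `Γ`: splittings, classifying spaces, obstruction classes -/

section CategoricalGroups

/-- A categorical group (gr-category): a monoidal groupoid in which every object is invertible. -/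
class IsCategoricalGroup (𝒢 : Type u) [Category.{v} 𝒢] [MonoidalCategory 𝒢] : Prop where
  isIso {X Y : 𝒢} (f : X ⟶ Y) : IsIso f
  exists_inverse (X : 𝒢) : ∃ Y : 𝒢, Nonempty (X ⊗ Y ≅ 𝟙_ 𝒢) ∧ Nonempty (Y ⊗ X ≅ 𝟙_ 𝒢)

variable {Γ : Type w} [Group Γ] {𝒢 : Type u} [Category.{v} 𝒢] [MonoidalCategory 𝒢]

/-- A splitting of a homomorphism of categorical groups `Ψ : 𝒢 ⟶ Γ`: a homomorphism of categorical
groups `Γ ⟶ 𝒢` (a strong monoidal functor) whose composition with `Ψ` is the identity. As `Γ` is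
discrete, isomorphic objects of it are equal, and the condition on objects is the whole one. -/
structure Splitting (Ψ : 𝒢 ⥤ Discrete Γ) where
  functor : Discrete Γ ⥤ 𝒢
  [monoidal : functor.Monoidal]
  comp_eq : ∀ g : Γ, (Ψ.obj (functor.obj ⟨g⟩)).as = g

attribute [instance] Splitting.monoidal

/-- An `I`-simplex of the classifying space of `𝒢`, for a linearly ordered set `I`: objects
`X i j` for `i ≤ j` with `X i i = 𝟙_`, and isomorphisms `X j k ⊗ X i j ≅ X i k` which are
compatible with the associator and the unitors. This is a normalised (strictly unitary)
pseudofunctor from `I` to the bicategory with one object attached to `𝒢`. -/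
structure BSimplex (𝒢 : Type u) [Category.{v} 𝒢] [MonoidalCategory 𝒢] (I : Type) [Preorder I] where
  obj : ∀ {i j : I}, i ≤ j → 𝒢
  comp : ∀ {i j k : I} (hij : i ≤ j) (hjk : j ≤ k), obj hjk ⊗ obj hij ≅ obj (hij.trans hjk)
  obj_refl : ∀ i : I, obj (le_refl i) = 𝟙_ 𝒢
  comp_refl_left : ∀ {i j : I} (h : i ≤ j),
    (comp (le_refl i) h).hom = obj h ◁ eqToHom (obj_refl i) ≫ (ρ_ (obj h)).hom
  comp_refl_right : ∀ {i j : I} (h : i ≤ j),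
    (comp h (le_refl j)).hom = eqToHom (obj_refl j) ▷ obj h ≫ (λ_ (obj h)).hom
  assoc : ∀ {i j k l : I} (hij : i ≤ j) (hjk : j ≤ k) (hkl : k ≤ l),
    (comp hjk hkl).hom ▷ obj hij ≫ (comp hij (hjk.trans hkl)).hom =
      (α_ (obj hkl) (obj hjk) (obj hij)).hom ≫ obj hkl ◁ (comp hij hjk).hom ≫
        (comp (hij.trans hjk) hkl).hom

/-- Restriction of simplices along a monotone map. -/
@[simps]
def BSimplex.restrict {I J : Type} [Preorder I] [Preorder J] (f : I →o J) (s : BSimplex 𝒢 J) :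
    BSimplex 𝒢 I where
  obj h := s.obj (f.monotone h)
  comp hij hjk := s.comp (f.monotone hij) (f.monotone hjk)
  obj_refl i := s.obj_refl (f i)
  comp_refl_left h := s.comp_refl_left (f.monotone h)
  comp_refl_right h := s.comp_refl_right (f.monotone h)
  assoc hij hjk hkl := s.assoc (f.monotone hij) (f.monotone hjk) (f.monotone hkl)

/-- The classifying space `B𝒢` of a categorical group, as a simplicial set: the Duskin nerve of the
bicategory with one object attached to `𝒢`. -/
def classifyingSpace (𝒢 : Type u) [Category.{v} 𝒢] [MonoidalCategory 𝒢] : SSet.{max u v} where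
  obj Δ := BSimplex 𝒢 (Fin (Δ.unop.len + 1))
  map f := ↾fun s ↦ s.restrict f.unop.toOrderHom
  map_id _ := rfl
  map_comp _ _ := rfl

variable (Ψ : 𝒢 ⥤ Discrete Γ) [Ψ.Monoidal]

/-- The simplex of `BΓ` below a simplex of `B𝒢`. -/
def BSimplex.toNerve {n : ℕ} (s : BSimplex 𝒢 (Fin (n + 1))) :
    ComposableArrows (SingleObj Γ) n where
  obj _ := SingleObj.star Γ
  map {i j} f := (Ψ.obj (s.obj (leOfHom f))).as
  map_id i := by
    rw [s.obj_refl i]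
    exact (Discrete.eq_of_hom (Functor.Monoidal.εIso Ψ).hom).symm
  map_comp {i j k} f g := by
    have h := Discrete.eq_of_hom ((Functor.Monoidal.μIso Ψ _ _).hom ≫
      Ψ.map (s.comp (leOfHom f) (leOfHom g)).hom)
    exact h.symm

/-- The map of classifying spaces `B𝒢 ⟶ BΓ` induced by `Ψ : 𝒢 ⟶ Γ`, where `BΓ` is the nerve of the
category with one object attached to `Γ` (both are lifted to a common universe). -/
def classifyingMap : SSet.uliftFunctor.{w, max u v}.obj (classifyingSpace 𝒢) ⟶
    SSet.uliftFunctor.{max u v, w}.obj (nerve (SingleObj Γ)) where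
  app Δ := ↾fun s ↦ ULift.up (s.down.toNerve Ψ)

/-- The fibration `B𝒢 ⟶ BΓ` has a section. -/
def HasSection : Prop :=
  ∃ σ : SSet.uliftFunctor.{max u v, w}.obj (nerve (SingleObj Γ)) ⟶
    SSet.uliftFunctor.{w, max u v}.obj (classifyingSpace 𝒢), σ ≫ classifyingMap Ψ = 𝟙 _

/-- A splitting "at the level of ordinary groups": lifts `Φ g` of the elements `g` of `Γ` to objects
of `𝒢` such that `Φ g ⊗ Φ h ≅ Φ (g * h)` for all `g` and `h`. -/
structure WeakSplitting where
  obj : Γ → 𝒢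
  obj_eq : ∀ g, (Ψ.obj (obj g)).as = g
  nonempty_iso : ∀ g h, Nonempty (obj g ⊗ obj h ≅ obj (g * h))

variable {Ψ}

/-- The automorphism group of the unit object of a monoidal category is commutative. -/
theorem aut_unit_mul_comm (a b : Aut (𝟙_ 𝒢)) : a * b = b * a := by
  have key : ∀ a b : 𝟙_ 𝒢 ⟶ 𝟙_ 𝒢, a ≫ b = b ≫ a := by
    intro a b
    have h1 : a = (λ_ (𝟙_ 𝒢)).inv ≫ 𝟙_ 𝒢 ◁ a ≫ (λ_ (𝟙_ 𝒢)).hom := by simp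
    have h2 : b = (ρ_ (𝟙_ 𝒢)).inv ≫ b ▷ 𝟙_ 𝒢 ≫ (ρ_ (𝟙_ 𝒢)).hom := by simp
    have e := whisker_exchange b a
    rw [h1, h2]
    simp only [unitors_equal, unitors_inv_equal, Category.assoc, Iso.hom_inv_id_assoc,
      reassoc_of% e]
  ext
  exact key _ _

/-- `π₂(B𝒢)`: the group of automorphisms of the unit object of `𝒢`. -/
instance autUnitCommGroup : CommGroup (Aut (𝟙_ 𝒢)) :=
  { (inferInstance : Group (Aut (𝟙_ 𝒢))) with mul_comm := aut_unit_mul_comm }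

/-- The automorphism `a ⊗ X` of `X` given by an automorphism `a` of the unit object. -/
def leftAct (a : Aut (𝟙_ 𝒢)) (X : 𝒢) : X ⟶ X := (λ_ X).inv ≫ a.hom ▷ X ≫ (λ_ X).hom

/-- The automorphism `X ⊗ a` of `X` given by an automorphism `a` of the unit object. -/
def rightAct (X : 𝒢) (a : Aut (𝟙_ 𝒢)) : X ⟶ X := (ρ_ X).inv ≫ X ◁ a.hom ≫ (ρ_ X).hom

end CategoricalGroups

section Cohomology

variable {Γ : Type w} [Group Γ] {A : Type v} [CommGroup A] (act : Γ →* MulAut A)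

/-- The differential from `2`-cochains to `3`-cochains of `Γ` in `A` (written multiplicatively). -/
def d₂ : (Γ → Γ → A) →* (Γ → Γ → Γ → A) where
  toFun η g h k := act g (η h k) * (η (g * h) k)⁻¹ * η g (h * k) * (η g h)⁻¹
  map_one' := by ext; simp
  map_mul' η θ := by
    ext g h k
    simp only [Pi.mul_apply, map_mul, mul_inv]
    ac_rfl

/-- The differential from `3`-cochains to `4`-cochains of `Γ` in `A` (written multiplicatively). -/
def d₃ : (Γ → Γ → Γ → A) →* (Γ → Γ → Γ → Γ → A) where
  toFun ω g h k l := act g (ω h k l) * (ω (g * h) k l)⁻¹ * ω g (h * k) l * (ω g h (k * l))⁻¹ *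
    ω g h k
  map_one' := by ext; simp
  map_mul' η θ := by
    ext g h k l
    simp only [Pi.mul_apply, map_mul, mul_inv]
    ac_rfl

/-- Coboundaries are cocycles. -/
theorem d₃_d₂ (η : Γ → Γ → A) : d₃ act (d₂ act η) = 1 := by
  ext g h k l
  simp only [d₂, d₃, MonoidHom.coe_mk, OneHom.coe_mk, map_mul, map_inv, MulAut.mul_apply,
    mul_assoc, Pi.one_apply, mul_inv, inv_inv]
  apply Additive.ofMul.injective
  simp only [ofMul_mul, ofMul_inv, ofMul_one]
  abel

/-- The cohomology group `H³(Γ, A)` of the complex of inhomogeneous cochains. -/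
abbrev H₃ : Type max w v := (d₃ act).ker ⧸ (d₂ act).range.subgroupOf (d₃ act).ker

end Cohomology

section Obstruction

variable {Γ : Type w} [Group Γ] {𝒢 : Type u} [Category.{v} 𝒢] [MonoidalCategory 𝒢]
  {Ψ : 𝒢 ⥤ Discrete Γ}

/-- The relation `ω(g,h,k) ∘ J(gh,k) ∘ J(g,h) = J(g,hk) ∘ g(J(h,k))` between isomorphisms
`J(g,h) : Φ g ⊗ Φ h ≅ Φ (g * h)` and elements `ω(g,h,k)` of `Aut 𝟙_`, acting on `Φ (g * h * k)`. -/
def WeakSplitting.IsAssociator (Φ : WeakSplitting Ψ)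
    (J : ∀ g h, Φ.obj g ⊗ Φ.obj h ≅ Φ.obj (g * h)) (ω : Γ → Γ → Γ → Aut (𝟙_ 𝒢)) : Prop :=
  ∀ g h k, (J g h).hom ▷ Φ.obj k ≫ (J (g * h) k).hom ≫ leftAct (ω g h k) (Φ.obj (g * h * k)) =
    (α_ (Φ.obj g) (Φ.obj h) (Φ.obj k)).hom ≫ Φ.obj g ◁ (J h k).hom ≫ (J g (h * k)).hom ≫
      eqToHom (congrArg Φ.obj (mul_assoc g h k).symm)

/-- The action of `Γ` on `Aut 𝟙_` defined by a splitting `Φ` at the level of ordinary groups is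
conjugation: `g • a` is characterised by `(g • a) ⊗ Φ g = Φ g ⊗ a`. -/
def WeakSplitting.IsConjugation (Φ : WeakSplitting Ψ) (act : Γ →* MulAut (Aut (𝟙_ 𝒢))) : Prop :=
  ∀ g a, leftAct (act g a) (Φ.obj g) = rightAct (Φ.obj g) a

/-- `o` is the class of the associators `ω` attached to the choices of `J`; the existence of such an
`o` includes that the `ω` are cocycles, with a class independent of the choices. -/
def WeakSplitting.IsObstruction (Φ : WeakSplitting Ψ) (act : Γ →* MulAut (Aut (𝟙_ 𝒢)))
    (o : H₃ act) : Prop :=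
  ∀ J : (∀ g h, Φ.obj g ⊗ Φ.obj h ≅ Φ.obj (g * h)),
    ∃ ω : (d₃ act).ker, Φ.IsAssociator J ω.1 ∧ (QuotientGroup.mk ω : H₃ act) = o

/-- A splitting `S` of categorical groups refines a splitting `Φ` at the level of ordinary groups. -/
def WeakSplitting.IsRefinedBy (Φ : WeakSplitting Ψ) (S : Splitting Ψ) : Prop :=
  ∀ g, Nonempty (S.functor.obj ⟨g⟩ ≅ Φ.obj g)

end Obstruction

/-! ### Semisimple categories and extension of scalars -/

section Semisimple

/-- A semisimple abelian category: an abelian category in which every object is a finite direct sum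
of simple objects. (A mixin on top of a given preadditive structure.) -/
class IsSemisimpleAbelian (C : Type u) [Category.{v} C] [Preadditive C] : Prop where
  hasFiniteProducts : HasFiniteProducts C
  hasKernels : HasKernels C
  hasCokernels : HasCokernels C
  normalMono : IsNormalMonoCategory C
  normalEpi : IsNormalEpiCategory C
  exists_simple_decomposition (X : C) : ∃ (n : ℕ) (S : Fin n → C) (b : Bicone S),
    (∀ i, Simple (S i)) ∧ Nonempty b.IsBilimit ∧ Nonempty (X ≅ b.pt)

/-- A linear category has finite-dimensional spaces of morphisms. -/
class HomFinite (k : Type w) [Field k] (C : Type u) [Category.{v} C] [Preadditive C]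
    [Linear k C] : Prop where
  finite : ∀ X Y : C, Module.Finite k (X ⟶ Y)

/-- A monoidal category is rigid: every object has a left and a right dual. -/
def IsRigid (C : Type u) [Category.{v} C] [MonoidalCategory C] : Prop :=
  ∀ X : C, Nonempty (HasLeftDual X) ∧ Nonempty (HasRightDual X)

/-- In a linear monoidal category, the endomorphisms of the unit object are the scalars. -/
def EndUnitIsScalar (k : Type w) [Field k] (C : Type u) [Category.{v} C] [Preadditive C]
    [Linear k C] [MonoidalCategory C] : Prop :=
  Function.Bijective fun a : k ↦ a • 𝟙 (𝟙_ C)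

end Semisimple

section ExtScalars

/-- The category obtained from a `K`-linear category `D` by extending scalars from `K` to `L` in the
spaces of morphisms. -/
@[nolint unusedArguments]
structure ExtScalars (K L : Type w) (D : Type u) where
  of : D

variable (K L : Type w) [Field K] [Field L] [Algebra K L]
variable (D : Type u) [Category.{v} D] [Preadditive D] [Linear K D]

namespace ExtScalars

variable {D} {K L}

/-- Composition: `(a ⊗ f) ≫ (b ⊗ g) = (a * b) ⊗ (f ≫ g)`. -/
noncomputable def compL (X Y Z : D) :
    L ⊗[K] (X ⟶ Y) →ₗ[K] L ⊗[K] (Y ⟶ Z) →ₗ[K] L ⊗[K] (X ⟶ Z) :=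
  TensorProduct.map₂ (LinearMap.mul K L) (Linear.comp X Y Z)

@[simp] theorem compL_tmul {X Y Z : D} (a b : L) (f : X ⟶ Y) (g : Y ⟶ Z) :
    compL (K := K) X Y Z (a ⊗ₜ f) (b ⊗ₜ g) = (a * b) ⊗ₜ (f ≫ g) := rfl

noncomputable instance : CategoryStruct (ExtScalars K L D) where
  Hom X Y := L ⊗[K] (X.of ⟶ Y.of)
  id X := (1 : L) ⊗ₜ[K] 𝟙 X.of
  comp f g := compL _ _ _ f g

theorem comp_def {X Y Z : ExtScalars K L D} (f : X ⟶ Y) (g : Y ⟶ Z) :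
    f ≫ g = compL _ _ _ f g := rfl

/-- The morphism `a ⊗ f`. -/
noncomputable def tmul {X Y : ExtScalars K L D} (a : L) (f : X.of ⟶ Y.of) : X ⟶ Y := a ⊗ₜ[K] f

noncomputable instance (X Y : ExtScalars K L D) : AddCommGroup (X ⟶ Y) :=
  inferInstanceAs (AddCommGroup (L ⊗[K] (X.of ⟶ Y.of)))

noncomputable instance (X Y : ExtScalars K L D) : Module L (X ⟶ Y) :=
  inferInstanceAs (Module L (L ⊗[K] (X.of ⟶ Y.of)))

theorem tmul_comp {X Y Z : ExtScalars K L D} (a b : L) (f : X.of ⟶ Y.of) (g : Y.of ⟶ Z.of) :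
    (tmul a f : X ⟶ Y) ≫ (tmul b g : Y ⟶ Z) = tmul (a * b) (f ≫ g) := rfl

theorem tmul_congr {X Y : ExtScalars K L D} {a b : L} {f g : X.of ⟶ Y.of} (h : a = b)
    (h' : f = g) : (tmul a f : X ⟶ Y) = tmul b g := by rw [h, h']

theorem id_eq (X : ExtScalars K L D) : 𝟙 X = tmul 1 (𝟙 X.of) := rfl

@[elab_as_elim]
theorem induction {X Y : ExtScalars K L D} {p : (X ⟶ Y) → Prop} (f : X ⟶ Y)
    (zero : p 0) (tmul : ∀ a f, p (tmul a f)) (add : ∀ f g, p f → p g → p (f + g)) : p f :=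
  TensorProduct.induction_on f zero tmul add

theorem add_comp' {X Y Z : ExtScalars K L D} (f f' : X ⟶ Y) (g : Y ⟶ Z) :
    (f + f') ≫ g = f ≫ g + f' ≫ g :=
  LinearMap.map_add₂ (compL (K := K) (L := L) X.of Y.of Z.of) f f' g

theorem comp_add' {X Y Z : ExtScalars K L D} (f : X ⟶ Y) (g g' : Y ⟶ Z) :
    f ≫ (g + g') = f ≫ g + f ≫ g' :=
  map_add (compL (K := K) (L := L) X.of Y.of Z.of f) g g'

theorem zero_comp' {X Y Z : ExtScalars K L D} (g : Y ⟶ Z) : (0 : X ⟶ Y) ≫ g = 0 :=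
  LinearMap.map_zero₂ (compL (K := K) (L := L) X.of Y.of Z.of) g

theorem comp_zero' {X Y Z : ExtScalars K L D} (f : X ⟶ Y) : f ≫ (0 : Y ⟶ Z) = 0 :=
  map_zero (compL (K := K) (L := L) X.of Y.of Z.of f)

noncomputable instance : Category (ExtScalars K L D) where
  id_comp f := by
    induction f using induction with
    | zero => exact comp_zero' _
    | tmul a f => rw [id_eq, tmul_comp, one_mul, Category.id_comp]
    | add f g hf hg => rw [comp_add', hf, hg]
  comp_id f := by
    induction f using induction with
    | zero => exact zero_comp' _
    | tmul a f => rw [id_eq, tmul_comp, mul_one, Category.comp_id]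
    | add f g hf hg => rw [add_comp', hf, hg]
  assoc f g h := by
    induction f using induction with
    | zero => simp only [zero_comp']
    | add f f' hf hf' => simp only [add_comp', hf, hf']
    | tmul a f =>
      induction g using induction with
      | zero => simp only [zero_comp', comp_zero']
      | add g g' hg hg' => simp only [add_comp', comp_add', hg, hg']
      | tmul b g =>
        induction h using induction with
        | zero => simp only [comp_zero']
        | add h h' hh hh' => simp only [comp_add', hh, hh']
        | tmul c h => simp only [tmul_comp, mul_assoc, Category.assoc]

noncomputable instance : Preadditive (ExtScalars K L D) where
  homGroup X Y := inferInstance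
  add_comp X Y Z f f' g := by exact add_comp' f f' g
  comp_add X Y Z f g g' := by exact comp_add' f g g'

theorem smul_tmul' {X Y : ExtScalars K L D} (a b : L) (f : X.of ⟶ Y.of) :
    a • (tmul b f : X ⟶ Y) = tmul (a * b) f := rfl

noncomputable instance : Linear L (ExtScalars K L D) where
  smul_comp X Y Z r f g := by
    induction f using induction with
    | zero => simp
    | add f f' hf hf' => simp [hf, hf']
    | tmul a f =>
      induction g using induction with
      | zero => simp
      | add g g' hg hg' => simp only [Preadditive.comp_add, hg, hg', smul_add]
      | tmul b g => simp only [tmul_comp, smul_tmul', mul_assoc]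
  comp_smul X Y Z f r g := by
    induction f using induction with
    | zero => simp
    | add f f' hf hf' => simp [hf, hf']
    | tmul a f =>
      induction g using induction with
      | zero => simp
      | add g g' hg hg' => simp only [Preadditive.comp_add, hg, hg', smul_add]
      | tmul b g => simp only [tmul_comp, smul_tmul', mul_left_comm]

variable (K L D) in
/-- The canonical functor `X ↦ X`, `f ↦ 1 ⊗ f`. -/
@[simps]
noncomputable def incl : D ⥤ ExtScalars K L D where
  obj X := ⟨X⟩
  map f := tmul 1 f
  map_id _ := rfl
  map_comp f g := by rw [tmul_comp, one_mul]

section Monoidal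

variable [MonoidalCategory D] [MonoidalPreadditive D] [MonoidalLinear K D]

/-- `id_X ⊗ (a ⊗ f) = a ⊗ (id_X ⊗ f)`. -/
noncomputable def whiskerL (X : D) (Y Z : D) : L ⊗[K] (Y ⟶ Z) →ₗ[K] L ⊗[K] (X ⊗ Y ⟶ X ⊗ Z) :=
  LinearMap.lTensor L ((tensorLeft X).mapLinearMap K)

/-- `(a ⊗ f) ⊗ id_X = a ⊗ (f ⊗ id_X)`. -/
noncomputable def whiskerR (Y Z : D) (X : D) : L ⊗[K] (Y ⟶ Z) →ₗ[K] L ⊗[K] (Y ⊗ X ⟶ Z ⊗ X) :=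
  LinearMap.lTensor L ((tensorRight X).mapLinearMap K)

noncomputable instance : MonoidalCategoryStruct (ExtScalars K L D) where
  tensorObj X Y := ⟨X.of ⊗ Y.of⟩
  tensorUnit := ⟨𝟙_ D⟩
  whiskerLeft X _ _ f := whiskerL X.of _ _ f
  whiskerRight f X := whiskerR _ _ X.of f
  associator X Y Z := (incl K L D).mapIso (α_ X.of Y.of Z.of)
  leftUnitor X := (incl K L D).mapIso (λ_ X.of)
  rightUnitor X := (incl K L D).mapIso (ρ_ X.of)

@[simp] theorem tensorObj_of (X Y : ExtScalars K L D) : (X ⊗ Y).of = X.of ⊗ Y.of := rfl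
@[simp] theorem tensorUnit_of : (𝟙_ (ExtScalars K L D)).of = 𝟙_ D := rfl

theorem whiskerLeft_tmul (X : ExtScalars K L D) {Y Z : ExtScalars K L D} (a : L)
    (f : Y.of ⟶ Z.of) : X ◁ (tmul a f : Y ⟶ Z) = tmul a (X.of ◁ f) := rfl
theorem tmul_whiskerRight {Y Z : ExtScalars K L D} (a : L)
    (f : Y.of ⟶ Z.of) (X : ExtScalars K L D) : (tmul a f : Y ⟶ Z) ▷ X = tmul a (f ▷ X.of) := rfl
theorem whiskerLeft_add' (X : ExtScalars K L D) {Y Z : ExtScalars K L D} (f g : Y ⟶ Z) :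
    X ◁ (f + g) = X ◁ f + X ◁ g := map_add (whiskerL (K := K) (L := L) X.of Y.of Z.of) f g
theorem whiskerLeft_zero' (X : ExtScalars K L D) {Y Z : ExtScalars K L D} :
    X ◁ (0 : Y ⟶ Z) = 0 := map_zero (whiskerL (K := K) (L := L) X.of Y.of Z.of)
theorem add_whiskerRight' {Y Z : ExtScalars K L D} (f g : Y ⟶ Z) (X : ExtScalars K L D) :
    (f + g) ▷ X = f ▷ X + g ▷ X := map_add (whiskerR (K := K) (L := L) Y.of Z.of X.of) f g
theorem zero_whiskerRight' {Y Z : ExtScalars K L D} (X : ExtScalars K L D) :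
    (0 : Y ⟶ Z) ▷ X = 0 := map_zero (whiskerR (K := K) (L := L) Y.of Z.of X.of)
theorem associator_hom_eq (X Y Z : ExtScalars K L D) :
    (α_ X Y Z).hom = tmul 1 (α_ X.of Y.of Z.of).hom := rfl
theorem associator_inv_eq (X Y Z : ExtScalars K L D) :
    (α_ X Y Z).inv = tmul 1 (α_ X.of Y.of Z.of).inv := rfl
theorem leftUnitor_hom_eq (X : ExtScalars K L D) : (λ_ X).hom = tmul 1 (λ_ X.of).hom := rfl
theorem rightUnitor_hom_eq (X : ExtScalars K L D) : (ρ_ X).hom = tmul 1 (ρ_ X.of).hom := rfl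

theorem tmul_tensorHom {X₁ Y₁ X₂ Y₂ : ExtScalars K L D} (a b : L) (f : X₁.of ⟶ Y₁.of)
    (g : X₂.of ⟶ Y₂.of) :
    (tmul a f : X₁ ⟶ Y₁) ⊗ₘ (tmul b g : X₂ ⟶ Y₂) = tmul (a * b) (f ⊗ₘ g) := by
  change tmul a (f ▷ X₂.of) ≫ tmul b (Y₁.of ◁ g) = _
  rw [tmul_comp, MonoidalCategory.tensorHom_def]
theorem tensorHom_def' {X₁ Y₁ X₂ Y₂ : ExtScalars K L D} (f : X₁ ⟶ Y₁) (g : X₂ ⟶ Y₂) :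
    f ⊗ₘ g = f ▷ X₂ ≫ Y₁ ◁ g := rfl
theorem add_tensorHom' {X₁ Y₁ X₂ Y₂ : ExtScalars K L D} (f f' : X₁ ⟶ Y₁) (g : X₂ ⟶ Y₂) :
    (f + f') ⊗ₘ g = f ⊗ₘ g + f' ⊗ₘ g := by
  simp only [tensorHom_def', add_whiskerRight', Preadditive.add_comp]
theorem tensorHom_add' {X₁ Y₁ X₂ Y₂ : ExtScalars K L D} (f : X₁ ⟶ Y₁) (g g' : X₂ ⟶ Y₂) :
    f ⊗ₘ (g + g') = f ⊗ₘ g + f ⊗ₘ g' := by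
  simp only [tensorHom_def', whiskerLeft_add', Preadditive.comp_add]
theorem zero_tensorHom' {X₁ Y₁ X₂ Y₂ : ExtScalars K L D} (g : X₂ ⟶ Y₂) :
    (0 : X₁ ⟶ Y₁) ⊗ₘ g = 0 := by
  simp only [tensorHom_def', zero_whiskerRight', Limits.zero_comp]
theorem tensorHom_zero' {X₁ Y₁ X₂ Y₂ : ExtScalars K L D} (f : X₁ ⟶ Y₁) :
    f ⊗ₘ (0 : X₂ ⟶ Y₂) = 0 := by
  simp only [tensorHom_def', whiskerLeft_zero', Limits.comp_zero]

theorem interchange {X₁ Y₁ Z₁ X₂ Y₂ Z₂ : ExtScalars K L D} (f₁ : X₁ ⟶ Y₁) (f₂ : X₂ ⟶ Y₂)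
    (g₁ : Y₁ ⟶ Z₁) (g₂ : Y₂ ⟶ Z₂) :
    (f₁ ⊗ₘ f₂) ≫ (g₁ ⊗ₘ g₂) = (f₁ ≫ g₁) ⊗ₘ (f₂ ≫ g₂) := by
  induction f₁ using induction with
  | zero => simp only [zero_tensorHom', Limits.zero_comp]
  | add f f' h h' => simp only [add_tensorHom', Preadditive.add_comp, h, h']
  | tmul a f =>
  induction f₂ using induction with
  | zero => simp only [tensorHom_zero', Limits.zero_comp]
  | add f f' h h' => simp only [tensorHom_add', Preadditive.add_comp, h, h']
  | tmul b f' =>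
  induction g₁ using induction with
  | zero => simp only [zero_tensorHom', Limits.comp_zero]
  | add f f' h h' => simp only [add_tensorHom', Preadditive.comp_add, h, h']
  | tmul c g =>
  induction g₂ using induction with
  | zero => simp only [tensorHom_zero', Limits.comp_zero]
  | add f f' h h' => simp only [tensorHom_add', Preadditive.comp_add, h, h']
  | tmul d g' =>
  rw [tmul_tensorHom, tmul_tensorHom, tmul_comp, tmul_comp, tmul_comp, tmul_tensorHom,
    MonoidalCategory.tensorHom_comp_tensorHom, mul_mul_mul_comm]

theorem assoc_natural {X₁ X₂ X₃ Y₁ Y₂ Y₃ : ExtScalars K L D} (f₁ : X₁ ⟶ Y₁) (f₂ : X₂ ⟶ Y₂)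
    (f₃ : X₃ ⟶ Y₃) :
    ((f₁ ⊗ₘ f₂) ⊗ₘ f₃) ≫ (α_ Y₁ Y₂ Y₃).hom = (α_ X₁ X₂ X₃).hom ≫ (f₁ ⊗ₘ (f₂ ⊗ₘ f₃)) := by
  induction f₁ using induction with
  | zero => simp only [zero_tensorHom', Limits.zero_comp, Limits.comp_zero]
  | add f f' h h' => simp only [add_tensorHom', Preadditive.add_comp, Preadditive.comp_add, h, h']
  | tmul a f =>
  induction f₂ using induction with
  | zero => simp only [tensorHom_zero', zero_tensorHom', Limits.zero_comp, Limits.comp_zero]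
  | add f f' h h' =>
    simp only [tensorHom_add', add_tensorHom', Preadditive.add_comp, Preadditive.comp_add, h, h']
  | tmul b f' =>
  induction f₃ using induction with
  | zero => simp only [tensorHom_zero', Limits.zero_comp, Limits.comp_zero]
  | add f f' h h' => simp only [tensorHom_add', Preadditive.add_comp, Preadditive.comp_add, h, h']
  | tmul c f'' =>
  rw [tmul_tensorHom, tmul_tensorHom, tmul_tensorHom, tmul_tensorHom, associator_hom_eq,
    associator_hom_eq, tmul_comp, tmul_comp]
  exact tmul_congr (by ring) (MonoidalCategory.associator_naturality _ _ _)

noncomputable instance : MonoidalCategory (ExtScalars K L D) where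
  tensorHom_def f g := rfl
  id_tensorHom_id X Y := by
    rw [id_eq, id_eq, tmul_tensorHom, MonoidalCategory.id_tensorHom_id, one_mul]; rfl
  tensorHom_comp_tensorHom := interchange
  whiskerLeft_id X Y := by
    rw [id_eq, whiskerLeft_tmul, MonoidalCategory.whiskerLeft_id]; rfl
  id_whiskerRight X Y := by
    rw [id_eq, tmul_whiskerRight, MonoidalCategory.id_whiskerRight]; rfl
  associator_naturality := assoc_natural
  leftUnitor_naturality f := by
    induction f using induction with
    | zero => simp only [whiskerLeft_zero', Limits.zero_comp, Limits.comp_zero]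
    | add f f' h h' => simp only [whiskerLeft_add', Preadditive.add_comp, Preadditive.comp_add, h, h']
    | tmul a f =>
      rw [whiskerLeft_tmul, leftUnitor_hom_eq, leftUnitor_hom_eq, tmul_comp, tmul_comp]
      exact tmul_congr (by ring) (MonoidalCategory.leftUnitor_naturality _)
  rightUnitor_naturality f := by
    induction f using induction with
    | zero => simp only [zero_whiskerRight', Limits.zero_comp, Limits.comp_zero]
    | add f f' h h' =>
      simp only [add_whiskerRight', Preadditive.add_comp, Preadditive.comp_add, h, h']
    | tmul a f =>
      rw [tmul_whiskerRight, rightUnitor_hom_eq, rightUnitor_hom_eq, tmul_comp, tmul_comp]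
      exact tmul_congr (by ring) (MonoidalCategory.rightUnitor_naturality _)
  pentagon W X Y Z := by
    simp only [associator_hom_eq, tmul_whiskerRight, whiskerLeft_tmul, tmul_comp]
    exact tmul_congr (by ring) (MonoidalCategory.pentagon _ _ _ _)
  triangle X Y := by
    simp only [associator_hom_eq, leftUnitor_hom_eq, rightUnitor_hom_eq, tmul_whiskerRight,
      whiskerLeft_tmul, tmul_comp]
    exact tmul_congr (by ring) (MonoidalCategory.triangle _ _)

noncomputable instance : (incl K L D).Monoidal :=
  Functor.CoreMonoidal.toMonoidal
    { εIso := Iso.refl _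
      μIso := fun _ _ ↦ Iso.refl _
      μIso_hom_natural_left := fun f X' ↦ by
        dsimp; erw [Category.comp_id, Category.id_comp]; rfl
      μIso_hom_natural_right := fun X' f ↦ by
        dsimp; erw [Category.comp_id, Category.id_comp]; rfl
      associativity := fun X Y Z ↦ by
        dsimp
        erw [MonoidalCategory.id_whiskerRight, MonoidalCategory.whiskerLeft_id, Category.comp_id,
          Category.id_comp, Category.id_comp, Category.comp_id]
        rfl
      left_unitality := fun X ↦ by
        dsimp
        erw [MonoidalCategory.id_whiskerRight, Category.id_comp, Category.id_comp]
        rfl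
      right_unitality := fun X ↦ by
        dsimp
        erw [MonoidalCategory.whiskerLeft_id, Category.id_comp, Category.id_comp]
        rfl }

variable [BraidedCategory D]

noncomputable instance : BraidedCategory (ExtScalars K L D) where
  braiding X Y := (incl K L D).mapIso (β_ X.of Y.of)
  braiding_naturality_right X Y Z f := by
    change X ◁ f ≫ tmul 1 (β_ X.of Z.of).hom = tmul 1 (β_ X.of Y.of).hom ≫ f ▷ X
    induction f using induction with
    | zero => simp only [whiskerLeft_zero', zero_whiskerRight', Limits.zero_comp, Limits.comp_zero]
    | add f f' h h' =>
      simp only [whiskerLeft_add', add_whiskerRight', Preadditive.add_comp, Preadditive.comp_add,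
        h, h']
    | tmul a f =>
      rw [whiskerLeft_tmul, tmul_whiskerRight, tmul_comp, tmul_comp]
      exact tmul_congr (by ring) (BraidedCategory.braiding_naturality_right _ _)
  braiding_naturality_left {X Y} f Z := by
    change f ▷ Z ≫ tmul 1 (β_ Y.of Z.of).hom = tmul 1 (β_ X.of Z.of).hom ≫ Z ◁ f
    induction f using induction with
    | zero => simp only [whiskerLeft_zero', zero_whiskerRight', Limits.zero_comp, Limits.comp_zero]
    | add f f' h h' =>
      simp only [whiskerLeft_add', add_whiskerRight', Preadditive.add_comp, Preadditive.comp_add,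
        h, h']
    | tmul a f =>
      rw [whiskerLeft_tmul, tmul_whiskerRight, tmul_comp, tmul_comp]
      exact tmul_congr (by ring) (BraidedCategory.braiding_naturality_left _ _)
  hexagon_forward X Y Z := by
    change tmul 1 (α_ X.of Y.of Z.of).hom ≫ tmul 1 (β_ X.of (Y.of ⊗ Z.of)).hom ≫
      tmul 1 (α_ Y.of Z.of X.of).hom = tmul 1 ((β_ X.of Y.of).hom ▷ Z.of) ≫
      tmul 1 (α_ Y.of X.of Z.of).hom ≫ tmul 1 (Y.of ◁ (β_ X.of Z.of).hom)
    simp only [tmul_comp]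
    exact tmul_congr (by ring) (BraidedCategory.hexagon_forward _ _ _)
  hexagon_reverse X Y Z := by
    change tmul 1 (α_ X.of Y.of Z.of).inv ≫ tmul 1 (β_ (X.of ⊗ Y.of) Z.of).hom ≫
      tmul 1 (α_ Z.of X.of Y.of).inv = tmul 1 (X.of ◁ (β_ Y.of Z.of).hom) ≫
      tmul 1 (α_ X.of Z.of Y.of).inv ≫ tmul 1 ((β_ X.of Z.of).hom ▷ Y.of)
    simp only [tmul_comp]
    exact tmul_congr (by ring) (BraidedCategory.hexagon_reverse _ _ _)

end Monoidal

end ExtScalars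
end ExtScalars


/-! ### Linear, monoidal and braided structures on the Karoubian envelope -/

section Karoubi

open Idempotents

variable {E : Type u} [Category.{v} E]

/-- The Karoubian envelope of a linear category is linear. -/
instance karoubiModule (k : Type w) [Semiring k] [Preadditive E] [Linear k E] (P Q : Karoubi E) :
    Module k (P ⟶ Q) where
  smul a f := ⟨a • f.f, by rw [Linear.smul_comp, Linear.comp_smul, f.comm]⟩
  one_smul f := Karoubi.hom_ext _ _ (one_smul k f.f)
  mul_smul a b f := Karoubi.hom_ext _ _ (mul_smul a b f.f)
  smul_zero a := Karoubi.hom_ext _ _ (smul_zero a)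
  smul_add a f g := Karoubi.hom_ext _ _ (smul_add a f.f g.f)
  add_smul a b f := Karoubi.hom_ext _ _ (add_smul a b f.f)
  zero_smul f := Karoubi.hom_ext _ _ (zero_smul k f.f)

instance karoubiLinear (k : Type w) [Semiring k] [Preadditive E] [Linear k E] :
    Linear k (Karoubi E) where
  homModule := karoubiModule k
  smul_comp _ _ _ a f g := Karoubi.hom_ext _ _ (Linear.smul_comp _ _ _ a f.f g.f)
  comp_smul _ _ _ f a g := Karoubi.hom_ext _ _ (Linear.comp_smul _ _ _ f.f a g.f)

variable [MonoidalCategory E]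

/-- `(X, p) ⊗ (Y, q) = (X ⊗ Y, p ⊗ q)`. -/
@[simps, reducible]
def karoubiTensorObj (P Q : Karoubi E) : Karoubi E := ⟨P.X ⊗ Q.X, P.p ⊗ₘ Q.p, by simp⟩

/-- The tensor product of morphisms in the Karoubian envelope. -/
@[simps, reducible]
def karoubiTensorHom {P P' Q Q' : Karoubi E} (f : P ⟶ P') (g : Q ⟶ Q') :
    karoubiTensorObj P Q ⟶ karoubiTensorObj P' Q' :=
  ⟨f.f ⊗ₘ g.f, by simp⟩

theorem karoubi_pentagon_aux {P Q R S : E} (p : P ⟶ P) (q : Q ⟶ Q) (r : R ⟶ R) (s : S ⟶ S)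
    (hp : p ≫ p = p) (hq : q ≫ q = q) (hr : r ≫ r = r) (hs : s ≫ s = s) :
    ((((p ⊗ₘ q) ⊗ₘ r) ≫ (α_ P Q R).hom) ⊗ₘ s) ≫ (((p ⊗ₘ (q ⊗ₘ r)) ⊗ₘ s) ≫ (α_ P (Q ⊗ R) S).hom) ≫
      (p ⊗ₘ (((q ⊗ₘ r) ⊗ₘ s) ≫ (α_ Q R S).hom)) =
    ((((p ⊗ₘ q) ⊗ₘ r) ⊗ₘ s) ≫ (α_ (P ⊗ Q) R S).hom) ≫
      ((p ⊗ₘ q) ⊗ₘ (r ⊗ₘ s)) ≫ (α_ P Q (R ⊗ S)).hom := by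
  have h1 : (((p ⊗ₘ q) ⊗ₘ r) ≫ (α_ P Q R).hom) ⊗ₘ s =
      (α_ P Q R).hom ▷ S ≫ ((p ⊗ₘ (q ⊗ₘ r)) ⊗ₘ s) := by
    rw [associator_naturality, ← tensorHom_id, tensorHom_comp_tensorHom, Category.id_comp]
  have h2 : p ⊗ₘ (((q ⊗ₘ r) ⊗ₘ s) ≫ (α_ Q R S).hom) =
      P ◁ (α_ Q R S).hom ≫ (p ⊗ₘ (q ⊗ₘ (r ⊗ₘ s))) := by
    rw [associator_naturality, ← id_tensorHom, tensorHom_comp_tensorHom, Category.id_comp]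
  have h3 : (p ⊗ₘ ((q ⊗ₘ r) ⊗ₘ s)) ≫ P ◁ (α_ Q R S).hom =
      P ◁ (α_ Q R S).hom ≫ (p ⊗ₘ (q ⊗ₘ (r ⊗ₘ s))) := by
    rw [← id_tensorHom, tensorHom_comp_tensorHom, tensorHom_comp_tensorHom, associator_naturality,
      Category.id_comp, Category.comp_id]
  rw [h1, h2]
  simp only [Category.assoc, associator_naturality_assoc, reassoc_of% h3, associator_naturality,
    pentagon_assoc, tensorHom_comp_tensorHom, hp, hq, hr, hs]

theorem karoubi_triangle_aux {P Q : E} (p : P ⟶ P) (q : Q ⟶ Q) (hp : p ≫ p = p) (hq : q ≫ q = q) :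
    (((p ⊗ₘ 𝟙 (𝟙_ E)) ⊗ₘ q) ≫ (α_ P (𝟙_ E) Q).hom) ≫ (p ⊗ₘ (𝟙_ E ◁ q ≫ (λ_ Q).hom)) =
      (p ▷ 𝟙_ E ≫ (ρ_ P).hom) ⊗ₘ q := by
  have h1 : p ⊗ₘ (𝟙_ E ◁ q ≫ (λ_ Q).hom) = P ◁ (λ_ Q).hom ≫ (p ⊗ₘ q) := by
    rw [leftUnitor_naturality, ← id_tensorHom, tensorHom_comp_tensorHom, Category.id_comp]
  have h2 : (p ▷ 𝟙_ E ≫ (ρ_ P).hom) ⊗ₘ q = (ρ_ P).hom ▷ Q ≫ (p ⊗ₘ q) := by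
    rw [rightUnitor_naturality, ← tensorHom_id, tensorHom_comp_tensorHom, Category.id_comp]
  have h3 : (p ⊗ₘ (𝟙 (𝟙_ E) ⊗ₘ q)) ≫ P ◁ (λ_ Q).hom = P ◁ (λ_ Q).hom ≫ (p ⊗ₘ q) := by
    rw [← id_tensorHom, tensorHom_comp_tensorHom, tensorHom_comp_tensorHom, id_tensorHom,
      leftUnitor_naturality, Category.id_comp, Category.comp_id]
  rw [h1, h2, associator_naturality, Category.assoc, reassoc_of% h3, triangle_assoc,
    tensorHom_comp_tensorHom, hp, hq]

@[simps]
instance : MonoidalCategoryStruct (Karoubi E) where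
  tensorObj := karoubiTensorObj
  tensorUnit := ⟨𝟙_ E, 𝟙 _, by simp⟩
  tensorHom := karoubiTensorHom
  whiskerLeft X _ _ f := karoubiTensorHom (𝟙 X) f
  whiskerRight f X := karoubiTensorHom f (𝟙 X)
  associator P Q R :=
    { hom := ⟨((P.p ⊗ₘ Q.p) ⊗ₘ R.p) ≫ (α_ P.X Q.X R.X).hom, by
        simp⟩
      inv := ⟨(P.p ⊗ₘ (Q.p ⊗ₘ R.p)) ≫ (α_ P.X Q.X R.X).inv, by
        simp⟩
      hom_inv_id := by ext; simp
      inv_hom_id := by ext; simp }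
  leftUnitor P :=
    { hom := ⟨(𝟙_ E ◁ P.p) ≫ (λ_ P.X).hom, by simp⟩
      inv := ⟨P.p ≫ (λ_ P.X).inv, by simp⟩
      hom_inv_id := by ext; simp
      inv_hom_id := by ext; simp }
  rightUnitor P :=
    { hom := ⟨(P.p ▷ 𝟙_ E) ≫ (ρ_ P.X).hom, by simp⟩
      inv := ⟨P.p ≫ (ρ_ P.X).inv, by simp⟩
      hom_inv_id := by ext; simp
      inv_hom_id := by ext; simp }

instance : MonoidalCategory (Karoubi E) where
  tensorHom_def f g := by ext; simp
  associator_naturality f g h := by ext; simp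
  leftUnitor_naturality f := by ext; simp
  rightUnitor_naturality f := by ext; simp
  pentagon P Q R S := Karoubi.hom_ext _ _
    (karoubi_pentagon_aux P.p Q.p R.p S.p P.idem Q.idem R.idem S.idem)
  triangle P Q := Karoubi.hom_ext _ _ (karoubi_triangle_aux P.p Q.p P.idem Q.idem)

instance : (toKaroubi E).Monoidal :=
  Functor.CoreMonoidal.toMonoidal
    { εIso := Iso.refl _
      μIso := fun X Y ↦
        { hom := ⟨𝟙 (X ⊗ Y), by simp⟩
          inv := ⟨𝟙 (X ⊗ Y), by simp⟩ }
      μIso_hom_natural_left := fun f X' ↦ by ext; simp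
      μIso_hom_natural_right := fun X' f ↦ by ext; simp
      associativity := fun X Y Z ↦ by ext; simp
      left_unitality := fun X ↦ by ext; simp
      right_unitality := fun X ↦ by ext; simp }

theorem karoubi_hexagon_forward_aux [BraidedCategory E] {P Q R : E} (p : P ⟶ P) (q : Q ⟶ Q)
    (r : R ⟶ R) (hp : p ≫ p = p) (hq : q ≫ q = q) (hr : r ≫ r = r) :
    (((p ⊗ₘ q) ⊗ₘ r) ≫ (α_ P Q R).hom) ≫ ((p ⊗ₘ (q ⊗ₘ r)) ≫ (β_ P (Q ⊗ R)).hom) ≫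
      (((q ⊗ₘ r) ⊗ₘ p) ≫ (α_ Q R P).hom) =
    (((p ⊗ₘ q) ≫ (β_ P Q).hom) ⊗ₘ r) ≫ (((q ⊗ₘ p) ⊗ₘ r) ≫ (α_ Q P R).hom) ≫
      (q ⊗ₘ ((p ⊗ₘ r) ≫ (β_ P R).hom)) := by
  have h1 : ((p ⊗ₘ q) ≫ (β_ P Q).hom) ⊗ₘ r = (β_ P Q).hom ▷ R ≫ ((q ⊗ₘ p) ⊗ₘ r) := by
    rw [BraidedCategory.braiding_naturality, ← tensorHom_id, tensorHom_comp_tensorHom,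
      Category.id_comp]
  have h2 : q ⊗ₘ ((p ⊗ₘ r) ≫ (β_ P R).hom) = Q ◁ (β_ P R).hom ≫ (q ⊗ₘ (r ⊗ₘ p)) := by
    rw [BraidedCategory.braiding_naturality, ← id_tensorHom, tensorHom_comp_tensorHom,
      Category.id_comp]
  have h3 : (q ⊗ₘ (p ⊗ₘ r)) ≫ Q ◁ (β_ P R).hom = Q ◁ (β_ P R).hom ≫ (q ⊗ₘ (r ⊗ₘ p)) := by
    rw [← id_tensorHom, tensorHom_comp_tensorHom, tensorHom_comp_tensorHom,
      BraidedCategory.braiding_naturality, Category.id_comp, Category.comp_id]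
  rw [h1, h2]
  simp only [Category.assoc, associator_naturality_assoc, reassoc_of% h3, associator_naturality,
    BraidedCategory.braiding_naturality_assoc, BraidedCategory.hexagon_forward_assoc,
    tensorHom_comp_tensorHom, hp, hq, hr]

theorem karoubi_hexagon_reverse_aux [BraidedCategory E] {P Q R : E} (p : P ⟶ P) (q : Q ⟶ Q)
    (r : R ⟶ R) (hp : p ≫ p = p) (hq : q ≫ q = q) (hr : r ≫ r = r) :
    ((p ⊗ₘ (q ⊗ₘ r)) ≫ (α_ P Q R).inv) ≫ (((p ⊗ₘ q) ⊗ₘ r) ≫ (β_ (P ⊗ Q) R).hom) ≫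
      ((r ⊗ₘ (p ⊗ₘ q)) ≫ (α_ R P Q).inv) =
    (p ⊗ₘ ((q ⊗ₘ r) ≫ (β_ Q R).hom)) ≫ ((p ⊗ₘ (r ⊗ₘ q)) ≫ (α_ P R Q).inv) ≫
      (((p ⊗ₘ r) ≫ (β_ P R).hom) ⊗ₘ q) := by
  have h1 : ((p ⊗ₘ r) ≫ (β_ P R).hom) ⊗ₘ q = (β_ P R).hom ▷ Q ≫ ((r ⊗ₘ p) ⊗ₘ q) := by
    rw [BraidedCategory.braiding_naturality, ← tensorHom_id, tensorHom_comp_tensorHom,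
      Category.id_comp]
  have h2 : p ⊗ₘ ((q ⊗ₘ r) ≫ (β_ Q R).hom) = P ◁ (β_ Q R).hom ≫ (p ⊗ₘ (r ⊗ₘ q)) := by
    rw [BraidedCategory.braiding_naturality, ← id_tensorHom, tensorHom_comp_tensorHom,
      Category.id_comp]
  have h3 : ((p ⊗ₘ r) ⊗ₘ q) ≫ (β_ P R).hom ▷ Q = (β_ P R).hom ▷ Q ≫ ((r ⊗ₘ p) ⊗ₘ q) := by
    rw [← tensorHom_id, tensorHom_comp_tensorHom, tensorHom_comp_tensorHom,
      BraidedCategory.braiding_naturality, Category.id_comp, Category.comp_id]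
  rw [h1, h2]
  simp only [Category.assoc, associator_inv_naturality_assoc, reassoc_of% h3,
    associator_inv_naturality, BraidedCategory.braiding_naturality_assoc,
    BraidedCategory.hexagon_reverse_assoc, tensorHom_comp_tensorHom, hp, hq, hr]

instance [BraidedCategory E] : BraidedCategory (Karoubi E) where
  braiding P Q :=
    { hom := ⟨(P.p ⊗ₘ Q.p) ≫ (β_ P.X Q.X).hom, by simp⟩
      inv := ⟨(Q.p ⊗ₘ P.p) ≫ (β_ P.X Q.X).inv, by simp⟩
      hom_inv_id := by ext; simp
      inv_hom_id := by ext; simp }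
  braiding_naturality_right P Q R f := by ext; simp
  braiding_naturality_left f R := by ext; simp
  hexagon_forward P Q R := Karoubi.hom_ext _ _
    (karoubi_hexagon_forward_aux P.p Q.p R.p P.idem Q.idem R.idem)
  hexagon_reverse P Q R := Karoubi.hom_ext _ _
    (karoubi_hexagon_reverse_aux P.p Q.p R.p P.idem Q.idem R.idem)

end Karoubi
/-! ### Forms of linear categories and of tensor categories -/

section Forms

variable (K L : Type w) [Field K] [Field L] [Algebra K L]

section

variable (D : Type*) [Category* D] [Preadditive D] [Linear K D]

/-- The category `D ⊗_K L`: the Karoubian envelope of the category obtained from `D` by extending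
scalars from `K` to `L` in the spaces of morphisms. -/
abbrev ScalarExtension := Idempotents.Karoubi (ExtScalars K L D)

/-- The canonical functor `D ⥤ D ⊗_K L`. -/
noncomputable abbrev toScalarExtension : D ⥤ ScalarExtension K L D :=
  ExtScalars.incl K L D ⋙ Idempotents.toKaroubi _

end

variable (D : Type*) [Category* D] [Preadditive D] [Linear K D]
  (C : Type*) [Category* C] [Preadditive C] [Linear L C]

/-- An `L`-linear equivalence `Ξ : D ⊗_K L ⟶ C`. -/
structure FormEquivalence where
  functor : ScalarExtension K L D ⥤ C
  [isEquivalence : functor.IsEquivalence]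
  [additive : functor.Additive]
  [linear : functor.Linear L]

/-- An `L`-linear tensor equivalence `Ξ : D ⊗_K L ⟶ C`. -/
structure TensorFormEquivalence [MonoidalCategory D] [MonoidalPreadditive D] [MonoidalLinear K D]
    [MonoidalCategory C] extends FormEquivalence K L D C where
  [monoidal : functor.Monoidal]

attribute [instance] TensorFormEquivalence.monoidal

/-- A monoidal functor between braided monoidal categories is braided. -/
def IsBraidedFunctor {C : Type*} [Category* C] [MonoidalCategory C] [BraidedCategory C]
    {D : Type*} [Category* D] [MonoidalCategory D] [BraidedCategory D] (F : C ⥤ D) [F.Monoidal] :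
    Prop :=
  ∀ X Y : C, Functor.LaxMonoidal.μ F X Y ≫ F.map (β_ X Y).hom =
    (β_ (F.obj X) (F.obj Y)).hom ≫ Functor.LaxMonoidal.μ F Y X

theorem IsBraidedFunctor.comp {C : Type*} [Category* C] [MonoidalCategory C] [BraidedCategory C]
    {F G : C ⥤ C} [F.Monoidal] [G.Monoidal] (hF : IsBraidedFunctor F)
    (hG : IsBraidedFunctor G) : IsBraidedFunctor (F ⋙ G) := fun X Y ↦ by
  simp only [Functor.comp_obj, Functor.LaxMonoidal.comp_μ, Functor.comp_map, Category.assoc]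
  rw [← G.map_comp, hF, G.map_comp, reassoc_of% (hG (F.obj X) (F.obj Y))]

end Forms

section HasForm

variable (K L : Type w) [Field K] [Field L] [Algebra K L]
  (C : Type u) [Category.{v} C] [Preadditive C] [Linear L C]

/-- `C` has a form over `K` as a semisimple abelian linear category. -/
def HasForm : Prop :=
  ∃ (D : Type max u v w) (_ : Category.{v} D) (_ : Preadditive D) (_ : Linear K D),
    IsSemisimpleAbelian D ∧ HomFinite K D ∧ Nonempty (FormEquivalence K L D C)

variable [MonoidalCategory C]

/-- `C` has a form over `K` as a semisimple tensor category. -/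
def HasTensorForm : Prop :=
  ∃ (D : Type max u v w) (_ : Category.{v} D) (_ : Preadditive D) (_ : Linear K D)
    (_ : MonoidalCategory D) (_ : MonoidalPreadditive D) (_ : MonoidalLinear K D),
    IsSemisimpleAbelian D ∧ HomFinite K D ∧ Nonempty (TensorFormEquivalence K L D C)

/-- `C` has a form over `K` as a semisimple braided tensor category. -/
def HasBraidedForm [BraidedCategory C] : Prop :=
  ∃ (D : Type max u v w) (_ : Category.{v} D) (_ : Preadditive D) (_ : Linear K D)
    (_ : MonoidalCategory D) (_ : MonoidalPreadditive D) (_ : MonoidalLinear K D)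
    (_ : BraidedCategory D),
    IsSemisimpleAbelian D ∧ HomFinite K D ∧
      ∃ Ξ : TensorFormEquivalence K L D C, IsBraidedFunctor Ξ.functor

end HasForm

/-! ### Twisted auto-equivalences -/

section Twisted

variable (K L : Type w) [Field K] [Field L] [Algebra K L]
  (C : Type u) [Category.{v} C] [Preadditive C] [Linear L C]

variable {K L} in
/-- The `L`-linear structure of the category `ᵍC`, which has the same underlying category as `C`:
`a` acts on the morphisms of `ᵍC` as `g⁻¹ a` acts on the morphisms of `C`. -/
@[reducible]
def twistLinear (g : L ≃ₐ[K] L) : Linear L C where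
  homModule X Y := Module.compHom (X ⟶ Y) ((g⁻¹ : L ≃ₐ[K] L) : L →+* L)
  smul_comp _ _ _ a f h := Linear.smul_comp _ _ _ (g⁻¹ a) f h
  comp_smul _ _ _ f a h := Linear.comp_smul _ _ _ f (g⁻¹ a) h

/-- A twisted auto-equivalence of `C`: a pair of `g` in the Galois group and an `L`-linear
equivalence `ᵍC ⟶ C`. -/
structure TwistedAut where
  g : L ≃ₐ[K] L
  functor : C ⥤ C
  isEquivalence : functor.IsEquivalence
  additive : functor.Additive
  linear : @Functor.Linear L _ C C _ _ _ _ (twistLinear C g) _ functor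

attribute [instance] TwistedAut.isEquivalence TwistedAut.additive

namespace TwistedAut

variable {K L C}

theorem map_smul (X : TwistedAut K L C) {Y Z : C} (a : L) (f : Y ⟶ Z) :
    X.functor.map (a • f) = X.g a • X.functor.map f := by
  have h := X.linear.map_smul f (X.g a)
  rw [← h]
  change _ = X.functor.map ((X.g⁻¹ (X.g a)) • f)
  congr 2
  exact (X.g.symm_apply_apply a).symm

/-- Constructor from the semilinearity of the functor. -/
theorem linear_of_map_smul (g : L ≃ₐ[K] L) (F : C ⥤ C)
    (h : ∀ {Y Z : C} (a : L) (f : Y ⟶ Z), F.map (a • f) = g a • F.map f) :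
    @Functor.Linear L _ C C _ _ _ _ (twistLinear C g) _ F :=
  @Functor.Linear.mk L _ C C _ _ _ _ (twistLinear C g) _ F (fun f a ↦ by
    change F.map ((g⁻¹ a) • f) = _
    rw [h]
    congr 1
    exact g.apply_symm_apply a)

/-- Morphisms of twisted auto-equivalences: there is none unless the elements of the Galois group
agree, and then these are the isomorphisms of functors. -/
@[ext]
structure Hom (X Y : TwistedAut K L C) where
  g_eq : X.g = Y.g
  iso : X.functor ≅ Y.functor

@[simps id_iso comp_iso]
instance : Category (TwistedAut K L C) where
  Hom := Hom
  id X := ⟨rfl, Iso.refl _⟩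
  comp f h := ⟨f.g_eq.trans h.g_eq, f.iso ≪≫ h.iso⟩

@[ext]
theorem hom_ext {X Y : TwistedAut K L C} {f h : X ⟶ Y}
    (e : ∀ Z, f.iso.hom.app Z = h.iso.hom.app Z) : f = h :=
  Hom.ext (by ext Z; exact e Z)

/-- Isomorphisms of twisted auto-equivalences. -/
@[simps]
def mkIso {X Y : TwistedAut K L C} (e : X.g = Y.g) (i : X.functor ≅ Y.functor) : X ≅ Y where
  hom := ⟨e, i⟩
  inv := ⟨e.symm, i.symm⟩

/-- The composition `(g, Φ) ∘ (h, Φ') = (gh, Φ ∘ g(Φ'))`. -/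
@[simps, reducible]
def tensor (X Y : TwistedAut K L C) : TwistedAut K L C where
  g := X.g * Y.g
  functor := Y.functor ⋙ X.functor
  isEquivalence := inferInstance
  additive := inferInstance
  linear := linear_of_map_smul _ _ fun a f ↦ by
    simp [map_smul]

/-- The identity `(1, Id)`. -/
@[simps, reducible]
def unit : TwistedAut K L C where
  g := 1
  functor := 𝟭 C
  isEquivalence := inferInstance
  additive := inferInstance
  linear := linear_of_map_smul _ _ fun a f ↦ by simp

@[simps]
instance : MonoidalCategoryStruct (TwistedAut K L C) where
  tensorObj := tensor
  tensorUnit := unit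
  whiskerLeft X _ _ f := ⟨by simp [f.g_eq], Functor.isoWhiskerRight f.iso X.functor⟩
  whiskerRight f Z := ⟨by simp [f.g_eq], Functor.isoWhiskerLeft Z.functor f.iso⟩
  associator X Y Z := mkIso (mul_assoc _ _ _) (Functor.associator _ _ _).symm
  leftUnitor X := mkIso (one_mul _) (Functor.rightUnitor _)
  rightUnitor X := mkIso (mul_one _) (Functor.leftUnitor _)

instance : MonoidalCategory (TwistedAut K L C) where
  tensorHom_def f g := rfl

variable (K L C) in
/-- The homomorphism of categorical groups `Ψ : Aut_K(C) ⟶ Γ`, `(g, Φ) ↦ g`. Its kernel consists of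
the `L`-linear auto-equivalences of `C`. -/
def toGalois : TwistedAut K L C ⥤ Discrete (L ≃ₐ[K] L) where
  obj X := ⟨X.g⟩
  map f := Discrete.eqToHom f.g_eq

instance : (toGalois K L C).Monoidal :=
  Functor.CoreMonoidal.toMonoidal
    { εIso := Iso.refl _
      μIso := fun _ _ ↦ Iso.refl _ }

end TwistedAut

end Twisted
section TwistedTensor

variable (K L : Type w) [Field K] [Field L] [Algebra K L]
  (C : Type u) [Category.{v} C] [Preadditive C] [Linear L C] [MonoidalCategory C]

/-- A twisted tensor auto-equivalence of `C`: a pair of `g` in the Galois group and an `L`-linear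
tensor equivalence `ᵍC ⟶ C`. -/
structure TwistedTensorAut extends TwistedAut K L C where
  monoidal : functor.Monoidal

attribute [instance] TwistedTensorAut.monoidal

namespace TwistedTensorAut

variable {K L C}

/-- Morphisms of twisted tensor auto-equivalences: isomorphisms of tensor functors. -/
@[ext]
structure Hom (X Y : TwistedTensorAut K L C) where
  hom : X.toTwistedAut ⟶ Y.toTwistedAut
  isMonoidal : NatTrans.IsMonoidal hom.iso.hom

attribute [instance] Hom.isMonoidal

@[simps id_hom comp_hom]
instance : Category (TwistedTensorAut K L C) where
  Hom := Hom
  id X := ⟨𝟙 X.toTwistedAut, inferInstanceAs (NatTrans.IsMonoidal (𝟙 X.functor))⟩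
  comp f h := ⟨f.hom ≫ h.hom,
    inferInstanceAs (NatTrans.IsMonoidal (f.hom.iso.hom ≫ h.hom.iso.hom))⟩

@[ext]
theorem hom_ext {X Y : TwistedTensorAut K L C} {f h : X ⟶ Y} (e : f.hom = h.hom) : f = h :=
  Hom.ext e

/-- Isomorphisms of twisted tensor auto-equivalences. -/
@[simps]
def mkIso {X Y : TwistedTensorAut K L C} (e : X.g = Y.g) (i : X.functor ≅ Y.functor)
    [NatTrans.IsMonoidal i.hom] : X ≅ Y where
  hom := ⟨⟨e, i⟩, inferInstance⟩
  inv := ⟨⟨e.symm, i.symm⟩, inferInstanceAs (NatTrans.IsMonoidal i.inv)⟩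

/-- The composition `(g, Φ) ∘ (h, Φ') = (gh, Φ ∘ g(Φ'))`. -/
@[simps toTwistedAut, reducible]
def tensor (X Y : TwistedTensorAut K L C) : TwistedTensorAut K L C where
  toTwistedAut := TwistedAut.tensor X.toTwistedAut Y.toTwistedAut
  monoidal := (inferInstance : (Y.functor ⋙ X.functor).Monoidal)

/-- The identity `(1, Id)`. -/
@[simps toTwistedAut, reducible]
def unit : TwistedTensorAut K L C where
  toTwistedAut := TwistedAut.unit
  monoidal := (inferInstance : (𝟭 C).Monoidal)

@[simps]
instance : MonoidalCategoryStruct (TwistedTensorAut K L C) where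
  tensorObj := tensor
  tensorUnit := unit
  whiskerLeft X _ _ f := ⟨X.toTwistedAut ◁ f.hom,
    inferInstanceAs (NatTrans.IsMonoidal (Functor.whiskerRight f.hom.iso.hom X.functor))⟩
  whiskerRight f Z := ⟨f.hom ▷ Z.toTwistedAut,
    inferInstanceAs (NatTrans.IsMonoidal (Functor.whiskerLeft Z.functor f.hom.iso.hom))⟩
  associator X Y Z :=
    haveI : NatTrans.IsMonoidal (Functor.associator Z.functor Y.functor X.functor).symm.hom :=
      inferInstanceAs (NatTrans.IsMonoidal (Functor.associator _ _ _).inv)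
    mkIso (mul_assoc _ _ _) (Functor.associator Z.functor Y.functor X.functor).symm
  leftUnitor X := mkIso (one_mul _) (Functor.rightUnitor X.functor)
  rightUnitor X := mkIso (mul_one _) (Functor.leftUnitor X.functor)

instance : MonoidalCategory (TwistedTensorAut K L C) where
  tensorHom_def f g := rfl

variable (K L C) in
/-- The homomorphism of categorical groups `Ψ : Aut_K(C) ⟶ Γ`, `(g, Φ) ↦ g`. Its kernel consists of
the `L`-linear tensor auto-equivalences of `C`. -/
def toGalois : TwistedTensorAut K L C ⥤ Discrete (L ≃ₐ[K] L) where
  obj X := ⟨X.g⟩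
  map f := Discrete.eqToHom f.hom.g_eq

instance : (toGalois K L C).Monoidal :=
  Functor.CoreMonoidal.toMonoidal
    { εIso := Iso.refl _
      μIso := fun _ _ ↦ Iso.refl _ }

end TwistedTensorAut

variable [BraidedCategory C]

/-- The twisted tensor auto-equivalences which are braided. -/
def isBraided : ObjectProperty (TwistedTensorAut K L C) := fun X ↦ IsBraidedFunctor X.functor

instance : (isBraided K L C).IsMonoidal where
  prop_unit := fun X Y ↦ by simp
  prop_tensor X Y hX hY := IsBraidedFunctor.comp hY hX

/-- The categorical group of twisted braided auto-equivalences of `C`. -/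
abbrev TwistedBraidedAut := (isBraided K L C).FullSubcategory

/-- The homomorphism of categorical groups `Ψ : Aut_K(C) ⟶ Γ`, `(g, Φ) ↦ g`. -/
abbrev TwistedBraidedAut.toGalois : TwistedBraidedAut K L C ⥤ Discrete (L ≃ₐ[K] L) :=
  (isBraided K L C).ι ⋙ TwistedTensorAut.toGalois K L C

end TwistedTensor
/-! ### Inverses of twisted auto-equivalences, and the automorphisms of the unit object -/

section Aut

variable {K L : Type w} [Field K] [Field L] [Algebra K L]
  {C : Type u} [Category.{v} C] [Preadditive C] [Linear L C]

namespace TwistedAut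

/-- A quasi-inverse of a twisted auto-equivalence. -/
@[simps, reducible]
noncomputable def inverse (X : TwistedAut K L C) : TwistedAut K L C where
  g := X.g⁻¹
  functor := X.functor.inv
  isEquivalence := inferInstance
  additive :=
    have : X.functor.asEquivalence.functor.Additive := X.additive
    inferInstanceAs X.functor.asEquivalence.inverse.Additive
  linear := linear_of_map_smul _ _ fun a f ↦ by
    apply X.functor.map_injective
    rw [map_smul, ← AlgEquiv.mul_apply, mul_inv_cancel]
    simp [Functor.inv]

/-- The composition of a twisted auto-equivalence with its quasi-inverse. -/
noncomputable def inverseIso (X : TwistedAut K L C) : X ⊗ X.inverse ≅ 𝟙_ (TwistedAut K L C) :=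
  mkIso (mul_inv_cancel X.g) X.functor.asEquivalence.counitIso

/-- The composition of a twisted auto-equivalence with its quasi-inverse. -/
noncomputable def inverseIso' (X : TwistedAut K L C) : X.inverse ⊗ X ≅ 𝟙_ (TwistedAut K L C) :=
  mkIso (inv_mul_cancel X.g) X.functor.asEquivalence.unitIso.symm

instance : IsCategoricalGroup (TwistedAut K L C) where
  isIso f := (mkIso f.g_eq f.iso).isIso_hom
  exists_inverse X := ⟨X.inverse, ⟨X.inverseIso⟩, ⟨X.inverseIso'⟩⟩

/-- `π₂` of the categorical group of twisted auto-equivalences is `Aut(Id_C)`. -/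
@[simps]
def autUnitEquiv : Aut (𝟙_ (TwistedAut K L C)) ≃* Aut (𝟭 C) where
  toFun f := f.hom.iso
  invFun i := mkIso rfl i
  left_inv f := by ext; rfl
  right_inv i := rfl
  map_mul' _ _ := rfl

end TwistedAut

namespace TwistedTensorAut

variable [MonoidalCategory C]

/-- A quasi-inverse of a twisted tensor auto-equivalence. -/
noncomputable def inverse (X : TwistedTensorAut K L C) : TwistedTensorAut K L C where
  toTwistedAut := X.toTwistedAut.inverse
  monoidal :=
    let _ : X.functor.asEquivalence.functor.Monoidal := X.monoidal
    X.functor.asEquivalence.inverseMonoidal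

theorem exists_inverse (X : TwistedTensorAut K L C) :
    Nonempty (X ⊗ X.inverse ≅ 𝟙_ (TwistedTensorAut K L C)) ∧
      Nonempty (X.inverse ⊗ X ≅ 𝟙_ (TwistedTensorAut K L C)) := by
  let _ : X.functor.asEquivalence.functor.Monoidal := X.monoidal
  let _ : X.functor.asEquivalence.inverse.Monoidal := X.functor.asEquivalence.inverseMonoidal
  have : X.functor.asEquivalence.IsMonoidal :=
    ⟨rfl, fun _ _ ↦ rfl⟩
  have h1 : NatTrans.IsMonoidal X.functor.asEquivalence.counit := inferInstance
  have h2 : NatTrans.IsMonoidal X.functor.asEquivalence.unitInv := inferInstance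
  exact ⟨⟨@mkIso _ _ _ _ _ _ _ _ _ _ (X.tensor X.inverse) unit (mul_inv_cancel X.g)
      X.functor.asEquivalence.counitIso h1⟩,
    ⟨@mkIso _ _ _ _ _ _ _ _ _ _ (X.inverse.tensor X) unit (inv_mul_cancel X.g)
      X.functor.asEquivalence.unitIso.symm h2⟩⟩

instance : IsCategoricalGroup (TwistedTensorAut K L C) where
  isIso f := (mkIso f.hom.g_eq f.hom.iso).isIso_hom
  exists_inverse X := ⟨X.inverse, X.exists_inverse⟩

theorem isMonoidal_inv {C : Type*} [Category* C] [MonoidalCategory C] (i : 𝟭 C ≅ 𝟭 C) (_ : NatTrans.IsMonoidal i.hom) :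
    NatTrans.IsMonoidal i.inv := inferInstance

variable (C) in
/-- The group of monoidal automorphisms of `Id_C`. -/
def monoidalAut : Subgroup (Aut (𝟭 C)) where
  carrier := { i | NatTrans.IsMonoidal i.hom }
  one_mem' := inferInstanceAs (NatTrans.IsMonoidal (𝟙 (𝟭 C)))
  mul_mem' {i j} (_ : NatTrans.IsMonoidal i.hom) (_ : NatTrans.IsMonoidal j.hom) :=
    inferInstanceAs (NatTrans.IsMonoidal (j.hom ≫ i.hom))
  inv_mem' {i} h := isMonoidal_inv i h

/-- `π₂` of the categorical group of twisted tensor auto-equivalences is the group `Aut(Id_C)` of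
monoidal automorphisms of `Id_C`. -/
def autUnitEquiv : Aut (𝟙_ (TwistedTensorAut K L C)) ≃* monoidalAut C where
  toFun f := ⟨f.hom.hom.iso, f.hom.isMonoidal⟩
  invFun i := have := i.2; @mkIso _ _ _ _ _ _ _ _ _ _ unit unit rfl i.1 this
  left_inv f := by ext; rfl
  right_inv i := rfl
  map_mul' _ _ := rfl

variable [BraidedCategory C]

theorem isBraided_inverse_aux {C : Type*} [Category* C] [MonoidalCategory C]
    [BraidedCategory C] (e : C ≌ C) [e.functor.Monoidal] [e.inverse.Monoidal]
    [e.toAdjunction.IsMonoidal] (h : IsBraidedFunctor e.functor) :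
    IsBraidedFunctor e.inverse := fun A B ↦ by
  apply e.functor.map_injective
  rw [← cancel_mono (e.toAdjunction.counit.app (B ⊗ A))]
  have n := e.toAdjunction.counit.naturality (β_ A B).hom
  simp only [Functor.comp_map, Functor.id_map] at n
  simp only [Functor.map_comp, Category.assoc, n,
    e.toAdjunction.map_μ_comp_counit_app_tensor,
    e.toAdjunction.map_μ_comp_counit_app_tensor_assoc, BraidedCategory.braiding_naturality]
  rw [← cancel_epi (Functor.LaxMonoidal.μ e.functor _ _), reassoc_of% (h _ _)]
  simp

theorem isBraided_inverse (X : TwistedTensorAut K L C) (h : IsBraidedFunctor X.functor) :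
    IsBraidedFunctor X.inverse.functor :=
  let _ : X.functor.asEquivalence.functor.Monoidal := X.monoidal
  let _ : X.functor.asEquivalence.inverse.Monoidal := X.functor.asEquivalence.inverseMonoidal
  have : X.functor.asEquivalence.toAdjunction.IsMonoidal := ⟨rfl, fun _ _ ↦ rfl⟩
  isBraided_inverse_aux X.functor.asEquivalence h

instance : IsCategoricalGroup (TwistedBraidedAut K L C) where
  isIso f := (isIso_iff_of_reflects_iso f (isBraided K L C).ι).1 (IsCategoricalGroup.isIso _)
  exists_inverse X := ⟨⟨X.obj.inverse, X.obj.isBraided_inverse X.property⟩,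
    X.obj.exists_inverse.1.map fun i ↦ (isBraided K L C).fullyFaithfulι.preimageIso i,
    X.obj.exists_inverse.2.map fun i ↦ (isBraided K L C).fullyFaithfulι.preimageIso i⟩

end TwistedTensorAut

end Aut
/-! ### Stable objects -/

section Stable

variable (K L : Type w) [Field K] [Field L] [Algebra K L]
  (C : Type u) [Category.{v} C] [Preadditive C] [Linear L C]

/-- The data underlying a splitting: semilinear functors `Φ g` and isomorphisms
`J(g,h) : Φ g ∘ Φ h ≅ Φ (g * h)`. -/
structure GaloisData where
  Φ : (L ≃ₐ[K] L) → C ⥤ C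
  J : ∀ g h, Φ h ⋙ Φ g ≅ Φ (g * h)
  additive : ∀ g, (Φ g).Additive
  map_smul : ∀ (g : L ≃ₐ[K] L) {X Y : C} (a : L) (f : X ⟶ Y),
    (Φ g).map (a • f) = g a • (Φ g).map f

attribute [instance] GaloisData.additive

/-- The data underlying a splitting in the case of a tensor category: the functors `Φ g` and the
isomorphisms `J(g,h)` are moreover monoidal. -/
structure TensorGaloisData [MonoidalCategory C] extends GaloisData K L C where
  monoidal : ∀ g, (Φ g).Monoidal
  isMonoidal : ∀ g h, NatTrans.IsMonoidal (J g h).hom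

attribute [instance] TensorGaloisData.monoidal TensorGaloisData.isMonoidal

/-- The data underlying a splitting in the case of a braided tensor category: the functors `Φ g` are
moreover braided. -/
structure BraidedGaloisData [MonoidalCategory C] [BraidedCategory C] extends
    TensorGaloisData K L C where
  isBraided : ∀ g, IsBraidedFunctor (Φ g)

variable {K L C}

/-- The functors `Φ g` and isomorphisms `J(g,h)` of a splitting. -/
@[simps]
def Splitting.galoisData (s : Splitting (TwistedAut.toGalois K L C)) : GaloisData K L C where
  Φ g := (s.functor.obj ⟨g⟩).functor
  J g h := (Functor.LaxMonoidal.μ s.functor ⟨g⟩ ⟨h⟩).iso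
  additive g := (s.functor.obj ⟨g⟩).additive
  map_smul g _ _ a f := by
    rw [TwistedAut.map_smul]
    congr 2
    exact s.comp_eq g

/-- The functors `Φ g` and isomorphisms `J(g,h)` of a splitting, for tensor categories. -/
@[simps]
def Splitting.tensorGaloisData [MonoidalCategory C]
    (s : Splitting (TwistedTensorAut.toGalois K L C)) : TensorGaloisData K L C where
  Φ g := (s.functor.obj ⟨g⟩).functor
  J g h := (Functor.LaxMonoidal.μ s.functor ⟨g⟩ ⟨h⟩).hom.iso
  additive g := (s.functor.obj ⟨g⟩).additive
  map_smul g _ _ a f := by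
    rw [TwistedAut.map_smul]
    congr 2
    exact s.comp_eq g
  monoidal g := (s.functor.obj ⟨g⟩).monoidal
  isMonoidal g h := (Functor.LaxMonoidal.μ s.functor ⟨g⟩ ⟨h⟩).isMonoidal

/-- The functors `Φ g` and isomorphisms `J(g,h)` of a splitting, for braided tensor categories. -/
def Splitting.braidedGaloisData [MonoidalCategory C] [BraidedCategory C]
    (s : Splitting (TwistedBraidedAut.toGalois K L C)) : BraidedGaloisData K L C where
  Φ g := (s.functor.obj ⟨g⟩).obj.functor
  J g h := (Functor.LaxMonoidal.μ s.functor ⟨g⟩ ⟨h⟩).hom.hom.iso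
  additive g := (s.functor.obj ⟨g⟩).obj.additive
  map_smul g _ _ a f := by
    rw [TwistedAut.map_smul]
    congr 2
    exact s.comp_eq g
  monoidal g := (s.functor.obj ⟨g⟩).obj.monoidal
  isMonoidal g h := (Functor.LaxMonoidal.μ s.functor ⟨g⟩ ⟨h⟩).hom.isMonoidal
  isBraided g := (s.functor.obj ⟨g⟩).property

/-- A `Γ`-stable object of `C`: an object `X` with isomorphisms `α g : Φ g X ≅ X` such that
`α (gh) ∘ J(g,h)_X = α g ∘ Φ g (α h)`. -/
structure StableObj (d : GaloisData K L C) where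
  obj : C
  α : ∀ g, (d.Φ g).obj obj ≅ obj
  α_mul : ∀ g h, (d.J g h).hom.app obj ≫ (α (g * h)).hom = (d.Φ g).map (α h).hom ≫ (α g).hom

namespace StableObj

section

variable {d : GaloisData K L C}

/-- Morphisms of `Γ`-stable objects: the morphisms `f` with `α g ∘ Φ g (f) ∘ (α g)⁻¹ = f`, i.e. the
invariants of `Γ` in the space of morphisms of `C`. -/
@[ext]
structure Hom (X Y : StableObj d) where
  hom : X.obj ⟶ Y.obj
  comm : ∀ g, (X.α g).inv ≫ (d.Φ g).map hom ≫ (Y.α g).hom = hom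

theorem Hom.comm' {X Y : StableObj d} (f : Hom X Y) (g : L ≃ₐ[K] L) :
    (d.Φ g).map f.hom ≫ (Y.α g).hom = (X.α g).hom ≫ f.hom := by
  rw [← Iso.inv_comp_eq, f.comm g]

theorem Hom.comm'' {X Y : StableObj d} (f : Hom X Y) (g : L ≃ₐ[K] L) :
    (X.α g).inv ≫ (d.Φ g).map f.hom = f.hom ≫ (Y.α g).inv := by
  rw [Iso.inv_comp_eq, ← Category.assoc, Iso.eq_comp_inv, f.comm']

@[simps id_hom comp_hom]
instance : Category (StableObj d) where
  Hom := Hom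
  id X := ⟨𝟙 X.obj, fun g ↦ by simp⟩
  comp f h := ⟨f.hom ≫ h.hom, fun g ↦ by
    rw [Functor.map_comp, Category.assoc, h.comm', reassoc_of% (f.comm'' g), Iso.inv_hom_id_assoc]⟩

@[ext]
theorem hom_ext {X Y : StableObj d} {f h : X ⟶ Y} (e : f.hom = h.hom) : f = h := Hom.ext e

/-- Isomorphisms of `Γ`-stable objects. -/
@[simps]
def mkIso {X Y : StableObj d} (e : X.obj ≅ Y.obj)
    (comm : ∀ g, (d.Φ g).map e.hom ≫ (Y.α g).hom = (X.α g).hom ≫ e.hom) : X ≅ Y where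
  hom := ⟨e.hom, fun g ↦ by rw [comm, Iso.inv_hom_id_assoc]⟩
  inv := ⟨e.inv, fun g ↦ by
    rw [Iso.inv_comp_eq, ← cancel_mono e.hom, Category.assoc, Category.assoc, ← comm,
      ← Functor.map_comp_assoc]
    simp⟩

variable (d) in
/-- The forgetful functor. -/
@[simps]
def forget : StableObj d ⥤ C where
  obj X := X.obj
  map f := f.hom

instance : (forget d).Faithful where
  map_injective e := hom_ext e

instance (X Y : StableObj d) : Add (X ⟶ Y) :=
  ⟨fun f h ↦ ⟨f.hom + h.hom, fun g ↦ by simp [f.comm, h.comm]⟩⟩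
instance (X Y : StableObj d) : Zero (X ⟶ Y) :=
  ⟨⟨0, fun g ↦ by simp⟩⟩
instance (X Y : StableObj d) : Neg (X ⟶ Y) :=
  ⟨fun f ↦ ⟨-f.hom, fun g ↦ by simp [f.comm]⟩⟩
@[simp] theorem add_hom {X Y : StableObj d} (f h : X ⟶ Y) : (f + h).hom = f.hom + h.hom := rfl
@[simp] theorem zero_hom {X Y : StableObj d} : (0 : X ⟶ Y).hom = 0 := rfl
@[simp] theorem neg_hom {X Y : StableObj d} (f : X ⟶ Y) : (-f).hom = -f.hom := rfl

instance (X Y : StableObj d) : AddCommGroup (X ⟶ Y) where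
  add_assoc _ _ _ := by ext; simp [add_assoc]
  zero_add _ := by ext; simp
  add_zero _ := by ext; simp
  add_comm _ _ := by ext; simp [add_comm]
  neg_add_cancel _ := by ext; simp
  nsmul := nsmulRec
  zsmul := zsmulRec

instance : Preadditive (StableObj d) where
  add_comp _ _ _ _ _ _ := by ext; simp
  comp_add _ _ _ _ _ _ := by ext; simp

/-- `K` acts through its embedding into `L`. -/
instance (X Y : StableObj d) : SMul K (X ⟶ Y) :=
  ⟨fun a f ↦ ⟨algebraMap K L a • f.hom, fun g ↦ by simp [d.map_smul, f.comm]⟩⟩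
@[simp] theorem smul_hom {X Y : StableObj d} (a : K) (f : X ⟶ Y) :
    (a • f).hom = algebraMap K L a • f.hom := rfl

instance (X Y : StableObj d) : Module K (X ⟶ Y) where
  one_smul _ := by ext; simp
  mul_smul _ _ _ := by ext; simp [mul_smul]
  smul_zero _ := by ext; simp
  smul_add _ _ _ := by ext; simp
  add_smul _ _ _ := by ext; simp [add_smul]
  zero_smul _ := by ext; simp

instance : Linear K (StableObj d) where
  smul_comp _ _ _ _ _ _ := by ext; simp
  comp_smul _ _ _ _ _ _ := by ext; simp

end

section Tensor

open Functor.LaxMonoidal Functor.OplaxMonoidal Functor.Monoidal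

variable [MonoidalCategory C] {d : TensorGaloisData K L C}

/-- The tensor product of `Γ`-stable objects. -/
@[simps, reducible]
def tensor (X Y : StableObj d.toGaloisData) : StableObj d.toGaloisData where
  obj := X.obj ⊗ Y.obj
  α g := (μIso (d.Φ g) X.obj Y.obj).symm ≪≫ (X.α g ⊗ᵢ Y.α g)
  α_mul g h := by
    have e := NatTrans.IsMonoidal.tensor (τ := (d.J g h).hom) X.obj Y.obj
    rw [comp_μ] at e
    rw [← cancel_epi ((d.Φ g).map (μ (d.Φ h) X.obj Y.obj)), ← cancel_epi (μ (d.Φ g) _ _)]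
    simp only [Category.assoc] at e
    simp only [Iso.trans_hom, Iso.symm_hom, μIso_inv, tensorIso_hom, reassoc_of% e, μ_δ_assoc,
      tensorHom_comp_tensorHom, X.α_mul, Y.α_mul, Functor.map_comp, Category.assoc,
      map_μ_δ_assoc, ← δ_natural_assoc]

/-- The unit object. -/
@[simps, reducible]
def unit : StableObj d.toGaloisData where
  obj := 𝟙_ C
  α g := (εIso (d.Φ g)).symm
  α_mul g h := by
    have e := NatTrans.IsMonoidal.unit (τ := (d.J g h).hom)
    rw [comp_ε] at e
    rw [← cancel_epi ((d.Φ g).map (ε (d.Φ h))), ← cancel_epi (ε (d.Φ g))]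
    simp only [Category.assoc] at e
    simp [reassoc_of% e]

/-- The tensor product of morphisms. -/
@[simps, reducible]
def homTensor {X X' Y Y' : StableObj d.toGaloisData} (f : X ⟶ X') (h : Y ⟶ Y') :
    tensor X Y ⟶ tensor X' Y' where
  hom := f.hom ⊗ₘ h.hom
  comm g := by
    rw [Iso.inv_comp_eq]
    simp only [Iso.trans_hom, Iso.symm_hom, μIso_inv, tensorIso_hom, ← δ_natural_assoc,
      tensorHom_comp_tensorHom, Category.assoc, Hom.comm']

@[simps]
instance : MonoidalCategoryStruct (StableObj d.toGaloisData) where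
  tensorObj := tensor
  tensorUnit := unit
  tensorHom := homTensor
  whiskerLeft X _ _ f := homTensor (𝟙 X) f
  whiskerRight f X := homTensor f (𝟙 X)
  associator X Y Z := mkIso (α_ X.obj Y.obj Z.obj) fun g ↦ by
    have e₁ : (X.α g).hom ⊗ₘ (δ (d.Φ g) Y.obj Z.obj ≫ ((Y.α g).hom ⊗ₘ (Z.α g).hom)) =
        _ ◁ δ (d.Φ g) Y.obj Z.obj ≫ ((X.α g).hom ⊗ₘ ((Y.α g).hom ⊗ₘ (Z.α g).hom)) := by
      rw [← id_tensorHom, tensorHom_comp_tensorHom, Category.id_comp]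
    have e₂ : (δ (d.Φ g) X.obj Y.obj ≫ ((X.α g).hom ⊗ₘ (Y.α g).hom)) ⊗ₘ (Z.α g).hom =
        δ (d.Φ g) X.obj Y.obj ▷ _ ≫ (((X.α g).hom ⊗ₘ (Y.α g).hom) ⊗ₘ (Z.α g).hom) := by
      rw [← tensorHom_id, tensorHom_comp_tensorHom, Category.id_comp]
    simp only [Iso.trans_hom, Iso.symm_hom, μIso_inv, tensorIso_hom, Category.assoc, e₁, e₂,
      associator_naturality, Functor.OplaxMonoidal.associativity_assoc]
  leftUnitor X := mkIso (λ_ X.obj) fun g ↦ by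
    simp only [Iso.trans_hom, Iso.symm_hom, μIso_inv,
      tensorIso_hom, Category.assoc, εIso_inv, MonoidalCategory.tensorHom_def,
      leftUnitor_naturality, map_leftUnitor]
  rightUnitor X := mkIso (ρ_ X.obj) fun g ↦ by
    simp only [Iso.trans_hom, Iso.symm_hom, μIso_inv,
      tensorIso_hom, Category.assoc, εIso_inv, MonoidalCategory.tensorHom_def',
      rightUnitor_naturality, map_rightUnitor]

instance : MonoidalCategory (StableObj d.toGaloisData) :=
  Monoidal.induced (forget d.toGaloisData)
    { μIso _ _ := Iso.refl _
      εIso := Iso.refl _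
      whiskerLeft_eq X Y Z f := by
        change 𝟙 X.obj ⊗ₘ f.hom = 𝟙 (X.obj ⊗ Y.obj) ≫ X.obj ◁ f.hom ≫ 𝟙 (X.obj ⊗ Z.obj)
        simp
      whiskerRight_eq {X Y} f Z := by
        change f.hom ⊗ₘ 𝟙 Z.obj = 𝟙 (X.obj ⊗ Z.obj) ≫ f.hom ▷ Z.obj ≫ 𝟙 (Y.obj ⊗ Z.obj)
        simp
      tensorHom_eq {X X' Y Y'} f h := by
        change f.hom ⊗ₘ h.hom = 𝟙 (X.obj ⊗ Y.obj) ≫ (f.hom ⊗ₘ h.hom) ≫ 𝟙 (X'.obj ⊗ Y'.obj)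
        simp
      associator_eq X Y Z := by
        change (α_ X.obj Y.obj Z.obj).hom =
          (𝟙 ((X.obj ⊗ Y.obj) ⊗ Z.obj) ≫ (𝟙 (X.obj ⊗ Y.obj) ⊗ₘ 𝟙 Z.obj)) ≫
          (α_ X.obj Y.obj Z.obj).hom ≫ (𝟙 X.obj ⊗ₘ 𝟙 (Y.obj ⊗ Z.obj)) ≫ 𝟙 (X.obj ⊗ Y.obj ⊗ Z.obj)
        simp
      leftUnitor_eq X := by
        change (λ_ X.obj).hom =
          (𝟙 (𝟙_ C ⊗ X.obj) ≫ (𝟙 (𝟙_ C) ⊗ₘ 𝟙 X.obj)) ≫ (λ_ X.obj).hom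
        simp
      rightUnitor_eq X := by
        change (ρ_ X.obj).hom =
          (𝟙 (X.obj ⊗ 𝟙_ C) ≫ (𝟙 X.obj ⊗ₘ 𝟙 (𝟙_ C))) ≫ (ρ_ X.obj).hom
        simp }

theorem hom_whiskerLeft (X : StableObj d.toGaloisData) {Y Z : StableObj d.toGaloisData}
    (f : Y ⟶ Z) : (X ◁ f).hom = X.obj ◁ f.hom := id_tensorHom _ _

theorem hom_whiskerRight {Y Z : StableObj d.toGaloisData}
    (f : Y ⟶ Z) (X : StableObj d.toGaloisData) : (f ▷ X).hom = f.hom ▷ X.obj := tensorHom_id _ _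

theorem hom_associator (X Y Z : StableObj d.toGaloisData) :
    (α_ X Y Z).hom.hom = (α_ X.obj Y.obj Z.obj).hom := rfl

theorem hom_leftUnitor (X : StableObj d.toGaloisData) : (λ_ X).hom.hom = (λ_ X.obj).hom := rfl

theorem hom_rightUnitor (X : StableObj d.toGaloisData) : (ρ_ X).hom.hom = (ρ_ X.obj).hom := rfl

instance : (forget d.toGaloisData).Monoidal :=
  Functor.CoreMonoidal.toMonoidal
    { εIso := Iso.refl (𝟙_ C)
      μIso := fun X Y ↦ Iso.refl (X.obj ⊗ Y.obj)
      μIso_hom_natural_left {X Y} f Z := by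
        change f.hom ▷ Z.obj ≫ 𝟙 (Y.obj ⊗ Z.obj) = 𝟙 (X.obj ⊗ Z.obj) ≫ (f ▷ Z).hom
        simp
      μIso_hom_natural_right {X Y} Z f := by
        change Z.obj ◁ f.hom ≫ 𝟙 (Z.obj ⊗ Y.obj) = 𝟙 (Z.obj ⊗ X.obj) ≫ (Z ◁ f).hom
        simp
      associativity X Y Z := by
        change 𝟙 (X.obj ⊗ Y.obj) ▷ Z.obj ≫ 𝟙 ((X.obj ⊗ Y.obj) ⊗ Z.obj) ≫
          (α_ X.obj Y.obj Z.obj).hom = (α_ X.obj Y.obj Z.obj).hom ≫ X.obj ◁ 𝟙 (Y.obj ⊗ Z.obj) ≫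
            𝟙 (X.obj ⊗ Y.obj ⊗ Z.obj)
        simp
      left_unitality X := by
        change (λ_ X.obj).hom = 𝟙 (𝟙_ C) ▷ X.obj ≫ 𝟙 (𝟙_ C ⊗ X.obj) ≫ (λ_ X.obj).hom
        simp
      right_unitality X := by
        change (ρ_ X.obj).hom = X.obj ◁ 𝟙 (𝟙_ C) ≫ 𝟙 (X.obj ⊗ 𝟙_ C) ≫ (ρ_ X.obj).hom
        simp }

instance [MonoidalPreadditive C] : MonoidalPreadditive (StableObj d.toGaloisData) where
  whiskerLeft_zero := by intros; ext; simp
  zero_whiskerRight := by intros; ext; simp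
  whiskerLeft_add := by
    intros; ext
    simp only [hom_whiskerLeft, add_hom, MonoidalPreadditive.whiskerLeft_add]
  add_whiskerRight := by
    intros; ext
    simp only [hom_whiskerRight, add_hom, MonoidalPreadditive.add_whiskerRight]

instance [MonoidalPreadditive C] [MonoidalLinear L C] :
    MonoidalLinear K (StableObj d.toGaloisData) where
  whiskerLeft_smul := by
    intros; ext
    simp only [hom_whiskerLeft, smul_hom, MonoidalLinear.whiskerLeft_smul]
  smul_whiskerRight := by
    intros; ext
    simp only [hom_whiskerRight, smul_hom, MonoidalLinear.smul_whiskerRight]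

end Tensor

section Braided

open Functor.LaxMonoidal Functor.OplaxMonoidal Functor.Monoidal

variable [MonoidalCategory C] [BraidedCategory C] {d : BraidedGaloisData K L C}

instance : BraidedCategory (StableObj d.toGaloisData) :=
  BraidedCategory.ofFaithful (forget d.toGaloisData)
    (fun X Y ↦ mkIso (β_ X.obj Y.obj) fun g ↦ by
      change (d.Φ g).map (β_ X.obj Y.obj).hom ≫ δ (d.Φ g) Y.obj X.obj ≫
        ((Y.α g).hom ⊗ₘ (X.α g).hom) =
        (δ (d.Φ g) X.obj Y.obj ≫ ((X.α g).hom ⊗ₘ (Y.α g).hom)) ≫ (β_ X.obj Y.obj).hom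
      rw [← cancel_epi (μ (d.Φ g) X.obj Y.obj), reassoc_of% (d.isBraided g X.obj Y.obj)]
      simp [BraidedCategory.braiding_naturality])
    fun X Y ↦ by
      change 𝟙 (X.obj ⊗ Y.obj) ≫ (β_ X.obj Y.obj).hom = (β_ X.obj Y.obj).hom ≫ 𝟙 (Y.obj ⊗ X.obj)
      simp

theorem hom_braiding (X Y : StableObj d.toGaloisData) :
    (β_ X Y).hom.hom = (β_ X.obj Y.obj).hom := rfl

end Braided

end StableObj

end Stable
end CategoricalDescent
open CategoricalDescent

namespace CategoricalDescent

/-! ### Multiplicative families of objects in a categorical group, and their units -/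

section CategoricalGroups

variable {Γ : Type w} [Group Γ] {𝒢 : Type u} [Category.{v} 𝒢] [MonoidalCategory 𝒢]

/-! The equivalence of forms and splittings is Galois descent in both directions.

Given a form `D`, the group Γ acts on `D ⊗_K L` through the coefficients, `a ⊗ f ↦ g a ⊗ f`
(`ExtScalars.twist`). Conjugating this action with the equivalence between `D ⊗_K L` and `C`
(`transportIso`) gives semilinear auto-equivalences of `C` with associative composition
isomorphisms, hence a splitting.

Given a splitting, the form is the category of stable objects. Between stable objects Γ acts
semilinearly on the morphisms of `C`, and descent for vector spaces says that the invariants span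
freely over `L`: this is `StableObj.extHom_bijective`, which rests on Dedekind's independence of
automorphisms. The forgetful functor therefore extends to a fully faithful functor on the category
with scalars extended, and then to its Karoubian envelope because `C` is idempotent complete. Every
object `X` of `C` is a retract of the induced stable object, the sum of all `Φ g X`
(`StableObj.exists_retract`), so the extension is an equivalence. Tensor products and braidings are
those of the underlying objects and go along.

Semisimplicity is handled through von Neumann regularity: every morphism `f` has some `g` with `f ≫
g ≫ f = f`. Schur's lemma gives this in a semisimple category. Conversely, an idempotent complete
category with finite products and finite-dimensional morphism spaces in which all morphisms are
regular is semisimple abelian (`isSemisimpleAbelian_of_regular`). Regularity descends to stable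
objects by averaging a quasi-inverse over Γ, weighted by an element of trace 1, so that no division
by the order of Γ occurs.

Sections of the classifying map and the obstruction class concern any categorical group over Γ. The
common notion is `MulData`, a monoidal functor from Γ with its unit forgotten; since objects are
invertible, the unit can always be recovered (`MulData.nonempty_unit`). A section yields `MulData`
from its values on 1-, 2- and 3-simplices. For a weak splitting, two isomorphisms between the same
objects differ by a unique automorphism of the unit; the failure of associativity is thus a
3-cochain `ω`. The pentagon makes it a cocycle, changing `J` changes it by a coboundary, and `ω = 1`
for some `J` is exactly `MulData`. -/

theorem tensorRight_isEquivalence [IsCategoricalGroup 𝒢] (X : 𝒢) :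
    (tensorRight X).IsEquivalence := by
  obtain ⟨Y, ⟨e⟩, ⟨e'⟩⟩ := IsCategoricalGroup.exists_inverse X
  exact .mk' (tensorRight Y)
    ((tensorRightTensor X Y).symm ≪≫ (tensoringRight 𝒢).mapIso e ≪≫ rightUnitorNatIso 𝒢).symm
    ((tensorRightTensor Y X).symm ≪≫ (tensoringRight 𝒢).mapIso e' ≪≫ rightUnitorNatIso 𝒢)

/-- Tensoring with an invertible object is fully faithful. Faithfulness is used to test equations
after tensoring, fullness to define morphisms by their tensor product with `X`. -/
theorem whiskerRight_injective [IsCategoricalGroup 𝒢] (X : 𝒢) {A B : 𝒢} {f f' : A ⟶ B}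
    (h : f ▷ X = f' ▷ X) : f = f' :=
  have := tensorRight_isEquivalence X
  (tensorRight X).map_injective h

theorem exists_whiskerRight_eq [IsCategoricalGroup 𝒢] (X : 𝒢) {A B : 𝒢} (q : A ⊗ X ⟶ B ⊗ X) :
    ∃ f : A ⟶ B, f ▷ X = q :=
  have := tensorRight_isEquivalence X
  (tensorRight X).map_surjective q

/-- Objects `Φ g` of a monoidal category with associative isomorphisms `Φ g ⊗ Φ h ≅ Φ k` for
`k = g * h`: a monoidal functor without its unit. -/
structure MulData (Γ : Type w) [Group Γ] (𝒢 : Type u) [Category.{v} 𝒢] [MonoidalCategory 𝒢] where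
  obj : Γ → 𝒢
  iso : ∀ {g h k : Γ}, g * h = k → (obj g ⊗ obj h ≅ obj k)
  assoc : ∀ {g h k a b c : Γ} (e₁ : g * h = a) (e₂ : a * k = c) (e₃ : h * k = b) (e₄ : g * b = c),
    (iso e₁).hom ▷ obj k ≫ (iso e₂).hom =
      (α_ (obj g) (obj h) (obj k)).hom ≫ obj g ◁ (iso e₃).hom ≫ (iso e₄).hom

/-- `MulData` from isomorphisms `Φ g ⊗ Φ h ≅ Φ (g * h)`. -/
@[simps]
def MulData.ofIso (Φ : Γ → 𝒢) (J : ∀ g h, Φ g ⊗ Φ h ≅ Φ (g * h))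
    (hJ : ∀ g h k, (J g h).hom ▷ Φ k ≫ (J (g * h) k).hom =
      (α_ (Φ g) (Φ h) (Φ k)).hom ≫ Φ g ◁ (J h k).hom ≫ (J g (h * k)).hom ≫
        eqToHom (congrArg Φ (mul_assoc g h k).symm)) : MulData Γ 𝒢 where
  obj := Φ
  iso {g h k} e := J g h ≪≫ eqToIso (congrArg Φ e)
  assoc {g h k a b c} e₁ e₂ e₃ e₄ := by
    subst e₁ e₂ e₃
    simpa using hJ g h k

namespace MulData

variable (m : MulData Γ 𝒢)

theorem iso_eq {g h k k' : Γ} (e : g * h = k) (e' : k = k') :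
    (m.iso (e.trans e')).hom = (m.iso e).hom ≫ eqToHom (congrArg m.obj e') := by
  subst e'; simp

/-- Unit constraint of a `MulData`. -/
structure Unit where
  iso : 𝟙_ 𝒢 ≅ m.obj 1
  left : ∀ g, iso.hom ▷ m.obj g ≫ (m.iso (one_mul g)).hom = (λ_ _).hom
  right : ∀ g, m.obj g ◁ iso.hom ≫ (m.iso (mul_one g)).hom = (ρ_ _).hom

/-- The left unit law at `1` determines the unit `u`, because tensoring with `m.obj 1` is fully
faithful. Associativity for `(1, 1, g)` then gives the left law at every `g`, and associativity for
`(g, 1, g)` gives the right law. -/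
theorem nonempty_unit [IsCategoricalGroup 𝒢] : Nonempty m.Unit := by
  obtain ⟨u, hu⟩ := exists_whiskerRight_eq (m.obj 1) ((λ_ _).hom ≫ (m.iso (one_mul 1)).inv)
  have hu' : u ▷ m.obj 1 ≫ (m.iso (one_mul 1)).hom = (λ_ _).hom := by rw [hu]; simp
  have hl : ∀ g, u ▷ m.obj g ≫ (m.iso (one_mul g)).hom = (λ_ _).hom := by
    intro g
    have a := m.assoc (one_mul 1) (one_mul g) (one_mul g) (one_mul g)
    have b := congrArg (fun t ↦ (u ▷ m.obj 1) ▷ m.obj g ≫ t) a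
    simp only [← comp_whiskerRight_assoc, hu', associator_naturality_left_assoc] at b
    rw [← whisker_exchange_assoc, leftUnitor_whiskerRight, Category.assoc, Iso.cancel_iso_hom_left,
      ← leftUnitor_naturality] at b
    rw [← cancel_epi (𝟙_ 𝒢 ◁ (m.iso (one_mul g)).hom)]
    exact b.symm
  have : IsIso u := IsCategoricalGroup.isIso u
  refine ⟨⟨asIso u, hl, fun g ↦ ?_⟩⟩
  -- The right law is an equation of endomorphisms of `m.obj g`; tensored with `m.obj g` on the
  -- right, it follows from the left law through the middle factor `1`.
  have n : (ρ_ _).inv ≫ m.obj g ◁ u ≫ (m.iso (mul_one g)).hom = 𝟙 _ := by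
    apply whiskerRight_injective (m.obj g)
    rw [← cancel_mono (m.iso (rfl : g * g = g * g)).hom]
    have a := m.assoc (mul_one g) (rfl : g * g = g * g) (one_mul g) rfl
    simp only [comp_whiskerRight, Category.assoc, a, associator_naturality_middle_assoc]
    rw [← MonoidalCategory.whiskerLeft_comp_assoc, hl]
    simp
  rw [Iso.inv_comp_eq] at n
  simpa using n

/-- A `MulData` with unit constraint is a monoidal functor. -/
def coreMonoidal (U : m.Unit) : (Discrete.functor m.obj : Discrete Γ ⥤ 𝒢).CoreMonoidal where
  εIso := U.iso
  μIso X Y := m.iso (rfl : X.as * Y.as = _)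
  μIso_hom_natural_left {X Y} f Z := by
    obtain rfl : X = Y := Discrete.ext (Discrete.eq_of_hom f)
    obtain rfl : f = 𝟙 X := Subsingleton.elim _ _
    have : 𝟙 X ▷ Z = 𝟙 (X ⊗ Z) := Subsingleton.elim _ _
    simp [this]
  μIso_hom_natural_right {X Y} Z f := by
    obtain rfl : X = Y := Discrete.ext (Discrete.eq_of_hom f)
    obtain rfl : f = 𝟙 X := Subsingleton.elim _ _
    have : Z ◁ 𝟙 X = 𝟙 (Z ⊗ X) := Subsingleton.elim _ _
    simp [this]
  associativity X Y Z := by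
    -- The target of the second multiplication in `assoc` is chosen as `x * (y * z)`; the transport
    -- this introduces is the image of the associator of the discrete category.
    have h := m.iso_eq (rfl : (X.as * Y.as) * Z.as = _) (mul_assoc X.as Y.as Z.as)
    have a := m.assoc (rfl : X.as * Y.as = _) (mul_assoc X.as Y.as Z.as)
      (rfl : Y.as * Z.as = _) rfl
    rw [h] at a
    have e : (Discrete.functor m.obj).map (α_ X Y Z).hom =
      eqToHom (congrArg m.obj (mul_assoc X.as Y.as Z.as)) := by
      rw [Subsingleton.elim (α_ X Y Z).hom (eqToHom (Discrete.ext (mul_assoc X.as Y.as Z.as))),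
        eqToHom_map]
    rw [e]
    exact a
  left_unitality X := by
    have h := m.iso_eq (rfl : 1 * X.as = _) (one_mul X.as)
    have e : (Discrete.functor m.obj).map (λ_ X).hom =
      eqToHom (congrArg m.obj (one_mul X.as)) := by
      rw [Subsingleton.elim (λ_ X).hom (eqToHom (Discrete.ext (one_mul X.as))), eqToHom_map]
    rw [e]
    have := U.left X.as
    rw [h] at this
    exact this.symm
  right_unitality X := by
    have h := m.iso_eq (rfl : X.as * 1 = _) (mul_one X.as)
    have e : (Discrete.functor m.obj).map (ρ_ X).hom =
      eqToHom (congrArg m.obj (mul_one X.as)) := by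
      rw [Subsingleton.elim (ρ_ X).hom (eqToHom (Discrete.ext (mul_one X.as))), eqToHom_map]
    rw [e]
    have := U.right X.as
    rw [h] at this
    exact this.symm

/-- The unit comes for free, and the objects are kept on the nose, so that lying over the identity
of Γ is a condition on `m.obj` alone. -/
theorem exists_splitting [IsCategoricalGroup 𝒢] {Ψ : 𝒢 ⥤ Discrete Γ}
    (hm : ∀ g, (Ψ.obj (m.obj g)).as = g) :
    ∃ S : Splitting Ψ, ∀ g, S.functor.obj ⟨g⟩ = m.obj g := by
  obtain ⟨U⟩ := m.nonempty_unit
  let _ := (m.coreMonoidal U).toMonoidal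
  exact ⟨⟨Discrete.functor m.obj, hm⟩, fun _ ↦ rfl⟩

open Functor.LaxMonoidal in
/-- The `MulData` of a splitting. -/
@[simps obj]
def ofSplitting {Ψ : 𝒢 ⥤ Discrete Γ} (S : Splitting Ψ) : MulData Γ 𝒢 where
  obj g := S.functor.obj ⟨g⟩
  iso {g h k} e := Functor.Monoidal.μIso S.functor ⟨g⟩ ⟨h⟩ ≪≫
    S.functor.mapIso (eqToIso (Discrete.ext e))
  assoc {g h k a b c} e₁ e₂ e₃ e₄ := by
    subst e₁ e₂ e₃
    have a := associativity S.functor ⟨g⟩ ⟨h⟩ ⟨k⟩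
    -- Parallel morphisms in a discrete category are equal, so the image of the associator is
    -- inverse to the transport along `e₄`.
    have e : S.functor.map (α_ (⟨g⟩ : Discrete Γ) ⟨h⟩ ⟨k⟩).hom ≫
        S.functor.map (eqToHom (Discrete.ext e₄)) = 𝟙 _ := by
      rw [← S.functor.map_comp, ← S.functor.map_id]
      congr 1
    have a' := congrArg (fun t ↦ t ≫ S.functor.map (eqToHom (Discrete.ext e₄))) a
    have i : ∀ x : Discrete Γ, S.functor.map (eqToHom (rfl : x = x)) = 𝟙 _ := fun x ↦ by simp
    simp only [Category.assoc] at a'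
    erw [e] at a'
    simp only [Category.comp_id] at a'
    simp only [Iso.trans_hom, Functor.mapIso_hom, eqToIso.hom]
    erw [i, i, i]
    simp only [Category.comp_id]
    exact a'

/-- The unit constraint of a splitting. -/
def unitOfSplitting {Ψ : 𝒢 ⥤ Discrete Γ} (S : Splitting Ψ) : (ofSplitting S).Unit where
  iso := Functor.Monoidal.εIso S.functor
  left g := by
    exact (Functor.LaxMonoidal.left_unitality S.functor ⟨g⟩).symm
  right g := by
    exact (Functor.LaxMonoidal.right_unitality S.functor ⟨g⟩).symm

end MulData

end CategoricalGroups

/-! ### Splittings and sections of the map of classifying spaces -/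

section CategoricalGroups

variable {Γ : Type w} [Group Γ] {𝒢 : Type u} [Category.{v} 𝒢] [MonoidalCategory 𝒢]

namespace MulData

variable (m : MulData Γ 𝒢)

/-- Transport of a `MulData` along isomorphisms of objects. -/
@[simps obj]
def transport (Φ : Γ → 𝒢) (e : ∀ g, Φ g ≅ m.obj g) : MulData Γ 𝒢 where
  obj := Φ
  iso {g h k} p := (e g ⊗ᵢ e h) ≪≫ m.iso p ≪≫ (e k).symm
  assoc {g h k a b c} e₁ e₂ e₃ e₄ := by
    have A := m.assoc e₁ e₂ e₃ e₄
    -- On both sides the interchange law moves the isomorphisms `e g`, `e h`, `e k` to the front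
    -- (`h1`, `h2`), once the intermediate `e a` and `e b` have cancelled (`h3`, `h4`). What is left
    -- is associativity of `m`.
    have h1 : ((e g).hom ⊗ₘ (e h).hom) ▷ Φ k ≫ (m.iso e₁).hom ▷ Φ k ≫ (m.obj a ◁ (e k).hom) =
      (((e g).hom ⊗ₘ (e h).hom) ⊗ₘ (e k).hom) ≫ (m.iso e₁).hom ▷ m.obj k := by
      rw [← whisker_exchange, MonoidalCategory.tensorHom_def _ (e k).hom]; simp
    have h2 : Φ g ◁ ((e h).hom ⊗ₘ (e k).hom) ≫ Φ g ◁ (m.iso e₃).hom ≫ (e g).hom ▷ m.obj b =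
      ((e g).hom ⊗ₘ ((e h).hom ⊗ₘ (e k).hom)) ≫ m.obj g ◁ (m.iso e₃).hom := by
      rw [whisker_exchange, MonoidalCategory.tensorHom_def' (e g).hom]; simp
    simp only [Iso.trans_hom, tensorIso_hom, Iso.symm_hom, comp_whiskerRight, Category.assoc,
      MonoidalCategory.whiskerLeft_comp]
    have h3 : (e a).inv ▷ Φ k ≫ ((e a).hom ⊗ₘ (e k).hom) = m.obj a ◁ (e k).hom := by
      rw [MonoidalCategory.tensorHom_def]; simp
    have h4 : Φ g ◁ (e b).inv ≫ ((e g).hom ⊗ₘ (e b).hom) = (e g).hom ▷ m.obj b := by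
      rw [MonoidalCategory.tensorHom_def']; simp
    rw [reassoc_of% h3, reassoc_of% h4, reassoc_of% h1, reassoc_of% h2, reassoc_of% A]
    simp

/-- Transport of a unit constraint. -/
@[simps iso]
def Unit.transport {m : MulData Γ 𝒢} (U : m.Unit) (Φ : Γ → 𝒢) (e : ∀ g, Φ g ≅ m.obj g) :
    (m.transport Φ e).Unit where
  iso := U.iso ≪≫ (e 1).symm
  left g := by
    have := U.left g
    change (U.iso.hom ≫ (e 1).inv) ▷ Φ g ≫ ((e 1).hom ⊗ₘ (e g).hom) ≫ (m.iso (one_mul g)).hom ≫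
      (e g).inv = _
    rw [MonoidalCategory.tensorHom_def]
    simp only [comp_whiskerRight, Category.assoc, inv_hom_whiskerRight_assoc]
    rw [← whisker_exchange_assoc, reassoc_of% this, leftUnitor_naturality_assoc]
    simp
    rfl
  right g := by
    have := U.right g
    change Φ g ◁ (U.iso.hom ≫ (e 1).inv) ≫ ((e g).hom ⊗ₘ (e 1).hom) ≫ (m.iso (mul_one g)).hom ≫
      (e g).inv = _
    rw [MonoidalCategory.tensorHom_def']
    simp only [MonoidalCategory.whiskerLeft_comp, Category.assoc, whiskerLeft_inv_hom_assoc]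
    rw [whisker_exchange_assoc, reassoc_of% this, rightUnitor_naturality_assoc]
    simp
    rfl

-- Simplices of the classifying space have `X i i` equal to the unit object, not merely isomorphic
-- to it. Replacing the object over `1` by the unit object and transporting along the unit
-- constraint achieves this, and makes the new constraint an identity.
open Classical in
theorem exists_normalized (U : m.Unit) : ∃ (m' : MulData Γ 𝒢) (h : 𝟙_ 𝒢 = m'.obj 1) (U' : m'.Unit),
    U'.iso.hom = eqToHom h ∧ ∀ g, Nonempty (m'.obj g ≅ m.obj g) := by
  let Φ : Γ → 𝒢 := fun g ↦ if g = 1 then 𝟙_ 𝒢 else m.obj g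
  have h1 : Φ 1 = 𝟙_ 𝒢 := if_pos rfl
  let e : ∀ g, Φ g ≅ m.obj g := fun g ↦
    if h : g = 1 then eqToIso ((congrArg Φ h).trans h1) ≪≫ U.iso ≪≫ eqToIso (congrArg m.obj h.symm)
    else eqToIso (if_neg h)
  refine ⟨m.transport Φ e, h1.symm, U.transport Φ e, ?_, fun g ↦ ⟨e g⟩⟩
  have he : e 1 = eqToIso h1 ≪≫ U.iso := by
    simp only [e, dif_pos]
    ext; simp
  change (U.iso ≪≫ (e 1).symm).hom = eqToHom h1.symm
  rw [he]
  simp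

/-- The simplex attached to a chain in `Γ`. -/
def toBSimplex (h1 : 𝟙_ 𝒢 = m.obj 1) (U : m.Unit) (hU : U.iso.hom = eqToHom h1)
    {I : Type} [Preorder I] (x : I ⥤ SingleObj Γ) : BSimplex 𝒢 I where
  obj h := m.obj (x.map (homOfLE h))
  comp hij hjk := m.iso (x.map_comp (homOfLE hij) (homOfLE hjk)).symm
  obj_refl i := (congrArg m.obj (x.map_id i)).trans h1.symm
  comp_refl_left {i j} h := by
    -- The arrow attached to `i ≤ i` is `1` only propositionally; a variable `k` with `k = 1` allows
    -- substitution.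
    have key : ∀ {g k : Γ} (hk : k = 1) (e : g * k = g), (m.iso e).hom =
        m.obj g ◁ eqToHom ((congrArg m.obj hk).trans h1.symm) ≫ (ρ_ _).hom := by
      rintro g k rfl e
      rw [← U.right g, hU, ← MonoidalCategory.whiskerLeft_comp_assoc]
      simp
    exact key (x.map_id i) _
  comp_refl_right {i j} h := by
    have key : ∀ {g k : Γ} (hk : k = 1) (e : k * g = g), (m.iso e).hom =
        eqToHom ((congrArg m.obj hk).trans h1.symm) ▷ m.obj g ≫ (λ_ _).hom := by
      rintro g k rfl e
      rw [← U.left g, hU, ← comp_whiskerRight_assoc]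
      simp
    exact key (x.map_id j) _
  assoc hij hjk hkl := m.assoc _ _ _ _

/-- After normalisation each chain of arrows in Γ lifts by applying `m'.obj` to its arrows. The lift
is formed arrow by arrow, so it commutes strictly with restriction of simplices. -/
theorem hasSection {Ψ : 𝒢 ⥤ Discrete Γ} [Ψ.Monoidal] (U : m.Unit)
    (hm : ∀ g, (Ψ.obj (m.obj g)).as = g) : HasSection Ψ := by
  obtain ⟨m', h1, U', hU, e⟩ := m.exists_normalized U
  have hm' : ∀ g, (Ψ.obj (m'.obj g)).as = g := fun g ↦ by
    obtain ⟨i⟩ := e g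
    exact (Discrete.eq_of_hom (Ψ.map i.hom)).trans (hm g)
  refine ⟨{ app := fun Δ ↦ ↾fun x ↦ ULift.up (m'.toBSimplex h1 U' hU x.down) }, ?_⟩
  ext Δ x
  refine congrArg ULift.up (CategoryTheory.Functor.ext (fun _ ↦ rfl) fun i j f ↦ ?_)
  simp only [eqToHom_refl, Category.comp_id, Category.id_comp]
  exact hm' _

end MulData

theorem BSimplex.comp_hom_congr {I : Type} [Preorder I] {s t : BSimplex 𝒢 I} (e : s = t) {i j k : I}
    (hij : i ≤ j) (hjk : j ≤ k) : (s.comp hij hjk).hom =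
      eqToHom (by rw [e]) ≫ (t.comp hij hjk).hom ≫ eqToHom (by rw [e]) := by
  subst e; simp

/-- The chain in `Γ` with the differences of a sequence of elements. -/
def chain {n : ℕ} (p : Fin (n + 1) → Γ) : ComposableArrows (SingleObj Γ) n where
  obj _ := SingleObj.star Γ
  map {i j} _ := (p j * (p i)⁻¹ : Γ)
  map_id i := mul_inv_cancel (p i)
  map_comp {i j k} _ _ := by
    change p k * (p i)⁻¹ = (p k * (p j)⁻¹) * (p j * (p i)⁻¹)
    group

theorem chain_congr {n : ℕ} {p q : Fin (n + 1) → Γ}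
    (h : ∀ i j, p j * (p i)⁻¹ = q j * (q i)⁻¹) : chain p = chain q := by
  have : (fun i j ↦ p j * (p i)⁻¹) = fun i j ↦ q j * (q i)⁻¹ := by ext i j; exact h i j
  refine CategoryTheory.Functor.ext (fun _ ↦ rfl) fun i j f ↦ ?_
  simp only [eqToHom_refl, Category.comp_id, Category.id_comp]
  exact h i j

/-- A section of the classifying map, in elementary terms. -/
structure ChainSection (Ψ : 𝒢 ⥤ Discrete Γ) where
  simplex : ∀ {n : ℕ}, (Fin (n + 1) → Γ) → BSimplex 𝒢 (Fin (n + 1))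
  congr : ∀ {n : ℕ} {p q : Fin (n + 1) → Γ}, (∀ i j, p j * (p i)⁻¹ = q j * (q i)⁻¹) →
    simplex p = simplex q
  restrict : ∀ {n m : ℕ} (f : Fin (n + 1) →o Fin (m + 1)) (p : Fin (m + 1) → Γ),
    simplex (p ∘ f) = (simplex p).restrict f
  eq : ∀ {n : ℕ} (p : Fin (n + 1) → Γ) {i j : Fin (n + 1)} (h : i ≤ j),
    (Ψ.obj ((simplex p).obj h)).as = p j * (p i)⁻¹

/-- Describing a chain by a sequence `p` with arrows `p j * (p i)⁻¹` turns simplicial operators into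
precomposition of `p`. Naturality of the section then reads as `restrict` with no transport. -/
theorem HasSection.nonempty_chainSection {Ψ : 𝒢 ⥤ Discrete Γ} [Ψ.Monoidal] (h : HasSection Ψ) :
    Nonempty (ChainSection Ψ) := by
  obtain ⟨σ, hσ⟩ := h
  refine ⟨⟨fun {n} p ↦ (σ.app (.op (.mk n)) (ULift.up (chain p))).down,
    fun {n p q} h ↦ by rw [chain_congr h], fun {n m} f p ↦ ?_, fun {n} p i j h ↦ ?_⟩⟩
  · have := σ.naturality (SimplexCategory.mkHom f).op
    let x : (SSet.uliftFunctor.{max u v, w}.obj (nerve (SingleObj Γ))).obj (.op (.mk m)) :=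
      ULift.up (chain p)
    have := congrArg ULift.down (ConcreteCategory.congr_hom this x)
    exact this
  · let x : (SSet.uliftFunctor.{max u v, w}.obj (nerve (SingleObj Γ))).obj (.op (.mk n)) :=
      ULift.up (chain p)
    have := congrArg ULift.down
      (ConcreteCategory.congr_hom (NatTrans.congr_app hσ (.op (.mk n))) x)
    exact congrArg (fun F : ComposableArrows (SingleObj Γ) n ↦ (F.map (homOfLE h) : Γ)) this

namespace ChainSection

variable {Ψ : 𝒢 ⥤ Discrete Γ} (s : ChainSection Ψ)

/-- The monotone map `Fin 2 → Fin (n + 1)` given by `i ≤ j`. -/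
@[simps]
def edge {n : ℕ} {i j : Fin (n + 1)} (h : i ≤ j) : Fin 2 →o Fin (n + 1) where
  toFun := ![i, j]
  monotone' := by
    intro a b hab
    fin_cases a <;> fin_cases b <;> simp_all

/-- The monotone map `Fin 3 → Fin (n + 1)` given by `i ≤ j ≤ k`. -/
@[simps]
def triangle {n : ℕ} {i j k : Fin (n + 1)} (h : i ≤ j) (h' : j ≤ k) : Fin 3 →o Fin (n + 1) where
  toFun := ![i, j, k]
  monotone' := by
    intro a b hab
    fin_cases a <;> fin_cases b <;> simp_all; exact h.trans h'

/-- The objects of the splitting attached to a section. -/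
def obj (g : Γ) : 𝒢 := (s.simplex (n := 1) ![1, g]).obj (Fin.zero_le (1 : Fin 2))

/-- Restricting to the edge from `i` to `j` gives the sequence `p i, p j`, which has the same
differences as `1, g`. Hence an edge depends only on its image in Γ. -/
theorem simplex_obj {n : ℕ} (p : Fin (n + 1) → Γ) {i j : Fin (n + 1)} (h : i ≤ j) {g : Γ}
    (hg : p j * (p i)⁻¹ = g) : (s.simplex p).obj h = s.obj g := by
  have h1 := s.restrict (edge h) p
  have h2 : s.simplex (p ∘ edge h) = s.simplex ![1, g] := s.congr fun a b ↦ by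
    subst hg
    fin_cases a <;> fin_cases b <;> simp
  rw [h1] at h2
  exact congrArg (fun t ↦ t.obj (Fin.zero_le (1 : Fin 2))) h2

/-- The isomorphisms of the splitting attached to a section. -/
def iso {g h k : Γ} (e : g * h = k) : s.obj g ⊗ s.obj h ≅ s.obj k :=
  -- The sequence `1, h, k` with `k = g * h` has edges `h` from 0 to 1, `g` from 1 to 2, and `k`
  -- from 0 to 2.
  eqToIso (congrArg₂ (· ⊗ ·)
      (s.simplex_obj (n := 2) ![1, h, k] (i := 1) (j := 2) (by decide) (by simp [← e])).symm
      (s.simplex_obj (n := 2) ![1, h, k] (i := 0) (j := 1) (by decide) (by simp)).symm) ≪≫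
    (s.simplex (n := 2) ![1, h, k]).comp (i := 0) (j := 1) (k := 2) (by decide) (by decide) ≪≫
    eqToIso (s.simplex_obj _ _ (by simp))

/-- The same argument for triangles: every 2-face with edges `h` and `g` carries the multiplication
defined from the standard 2-simplex, up to the equalities of objects. It will be applied to the four
faces of one 3-simplex. -/
theorem iso_hom_eq {n : ℕ} (p : Fin (n + 1) → Γ) {i j l : Fin (n + 1)} (h₁ : i ≤ j) (h₂ : j ≤ l)
    {g h k : Γ} (e : g * h = k) (hg : p l * (p j)⁻¹ = g) (hh : p j * (p i)⁻¹ = h) :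
    (s.iso e).hom = eqToHom (congrArg₂ (· ⊗ ·) (s.simplex_obj p h₂ hg).symm
      (s.simplex_obj p h₁ hh).symm) ≫ ((s.simplex p).comp h₁ h₂).hom ≫
      eqToHom (s.simplex_obj p _ (by rw [← e, ← hg, ← hh]; group)) := by
  have h1 := s.restrict (triangle h₁ h₂) p
  have h2 : s.simplex (p ∘ triangle h₁ h₂) = s.simplex ![1, h, k] := s.congr fun a b ↦ by
    subst hg hh e
    fin_cases a <;> fin_cases b <;> simp
  rw [h1] at h2
  have h3 := BSimplex.comp_hom_congr h2.symm (i := 0) (j := 1) (k := 2) (by decide) (by decide)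
  simp only [iso, Iso.trans_hom, eqToIso.hom, h3, Category.assoc, eqToHom_trans,
    eqToHom_trans_assoc]
  rfl

/-- All six objects are replaced by variables, so that substitution removes the transports at once
and leaves the associativity axiom of the simplex. -/
theorem _root_.CategoricalDescent.BSimplex.assoc_transport {I : Type} [Preorder I] (t : BSimplex 𝒢 I) {i j k l : I} (hij : i ≤ j)
    (hjk : j ≤ k) (hkl : k ≤ l) {X Y Z XY YZ XYZ : 𝒢} (hX : t.obj hij = X) (hY : t.obj hjk = Y)
    (hZ : t.obj hkl = Z) (hXY : t.obj (hij.trans hjk) = XY) (hYZ : t.obj (hjk.trans hkl) = YZ)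
    (hXYZ : t.obj (hij.trans (hjk.trans hkl)) = XYZ) :
    (eqToHom (by rw [hZ, hY]) ≫ (t.comp hjk hkl).hom ≫ eqToHom hYZ) ▷ X ≫
      (eqToHom (by rw [hYZ, hX]) ≫ (t.comp hij (hjk.trans hkl)).hom ≫ eqToHom hXYZ) =
    (α_ Z Y X).hom ≫ Z ◁ (eqToHom (by rw [hX, hY]) ≫ (t.comp hij hjk).hom ≫ eqToHom hXY) ≫
      (eqToHom (by rw [hXY, hZ]) ≫ (t.comp (hij.trans hjk) hkl).hom ≫ eqToHom hXYZ) := by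
  subst hX hY hZ hXY hYZ hXYZ
  simpa using t.assoc hij hjk hkl

/-- The `MulData` attached to a section. -/
@[simps obj]
def mulData : MulData Γ 𝒢 where
  obj := s.obj
  iso e := s.iso e
  assoc {g h k a b c} e₁ e₂ e₃ e₄ := by
    -- The 3-simplex with consecutive edges `k`, `h`, `g`: its four faces are the four
    -- multiplications in the associativity law.
    let p : Fin 4 → Γ := ![1, k, b, c]
    rw [s.iso_hom_eq p (i := 1) (j := 2) (l := 3) (by decide) (by decide) e₁
        (by simp [p, ← e₄]) (by simp [p, ← e₃]),
      s.iso_hom_eq p (i := 0) (j := 1) (l := 3) (by decide) (by decide) e₂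
        (by simp [p, ← e₂]) (by simp [p]),
      s.iso_hom_eq p (i := 0) (j := 1) (l := 2) (by decide) (by decide) e₃
        (by simp [p, ← e₃]) (by simp [p]),
      s.iso_hom_eq p (i := 0) (j := 2) (l := 3) (by decide) (by decide) e₄
        (by simp [p, ← e₄]) (by simp [p])]
    exact BSimplex.assoc_transport (s.simplex p) (i := 0) (j := 1) (k := 2) (l := 3) (by decide)
      (by decide) (by decide) (s.simplex_obj p _ (by simp [p]))
      (s.simplex_obj p _ (by simp [p, ← e₃])) (s.simplex_obj p _ (by simp [p, ← e₄])) _ _ _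

theorem nonempty_splitting [IsCategoricalGroup 𝒢] (s : ChainSection Ψ) : Nonempty (Splitting Ψ) := by
  obtain ⟨S, -⟩ := s.mulData.exists_splitting (Ψ := Ψ) fun g ↦ by
    exact (s.eq (n := 1) ![1, g] (Fin.zero_le 1)).trans (by simp)
  exact ⟨S⟩

end ChainSection

theorem nonempty_splitting_iff_hasSection [IsCategoricalGroup 𝒢] (Ψ : 𝒢 ⥤ Discrete Γ)
    [Ψ.Monoidal] : Nonempty (Splitting Ψ) ↔ HasSection Ψ :=
  ⟨fun ⟨S⟩ ↦ (MulData.ofSplitting S).hasSection (MulData.unitOfSplitting S) S.comp_eq,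
    fun h ↦ h.nonempty_chainSection.some.nonempty_splitting⟩

end CategoricalGroups

/-! ### The obstruction class of a weak splitting -/

section Obstruction

variable {Γ : Type w} [Group Γ] {𝒢 : Type u} [Category.{v} 𝒢] [MonoidalCategory 𝒢]

/-- By the interchange law, `a` acts as an endomorphism of the identity functor. It can therefore be
moved past every morphism in the cochain computations below. -/
theorem leftAct_naturality (a : Aut (𝟙_ 𝒢)) {X Y : 𝒢} (f : X ⟶ Y) :
    leftAct a X ≫ f = f ≫ leftAct a Y := by
  simp only [leftAct, Category.assoc, leftUnitor_inv_naturality_assoc, whisker_exchange_assoc,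
    leftUnitor_naturality]

theorem leftAct_naturality_assoc (a : Aut (𝟙_ 𝒢)) {X Y Z : 𝒢} (f : X ⟶ Y) (f' : Y ⟶ Z) :
    leftAct a X ≫ f ≫ f' = f ≫ leftAct a Y ≫ f' := by
  rw [← Category.assoc, leftAct_naturality, Category.assoc]

@[simp]
theorem leftAct_one (X : 𝒢) : leftAct 1 X = 𝟙 X := by
  simp [leftAct, show (1 : Aut (𝟙_ 𝒢)).hom = 𝟙 _ from rfl]

theorem leftAct_mul (a b : Aut (𝟙_ 𝒢)) (X : 𝒢) : leftAct (a * b) X = leftAct b X ≫ leftAct a X := by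
  simp [leftAct, show (a * b).hom = b.hom ≫ a.hom from rfl]

theorem leftAct_mul' (a b : Aut (𝟙_ 𝒢)) (X : 𝒢) :
    leftAct (a * b) X = leftAct a X ≫ leftAct b X := by
  rw [mul_comm, leftAct_mul]

theorem rightAct_mul (a b : Aut (𝟙_ 𝒢)) (X : 𝒢) :
    rightAct X (a * b) = rightAct X b ≫ rightAct X a := by
  simp [rightAct, show (a * b).hom = b.hom ≫ a.hom from rfl]

theorem leftAct_tensor (a : Aut (𝟙_ 𝒢)) (X Y : 𝒢) : leftAct a (X ⊗ Y) = leftAct a X ▷ Y := by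
  simp [leftAct]

theorem rightAct_tensor (X Y : 𝒢) (a : Aut (𝟙_ 𝒢)) : rightAct (X ⊗ Y) a = X ◁ rightAct Y a := by
  simp [rightAct]

/-- The triangle axiom: an automorphism of a unit placed between `X` and `Y` may be absorbed on
either side. -/
theorem whiskerLeft_leftAct (X : 𝒢) (a : Aut (𝟙_ 𝒢)) (Y : 𝒢) :
    X ◁ leftAct a Y = rightAct X a ▷ Y := by
  simp [leftAct, rightAct]

theorem rightAct_naturality (a : Aut (𝟙_ 𝒢)) {X Y : 𝒢} (f : X ⟶ Y) :
    rightAct X a ≫ f = f ≫ rightAct Y a := by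
  simp only [rightAct, Category.assoc, rightUnitor_inv_naturality_assoc, ← whisker_exchange_assoc,
    rightUnitor_naturality]

theorem leftAct_unit (a : Aut (𝟙_ 𝒢)) : leftAct a (𝟙_ 𝒢) = rightAct (𝟙_ 𝒢) a := by
  have := rightUnitor_naturality a.hom
  have h := leftUnitor_naturality a.hom
  simp only [leftAct, rightAct, unitors_equal, unitors_inv_equal] at *
  rw [this, h]

namespace WeakSplitting

variable {Ψ : 𝒢 ⥤ Discrete Γ} {Φ : WeakSplitting Ψ}
  {J : ∀ g h, Φ.obj g ⊗ Φ.obj h ≅ Φ.obj (g * h)}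

variable (J) in
/-- The isomorphisms `Φ g ⊗ Φ h ≅ Φ k` for `k = g * h`. -/
def isoOfEq {g h k : Γ} (e : g * h = k) : Φ.obj g ⊗ Φ.obj h ≅ Φ.obj k :=
  J g h ≪≫ eqToIso (congrArg Φ.obj e)

/-- Free indices `a`, `b`, `c` absorb the transport along associativity of Γ, which lets several
instances be composed in the pentagon. -/
theorem IsAssociator.eq {ω : Γ → Γ → Γ → Aut (𝟙_ 𝒢)} (hω : Φ.IsAssociator J ω) {g h k a b c : Γ}
    (e₁ : g * h = a) (e₂ : a * k = c) (e₃ : h * k = b) (e₄ : g * b = c) :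
    (isoOfEq J e₁).hom ▷ Φ.obj k ≫ (isoOfEq J e₂).hom ≫ leftAct (ω g h k) (Φ.obj c) =
      (α_ (Φ.obj g) (Φ.obj h) (Φ.obj k)).hom ≫ Φ.obj g ◁ (isoOfEq J e₃).hom ≫
        (isoOfEq J e₄).hom := by
  subst e₁ e₂ e₃
  simpa [isoOfEq] using hω g h k

end WeakSplitting

variable [IsCategoricalGroup 𝒢]

/-- Tensoring with the invertible object `X` identifies the automorphisms of the unit with the
endomorphisms of `X`. This and the next lemma say that parallel isomorphisms differ by exactly one
automorphism of the unit. -/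
theorem leftAct_injective (X : 𝒢) {a b : Aut (𝟙_ 𝒢)} (h : leftAct a X = leftAct b X) : a = b := by
  ext
  apply whiskerRight_injective X
  simpa [leftAct] using h

theorem exists_leftAct_eq {X : 𝒢} (f : X ⟶ X) : ∃ a, leftAct a X = f := by
  obtain ⟨a, ha⟩ := exists_whiskerRight_eq X ((λ_ X).hom ≫ f ≫ (λ_ X).inv)
  have : IsIso a := IsCategoricalGroup.isIso a
  refine ⟨asIso a, ?_⟩
  simp [leftAct, ha]

/-- Conjugation by an object on the automorphism group of the unit object. -/
noncomputable def conj (X : 𝒢) : Aut (𝟙_ 𝒢) →* Aut (𝟙_ 𝒢) :=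
  MonoidHom.mk' (fun a ↦ (exists_leftAct_eq (rightAct X a)).choose) fun a b ↦
    leftAct_injective X <| by
      rw [leftAct_mul, (exists_leftAct_eq (rightAct X _)).choose_spec,
        (exists_leftAct_eq (rightAct X _)).choose_spec,
        (exists_leftAct_eq (rightAct X _)).choose_spec, rightAct_mul]

theorem leftAct_conj (X : 𝒢) (a : Aut (𝟙_ 𝒢)) : leftAct (conj X a) X = rightAct X a :=
  (exists_leftAct_eq (rightAct X a)).choose_spec

theorem conj_congr {X Y : 𝒢} (e : X ≅ Y) : conj X = conj Y := by
  ext1 a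
  apply leftAct_injective Y
  rw [leftAct_conj, ← cancel_epi e.hom, ← leftAct_naturality, leftAct_conj, rightAct_naturality]

theorem conj_tensor (X Y : 𝒢) (a : Aut (𝟙_ 𝒢)) : conj (X ⊗ Y) a = conj X (conj Y a) := by
  apply leftAct_injective (X ⊗ Y)
  rw [leftAct_conj, leftAct_tensor, leftAct_conj, ← whiskerLeft_leftAct, leftAct_conj,
    rightAct_tensor]

theorem conj_unit (a : Aut (𝟙_ 𝒢)) : conj (𝟙_ 𝒢) a = a := by
  apply leftAct_injective (𝟙_ 𝒢)
  rw [leftAct_conj, leftAct_unit]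

/-- Conjugation is multiplicative in the object and depends only on its isomorphism class, so a
tensor inverse of `X` conjugates by the inverse map. -/
theorem conj_bijective (X : 𝒢) : Function.Bijective (conj X) := by
  obtain ⟨Y, ⟨e⟩, ⟨e'⟩⟩ := IsCategoricalGroup.exists_inverse X
  refine Function.bijective_iff_has_inverse.2 ⟨conj Y, fun a ↦ ?_, fun a ↦ ?_⟩
  · rw [← conj_tensor, conj_congr e', conj_unit]
  · rw [← conj_tensor, conj_congr e, conj_unit]

namespace WeakSplitting

variable {Ψ : 𝒢 ⥤ Discrete Γ} (Φ : WeakSplitting Ψ)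

/-- The action of `Γ` on the automorphism group of the unit object. -/
noncomputable def act : Γ →* MulAut (Aut (𝟙_ 𝒢)) :=
  MonoidHom.mk' (fun g ↦ MulEquiv.ofBijective (conj (Φ.obj g)) (conj_bijective _)) fun g h ↦ by
    ext1 a
    obtain ⟨e⟩ := Φ.nonempty_iso g h
    exact (DFunLike.congr_fun (conj_congr e.symm) a).trans (conj_tensor _ _ a)

theorem isConjugation_act : Φ.IsConjugation Φ.act := fun g a ↦ leftAct_conj (Φ.obj g) a

variable {Φ} {J : ∀ g h, Φ.obj g ⊗ Φ.obj h ≅ Φ.obj (g * h)}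

theorem exists_isAssociator (J : ∀ g h, Φ.obj g ⊗ Φ.obj h ≅ Φ.obj (g * h)) :
    ∃ ω, Φ.IsAssociator J ω := by
  choose ω hω using fun g h k ↦ exists_leftAct_eq ((J (g * h) k).inv ≫ (J g h).inv ▷ Φ.obj k ≫
    (α_ (Φ.obj g) (Φ.obj h) (Φ.obj k)).hom ≫ Φ.obj g ◁ (J h k).hom ≫ (J g (h * k)).hom ≫
      eqToHom (congrArg Φ.obj (mul_assoc g h k).symm))
  exact ⟨ω, fun g h k ↦ by rw [hω]; simp⟩

/-- The pentagon. Each reassociation of a fourfold product contributes one value of `ω`: three along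
one side of the pentagon, two along the other. The coherence of the associator of `𝒢` equates the
two products. -/
theorem IsAssociator.mem_ker {ω : Γ → Γ → Γ → Aut (𝟙_ 𝒢)} (hω : Φ.IsAssociator J ω) :
    ω ∈ (d₃ Φ.act).ker := by
  rw [MonoidHom.mem_ker]
  ext1 g; ext1 h; ext1 k; ext1 l
  have key : ω g h k * ω g (h * k) l * Φ.act g (ω h k l) = ω (g * h) k l * ω g h (k * l) := by
    apply leftAct_injective (Φ.obj (g * h * k * l))
    have a1 := hω.eq (J := J) (rfl : g * h = _) (rfl : g * h * k = _) rfl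
      (mul_assoc g h k).symm
    have a2 := hω.eq (J := J) (mul_assoc g h k).symm (rfl : g * h * k * l = _)
      (rfl : h * k * l = _) (by simp only [mul_assoc])
    have a3 := hω.eq (J := J) (rfl : h * k = _) rfl (rfl : k * l = _)
      (mul_assoc h k l).symm
    have a4 := hω.eq (J := J) (rfl : g * h * k = _) (rfl : g * h * k * l = _)
      (rfl : k * l = _) (mul_assoc (g * h) k l).symm
    have a5 := hω.eq (J := J) (rfl : g * h = _) (mul_assoc (g * h) k l).symm
      (mul_assoc h k l).symm (by simp only [mul_assoc] : g * (h * k * l) = g * h * k * l)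
    -- The factor `ω h k l` arises to the right of `Φ.obj g`; pulling it out conjugates it, which is
    -- the twisted term of `d₃`.
    have b : leftAct (Φ.act g (ω h k l)) (Φ.obj g ⊗ Φ.obj (h * k * l)) =
        Φ.obj g ◁ leftAct (ω h k l) (Φ.obj (h * k * l)) := by
      rw [leftAct_tensor, whiskerLeft_leftAct, Φ.isConjugation_act]
    -- `T` multiplies the four factors from the left. Followed by the values of `ω` on either side
    -- of the pentagon, it becomes the multiplication from the right, preceded by associators (`L`
    -- and `R`).
    let T := (isoOfEq J (rfl : g * h = _)).hom ▷ Φ.obj k ▷ Φ.obj l ≫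
      (isoOfEq J (rfl : g * h * k = _)).hom ▷ Φ.obj l ≫
      (isoOfEq J (rfl : g * h * k * l = _)).hom
    have : IsIso T := IsCategoricalGroup.isIso T
    rw [← cancel_epi T]
    simp only [leftAct_mul', T, Category.assoc]
    have L : T ≫ leftAct (ω g h k) _ ≫ leftAct (ω g (h * k) l) _ ≫
        leftAct (Φ.act g (ω h k l)) _ = (α_ _ _ _).hom ▷ _ ≫ (α_ _ _ _).hom ≫
          _ ◁ (α_ _ _ _).hom ≫ _ ◁ _ ◁ (isoOfEq J (rfl : k * l = _)).hom ≫
          _ ◁ (isoOfEq J (mul_assoc h k l).symm).hom ≫ (isoOfEq J (by simp only [mul_assoc])).hom := by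
      simp only [T, Category.assoc]
      rw [← leftAct_naturality_assoc, leftAct_tensor, ← comp_whiskerRight_assoc,
        ← comp_whiskerRight_assoc, Category.assoc, a1]
      simp only [comp_whiskerRight, Category.assoc]
      rw [reassoc_of% a2, ← leftAct_naturality, b, associator_naturality_middle_assoc,
        ← MonoidalCategory.whiskerLeft_comp_assoc, ← MonoidalCategory.whiskerLeft_comp_assoc,
        Category.assoc, a3]
      simp only [MonoidalCategory.whiskerLeft_comp, Category.assoc]
    have R : T ≫ leftAct (ω (g * h) k l) _ ≫ leftAct (ω g h (k * l)) _ =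
        (α_ _ _ _).hom ≫ (α_ _ _ _).hom ≫ _ ◁ _ ◁ (isoOfEq J (rfl : k * l = _)).hom ≫
          _ ◁ (isoOfEq J (mul_assoc h k l).symm).hom ≫ (isoOfEq J (by simp only [mul_assoc])).hom := by
      simp only [T, Category.assoc]
      rw [reassoc_of% a4, associator_naturality_left_assoc, ← whisker_exchange_assoc, a5]
      simp only [tensor_whiskerLeft, Category.assoc, Iso.inv_hom_id_assoc]
    simp only [T, Category.assoc] at L R
    rw [L, R, pentagon_assoc]
  simp only [d₃, MonoidHom.coe_mk, OneHom.coe_mk, Pi.one_apply]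
  rw [← mul_right_inj (ω (g * h) k l * ω g h (k * l)), mul_one]
  nth_rw 2 [← key]
  apply Additive.ofMul.injective
  simp only [ofMul_mul, ofMul_inv]
  abel

theorem IsAssociator.unique {ω ω' : Γ → Γ → Γ → Aut (𝟙_ 𝒢)} (hω : Φ.IsAssociator J ω)
    (hω' : Φ.IsAssociator J ω') : ω = ω' := by
  ext1 g; ext1 h; ext1 k
  apply leftAct_injective (Φ.obj (g * h * k))
  rw [← cancel_epi (J (g * h) k).hom, ← cancel_epi ((J g h).hom ▷ Φ.obj k)]
  exact (hω g h k).trans (hω' g h k).symm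

/-- Each of the four occurrences of `J` contributes one term of `d₂ θ`; the one to the right of
`Φ.obj g` is conjugated, as in the pentagon argument. -/
theorem IsAssociator.modify {ω : Γ → Γ → Γ → Aut (𝟙_ 𝒢)} (hω : Φ.IsAssociator J ω)
    {J' : ∀ g h, Φ.obj g ⊗ Φ.obj h ≅ Φ.obj (g * h)} (θ : Γ → Γ → Aut (𝟙_ 𝒢))
    (hJ : ∀ g h, (J' g h).hom = (J g h).hom ≫ leftAct (θ g h) _) :
    Φ.IsAssociator J' (ω * d₂ Φ.act θ) := by
  intro g h k
  have b : leftAct (Φ.act g (θ h k)) (Φ.obj g ⊗ Φ.obj (h * k)) =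
      Φ.obj g ◁ leftAct (θ h k) (Φ.obj (h * k)) := by
    rw [leftAct_tensor, whiskerLeft_leftAct, Φ.isConjugation_act]
  have e : θ g h * (θ (g * h) k * (ω * d₂ Φ.act θ) g h k) =
      ω g h k * (θ g (h * k) * Φ.act g (θ h k)) := by
    simp only [d₂, MonoidHom.coe_mk, OneHom.coe_mk, Pi.mul_apply]
    apply Additive.ofMul.injective
    simp only [ofMul_mul, ofMul_inv]
    abel
  simp only [hJ, comp_whiskerRight, MonoidalCategory.whiskerLeft_comp, Category.assoc]
  rw [← leftAct_tensor, leftAct_naturality_assoc, ← leftAct_mul', ← leftAct_mul', e, leftAct_mul',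
    reassoc_of% hω g h k, ← b, leftAct_naturality_assoc, leftAct_naturality_assoc]
  rw [← leftAct_naturality, leftAct_mul', Category.assoc]

theorem exists_modify (J J' : ∀ g h, Φ.obj g ⊗ Φ.obj h ≅ Φ.obj (g * h)) :
    ∃ θ : Γ → Γ → Aut (𝟙_ 𝒢), ∀ g h, (J' g h).hom = (J g h).hom ≫ leftAct (θ g h) _ := by
  choose θ hθ using fun g h ↦ exists_leftAct_eq ((J g h).inv ≫ (J' g h).hom)
  exact ⟨θ, fun g h ↦ by simp [hθ]⟩

/-- If `ω = d₂ θ`, correcting `J` by `θ⁻¹` makes it strictly associative, that is, `MulData`.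
Conversely, a splitting with values isomorphic to the `Φ.obj g` can be transported to them and
supplies a `J` with `ω = 1`. -/
theorem exists_isObstruction (Φ : WeakSplitting Ψ) : ∃ o, Φ.IsObstruction Φ.act o ∧
    (o = 1 ↔ ∃ S : Splitting Ψ, Φ.IsRefinedBy S) := by
  let J : ∀ g h, Φ.obj g ⊗ Φ.obj h ≅ Φ.obj (g * h) := fun g h ↦ (Φ.nonempty_iso g h).some
  obtain ⟨ω, hω⟩ := exists_isAssociator J
  have hob : Φ.IsObstruction Φ.act (QuotientGroup.mk ⟨ω, hω.mem_ker⟩) := by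
    intro J'
    obtain ⟨θ, hθ⟩ := exists_modify J J'
    refine ⟨⟨_, (hω.modify θ hθ).mem_ker⟩, hω.modify θ hθ, ?_⟩
    rw [QuotientGroup.eq, Subgroup.mem_subgroupOf]
    -- Equality of cosets compares the inverse of the new cocycle with the old one, hence the
    -- inverse of `θ`.
    exact ⟨θ⁻¹, by simp⟩
  refine ⟨_, hob, fun h ↦ ?_, fun ⟨S, hS⟩ ↦ ?_⟩
  · rw [QuotientGroup.eq_one_iff, Subgroup.mem_subgroupOf] at h
    obtain ⟨θ, hθ⟩ := h
    have i : ∀ g h, IsIso (leftAct (θ⁻¹ g h) (Φ.obj (g * h))) := fun _ _ ↦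
      IsCategoricalGroup.isIso _
    let J' : ∀ g h, Φ.obj g ⊗ Φ.obj h ≅ Φ.obj (g * h) := fun g h ↦
      J g h ≪≫ asIso (leftAct (θ⁻¹ g h) _)
    have h1 := hω.modify (J' := J') θ⁻¹ fun g h ↦ rfl
    rw [map_inv, hθ] at h1
    simp only [mul_inv_cancel] at h1
    obtain ⟨S, hS⟩ := (MulData.ofIso Φ.obj J' fun g h k ↦ by simpa using h1 g h k).exists_splitting
      Φ.obj_eq
    exact ⟨S, fun g ↦ ⟨eqToIso (hS g)⟩⟩
  · let m := (MulData.ofSplitting S).transport Φ.obj fun g ↦ (hS g).some.symm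
    obtain ⟨ω', h1, h2⟩ := hob fun g h ↦ m.iso (rfl : g * h = _)
    rw [← h2, QuotientGroup.eq_one_iff, Subgroup.mem_subgroupOf]
    have : ω'.1 = 1 := h1.unique fun g h k ↦ by
      have := m.assoc (rfl : g * h = _) rfl rfl (mul_assoc g h k).symm
      rw [m.iso_eq rfl (mul_assoc g h k).symm] at this
      simp only [Pi.one_apply, leftAct_one, Category.comp_id]
      exact this
    rw [this]
    exact one_mem _

end WeakSplitting

end Obstruction

/-! ### Semisimplicity and von Neumann regularity -/

section Regular

variable {C : Type*} [Category* C]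

/-- Von Neumann regular morphisms: those with a quasi-inverse. -/
def IsRegularMor {X Y : C} (f : X ⟶ Y) : Prop := ∃ g : Y ⟶ X, f ≫ g ≫ f = f

variable [Preadditive C]

/-- A decomposition of an object as a finite direct sum of simple objects. -/
structure SimpleDecomposition (X : C) where
  J : Type
  [fintype : Fintype J]
  S : J → C
  simple : ∀ j, Simple (S j)
  ι : ∀ j, S j ⟶ X
  π : ∀ j, X ⟶ S j
  ι_π_self : ∀ j, ι j ≫ π j = 𝟙 _
  ι_π_ne : ∀ i j, i ≠ j → ι i ≫ π j = 0
  total : ∑ j, π j ≫ ι j = 𝟙 X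

attribute [instance] SimpleDecomposition.fintype SimpleDecomposition.simple

theorem IsSemisimpleAbelian.nonempty_simpleDecomposition [IsSemisimpleAbelian C] (X : C) :
    Nonempty (SimpleDecomposition X) := by
  obtain ⟨n, S, b, hS, ⟨hb⟩, ⟨e⟩⟩ := IsSemisimpleAbelian.exists_simple_decomposition X
  exact ⟨{
    J := Fin n
    S := S
    simple := hS
    ι j := b.ι j ≫ e.inv
    π j := e.hom ≫ b.π j
    ι_π_self j := by simp
    ι_π_ne i j h := by simp [bicone_ι_π_ne b h]
    total := by
      have := IsBilimit.total hb
      simp only [Category.assoc]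
      simp only [← Category.assoc (b.π _), ← Preadditive.comp_sum, ← Preadditive.sum_comp, this]
      simp }⟩

/-- Schur's lemma: a nonzero component of `f` is invertible, and inverting it splits `f`. -/
theorem isRegularMor_of_simple [HasKernels C] {S Y : C} [Simple S] (d : SimpleDecomposition Y) (f : S ⟶ Y) :
    IsRegularMor f := by
  by_cases h : ∃ j, f ≫ d.π j ≠ 0
  · obtain ⟨j, hj⟩ := h
    have := isIso_of_hom_simple hj
    exact ⟨d.π j ≫ inv (f ≫ d.π j), by
      rw [Category.assoc, ← Category.assoc f, IsIso.hom_inv_id_assoc]⟩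
  · push Not at h
    have : f = 0 := by
      rw [← Category.comp_id f, ← d.total, Preadditive.comp_sum]
      exact Finset.sum_eq_zero fun j _ ↦ by rw [reassoc_of% (h j), zero_comp]
    exact ⟨0, by simp [this]⟩

/-- A quasi-inverse is improved one simple summand of `X` at a time. The error `f - f ≫ g ≫ f`
vanishes on the summands already treated, and is to be killed on one more. -/
theorem SimpleDecomposition.isRegularMor [HasKernels C] {X Y : C} (d : SimpleDecomposition X)
    (d' : SimpleDecomposition Y) (f : X ⟶ Y) : IsRegularMor f := by
  classical
  have key : ∀ s : Finset d.J, ∃ g : Y ⟶ X, ∀ j ∈ s, d.ι j ≫ f ≫ g ≫ f = d.ι j ≫ f := by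
    intro s
    induction s using Finset.induction_on with
    | empty => exact ⟨0, by simp⟩
    | insert i s _ ih =>
      obtain ⟨g, hg⟩ := ih
      obtain ⟨r, hr⟩ := isRegularMor_of_simple d' (d.ι i ≫ (f - f ≫ g ≫ f))
      -- With `t` the old error, the new error is `t - t ≫ r ≫ d.ι i ≫ t`. It vanishes on summand
      -- `i` since `r` is a quasi-inverse of `d.ι i ≫ t`, and still vanishes wherever `t` did.
      refine ⟨g + (𝟙 _ - g ≫ f) ≫ r ≫ d.ι i ≫ (𝟙 _ - f ≫ g), fun j hj ↦ ?_⟩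
      have e : f ≫ (g + (𝟙 _ - g ≫ f) ≫ r ≫ d.ι i ≫ (𝟙 _ - f ≫ g)) ≫ f =
          f ≫ g ≫ f + (f - f ≫ g ≫ f) ≫ r ≫ d.ι i ≫ (f - f ≫ g ≫ f) := by
        simp only [Preadditive.comp_add, Preadditive.add_comp, Preadditive.comp_sub,
          Preadditive.sub_comp, Category.assoc, Category.id_comp, Category.comp_id]
      rw [e, Preadditive.comp_add]
      rcases Finset.mem_insert.1 hj with rfl | hj
      · rw [Category.assoc] at hr
        rw [hr]
        simp
      · have : d.ι j ≫ (f - f ≫ g ≫ f) = 0 := by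
          rw [Preadditive.comp_sub, hg j hj, sub_self]
        rw [reassoc_of% this, zero_comp, add_zero, hg j hj]
  obtain ⟨g, hg⟩ := key Finset.univ
  refine ⟨g, ?_⟩
  have e : ∀ t : X ⟶ Y, t = ∑ j, d.π j ≫ d.ι j ≫ t := fun t ↦ by
    simp only [← Category.assoc]
    rw [← Preadditive.sum_comp, d.total, Category.id_comp]
  rw [e (f ≫ g ≫ f)]
  conv_rhs => rw [e f]
  exact Finset.sum_congr rfl fun j hj ↦ by rw [hg j hj]

theorem IsSemisimpleAbelian.isRegularMor [IsSemisimpleAbelian C] {X Y : C} (f : X ⟶ Y) :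
    IsRegularMor f :=
  have := IsSemisimpleAbelian.hasKernels (C := C)
  (nonempty_simpleDecomposition X).some.isRegularMor (nonempty_simpleDecomposition Y).some f

theorem IsSemisimpleAbelian.isIdempotentComplete [IsSemisimpleAbelian C] :
    IsIdempotentComplete C :=
  have := IsSemisimpleAbelian.hasKernels (C := C)
  Idempotents.isIdempotentComplete_iff_idempotents_have_kernels C |>.2 fun _ _ _ ↦ inferInstance

theorem IsSemisimpleAbelian.hasFiniteBiproducts [IsSemisimpleAbelian C] :
    HasFiniteBiproducts C :=
  have := IsSemisimpleAbelian.hasFiniteProducts (C := C)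
  .of_hasFiniteProducts

/-- The decomposition of a direct sum. -/
def SimpleDecomposition.add {X Y Z : C} (d : SimpleDecomposition X) (d' : SimpleDecomposition Y)
    (i : X ⟶ Z) (p : Z ⟶ X) (i' : Y ⟶ Z) (p' : Z ⟶ Y) (h : i ≫ p = 𝟙 X) (h' : i' ≫ p' = 𝟙 Y)
    (h₁ : i ≫ p' = 0) (h₂ : i' ≫ p = 0) (t : p ≫ i + p' ≫ i' = 𝟙 Z) : SimpleDecomposition Z where
  J := d.J ⊕ d'.J
  S := Sum.elim d.S d'.S
  simple := by rintro (j | j) <;> dsimp <;> infer_instance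
  ι
    | .inl j => d.ι j ≫ i
    | .inr j => d'.ι j ≫ i'
  π
    | .inl j => p ≫ d.π j
    | .inr j => p' ≫ d'.π j
  ι_π_self := by
    rintro (j | j)
    · simp [reassoc_of% h, d.ι_π_self]
    · simp [reassoc_of% h', d'.ι_π_self]
  ι_π_ne := by
    rintro (j | j) (k | k) hjk
    · change (d.ι j ≫ i) ≫ p ≫ d.π k = 0
      simp [reassoc_of% h, d.ι_π_ne j k (by simpa using hjk)]
    · change (d.ι j ≫ i) ≫ p' ≫ d'.π k = 0
      simp [reassoc_of% h₁]
    · change (d'.ι j ≫ i') ≫ p ≫ d.π k = 0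
      simp [reassoc_of% h₂]
    · change (d'.ι j ≫ i') ≫ p' ≫ d'.π k = 0
      simp [reassoc_of% h', d'.ι_π_ne j k (by simpa using hjk)]
  total := by
    have a : ∑ j, p ≫ d.π j ≫ d.ι j ≫ i = p ≫ i := by
      rw [← Preadditive.comp_sum]
      simp only [← Category.assoc (d.π _)]
      rw [← Preadditive.sum_comp, d.total, Category.id_comp]
    have b : ∑ j, p' ≫ d'.π j ≫ d'.ι j ≫ i' = p' ≫ i' := by
      rw [← Preadditive.comp_sum]
      simp only [← Category.assoc (d'.π _)]
      rw [← Preadditive.sum_comp, d'.total, Category.id_comp]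
    rw [Fintype.sum_sum_type, ← t, ← a, ← b]
    exact congrArg₂ (· + ·) (Finset.sum_congr rfl fun _ _ ↦ Category.assoc _ _ _)
      (Finset.sum_congr rfl fun _ _ ↦ Category.assoc _ _ _)

variable (k : Type*) [Field k] [Linear k C]

/-- Induction on the dimension of the endomorphism algebra. A nonzero object that is not simple has
a proper nonzero subobject, which regularity splits off; the two nonzero summands have smaller
endomorphism algebras. -/
theorem nonempty_simpleDecomposition_of_regular [IsIdempotentComplete C] [HomFinite k C]
    (reg : ∀ {X Y : C} (f : X ⟶ Y), IsRegularMor f) (X : C) :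
    Nonempty (SimpleDecomposition X) := by
  have fin := HomFinite.finite (k := k) (C := C)
  induction hn : Module.finrank k (X ⟶ X) using Nat.strong_induction_on generalizing X with
  | _ n ih =>
  subst hn
  by_cases h0 : 𝟙 X = 0
  · exact ⟨{ J := Empty, S := Empty.elim, simple := nofun, ι := nofun, π := nofun, ι_π_self := nofun,
             ι_π_ne := nofun, total := by simp [h0] }⟩
  by_cases hs : Simple X
  · exact ⟨{ J := Unit, S := fun _ ↦ X, simple := fun _ ↦ hs, ι := fun _ ↦ 𝟙 X, π := fun _ ↦ 𝟙 X,
             ι_π_self := by simp, ι_π_ne := fun i j h ↦ (h rfl).elim, total := by simp }⟩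
  have : ∃ (Y : C) (f : Y ⟶ X), Mono f ∧ ¬ IsIso f ∧ f ≠ 0 := by
    by_contra! hcon
    refine hs ⟨fun {Y} f _ ↦ ⟨?_, fun h ↦ ?_⟩⟩
    · rintro h rfl
      exact h0 (by rw [← IsIso.inv_hom_id (0 : Y ⟶ X), comp_zero])
    · by_contra hf
      exact h (hcon Y f inferInstance hf)
  obtain ⟨Y, f, hm, hiso, hf0⟩ := this
  obtain ⟨g, hg⟩ := reg f
  have hfg : f ≫ g = 𝟙 Y := by rw [← cancel_mono f, Category.assoc, hg, Category.id_comp]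
  -- A monomorphism with a quasi-inverse is split, and `Z` is the complementary summand.
  obtain ⟨Z, i, p, hip, hpi⟩ := IsIdempotentComplete.idempotents_split X (𝟙 X - g ≫ f)
    (Idempotents.idem_of_id_sub_idem _ (by rw [Category.assoc, hg]))
  have h₁ : f ≫ p = 0 := by
    have : f ≫ p ≫ i = 0 := by rw [hpi, Preadditive.comp_sub, hg]; simp
    rw [← Category.comp_id p, ← hip, reassoc_of% this, zero_comp]
  have h₂ : i ≫ g = 0 := by
    have : p ≫ i ≫ g = 0 := by
      rw [← Category.assoc, hpi, Preadditive.sub_comp, Category.assoc, hfg]; simp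
    rw [← Category.id_comp i, ← hip, Category.assoc, Category.assoc, this, comp_zero]
  have hY : 𝟙 Y ≠ 0 := fun h ↦ hf0 (by rw [← Category.id_comp f, h, zero_comp])
  have hZ : 𝟙 Z ≠ 0 := fun h ↦ hiso ⟨g, hfg, by
    have : p ≫ i = 0 := by rw [← Category.comp_id p, h]; simp
    rw [hpi] at this
    exact (sub_eq_zero.1 this).symm⟩
  -- Block-diagonal endomorphisms: they embed in the endomorphisms of `X`, so both dimensions, being
  -- positive, are strictly smaller.
  let φ : ((Y ⟶ Y) × (Z ⟶ Z)) →ₗ[k] (X ⟶ X) :=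
    { toFun a := g ≫ a.1 ≫ f + p ≫ a.2 ≫ i
      map_add' a b := by simp; abel
      map_smul' c a := by simp }
  have hφ : Function.Injective φ := by
    rw [← LinearMap.ker_eq_bot, LinearMap.ker_eq_bot']
    rintro ⟨a, b⟩ (h : g ≫ a ≫ f + p ≫ b ≫ i = 0)
    have e₁ := congrArg (fun t ↦ f ≫ t ≫ g) h
    have e₂ := congrArg (fun t ↦ i ≫ t ≫ p) h
    simp only [Preadditive.add_comp, Category.assoc, hfg, h₁, h₂, hip,
      reassoc_of% hfg, reassoc_of% hip, zero_comp, comp_zero,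
      add_zero, zero_add, Category.comp_id] at e₁ e₂
    rw [e₁, e₂, Prod.mk_zero_zero]
  have hle := LinearMap.finrank_le_finrank_of_injective hφ
  rw [Module.finrank_prod] at hle
  have : Nontrivial (Y ⟶ Y) := ⟨_, _, hY⟩
  have : Nontrivial (Z ⟶ Z) := ⟨_, _, hZ⟩
  have p₁ := Module.finrank_pos (R := k) (M := Y ⟶ Y)
  have p₂ := Module.finrank_pos (R := k) (M := Z ⟶ Z)
  obtain ⟨d⟩ := ih _ (by omega) Y rfl
  obtain ⟨d'⟩ := ih _ (by omega) Z rfl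
  exact ⟨d.add d' f g i p hfg hip h₁ h₂ (by rw [hpi]; abel)⟩

/-- For a quasi-inverse `g` of `f`, the idempotents `𝟙 - f ≫ g` and `𝟙 - g ≫ f` split off the kernel
and the cokernel of `f`. A monomorphism is the kernel of the second, an epimorphism the cokernel of
the first. -/
theorem isSemisimpleAbelian_of_regular [IsIdempotentComplete C] [HomFinite k C]
    [HasFiniteProducts C] (reg : ∀ {X Y : C} (f : X ⟶ Y), IsRegularMor f) :
    IsSemisimpleAbelian C where
  hasFiniteProducts := inferInstance
  hasKernels := ⟨fun {X Y} f ↦ by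
    obtain ⟨g, hg⟩ := reg f
    obtain ⟨Z, i, p, hip, hpi⟩ := IsIdempotentComplete.idempotents_split X (𝟙 X - f ≫ g)
      (Idempotents.idem_of_id_sub_idem _ (by simp [reassoc_of% hg]))
    have hi : i ≫ f = 0 := by
      have : p ≫ i ≫ f = 0 := by rw [← Category.assoc, hpi, Preadditive.sub_comp]; simp [hg]
      rw [← Category.id_comp i, ← hip, Category.assoc, Category.assoc, this, comp_zero]
    have : Mono i := mono_of_mono_fac hip
    exact ⟨⟨⟨_, KernelFork.IsLimit.ofι' i hi fun k hk ↦ ⟨k ≫ p, by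
      rw [Category.assoc, hpi, Preadditive.comp_sub, reassoc_of% hk]; simp⟩⟩⟩⟩⟩
  hasCokernels := ⟨fun {X Y} f ↦ by
    obtain ⟨g, hg⟩ := reg f
    obtain ⟨Z, i, p, hip, hpi⟩ := IsIdempotentComplete.idempotents_split Y (𝟙 Y - g ≫ f)
      (Idempotents.idem_of_id_sub_idem _ (by simp [hg]))
    have hp : f ≫ p = 0 := by
      have : f ≫ p ≫ i = 0 := by rw [hpi, Preadditive.comp_sub]; simp [hg]
      rw [← Category.comp_id p, ← hip, reassoc_of% this, zero_comp]
    have : Epi p := epi_of_epi_fac hip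
    exact ⟨⟨⟨_, CokernelCofork.IsColimit.ofπ' p hp fun k hk ↦ ⟨i ≫ k, by
      rw [← Category.assoc, hpi, Preadditive.sub_comp, Category.assoc, hk]; simp⟩⟩⟩⟩⟩
  normalMono := ⟨fun {X Y} f _ ↦ by
    obtain ⟨g, hg⟩ := reg f
    exact ⟨⟨Y, 𝟙 Y - g ≫ f, by simp [hg], KernelFork.IsLimit.ofι' f _ fun k hk ↦ ⟨k ≫ g, by
      rw [Preadditive.comp_sub, sub_eq_zero, Category.comp_id] at hk
      simp [← hk]⟩⟩⟩⟩
  normalEpi := ⟨fun {X Y} f _ ↦ by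
    obtain ⟨g, hg⟩ := reg f
    exact ⟨⟨X, 𝟙 X - f ≫ g, by simp [hg], CokernelCofork.IsColimit.ofπ' f _ fun k hk ↦ ⟨g ≫ k, by
      rw [Preadditive.sub_comp, sub_eq_zero, Category.id_comp, Category.assoc] at hk
      exact hk.symm⟩⟩⟩⟩
  exists_simple_decomposition X := by
    obtain ⟨d⟩ := nonempty_simpleDecomposition_of_regular k reg X
    let e := Fintype.equivFin d.J
    let b : Bicone (fun i ↦ d.S (e.symm i)) :=
      { pt := X
        ι i := d.ι (e.symm i)
        π i := d.π (e.symm i)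
        ι_π i j := by
          split_ifs with h
          · subst h; exact d.ι_π_self _
          · exact d.ι_π_ne _ _ (by simpa using h) }
    exact ⟨_, _, b, fun i ↦ d.simple _, ⟨isBilimitOfTotal b
      ((Equiv.sum_comp e.symm fun j ↦ d.π j ≫ d.ι j).trans d.total)⟩, ⟨Iso.refl _⟩⟩

end Regular

/-- The vectors `(g b)` indexed by the automorphisms `g`, for `b` in `L`, span the whole space: a
nonzero linear form vanishing on them would be a linear relation between distinct automorphisms,
against Dedekind's independence. The identity's indicator function is therefore a combination of
them. -/
theorem exists_sum_mul_apply_eq_ite (K L : Type*) [Field K] [Field L] [Algebra K L]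
    [FiniteDimensional K L] [DecidableEq (L ≃ₐ[K] L)] : ∃ (s : Finset L) (c : L → L),
      ∀ g : L ≃ₐ[K] L, ∑ b ∈ s, c b * g b = if g = 1 then 1 else 0 := by
  let ev : L → (L ≃ₐ[K] L) → L := fun b g ↦ g b
  have h : Submodule.span L (Set.range ev) = ⊤ := by
    by_contra hne
    obtain ⟨f, hf, hle⟩ := Submodule.exists_le_ker_of_lt_top _ (lt_top_iff_ne_top.2 hne)
    have li := (linearIndependent_monoidHom L L).comp
      (fun g : L ≃ₐ[K] L ↦ (g : L →* L)) fun g h e ↦ by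
        exact AlgEquiv.ext fun x ↦ DFunLike.congr_fun e x
    rw [Fintype.linearIndependent_iff] at li
    have hs : ∀ g : L ≃ₐ[K] L, (fun j ↦ if g = j then (1 : L) else 0) = Pi.single g 1 := fun g ↦ by
      ext h
      simp [Pi.single_apply, eq_comm]
    have z := li (fun g ↦ f (Pi.single g 1)) (by
      ext b
      have := hle (Submodule.subset_span ⟨b, rfl⟩)
      rw [LinearMap.mem_ker, LinearMap.pi_apply_eq_sum_univ] at this
      simp only [hs] at this
      simpa [mul_comm, ev] using this)
    refine hf (LinearMap.ext fun x ↦ ?_)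
    rw [LinearMap.pi_apply_eq_sum_univ]
    exact Finset.sum_eq_zero fun g _ ↦ by rw [hs, z g, smul_zero]
  have hδ : (fun g : L ≃ₐ[K] L ↦ if g = 1 then (1 : L) else 0) ∈ Submodule.span L (Set.range ev) :=
    h ▸ Submodule.mem_top
  obtain ⟨c, hc⟩ := Finsupp.mem_span_range_iff_exists_finsupp.1 hδ
  refine ⟨c.support, c, fun g ↦ ?_⟩
  have := congrFun hc g
  simpa [Finsupp.sum, ev] using this

/-! ### Additive functors and direct sums with permuted summands -/

section Biproduct

variable {C : Type*} [Category* C] [Preadditive C] [HasFiniteBiproducts C] (F : C ⥤ C)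
  {J J' : Type*} [Finite J'] {A : J → C} {B : J' → C}

/-- The reindexing `e` is needed for induced objects, where `Φ g` carries the summand of `h` to that
of `g * h`. -/
theorem ι_sum_map [Fintype J] (e : J ≃ J') (w : ∀ j, B (e j) ⟶ F.obj (A j)) (j : J) :
    biproduct.ι B (e j) ≫ ∑ i, biproduct.π B (e i) ≫ w i ≫ F.map (biproduct.ι A i) =
      w j ≫ F.map (biproduct.ι A j) := by
  rw [Preadditive.comp_sum, Finset.sum_eq_single j]
  · simp
  · intro i _ h
    rw [biproduct.ι_π_ne_assoc _ (by simpa using h.symm), zero_comp]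
  · simp

theorem sum_π_ι_eq_id [Fintype J] (A : J → C) :
    ∑ j, biproduct.π A j ≫ biproduct.ι A j = 𝟙 (⨁ A) :=
  biproduct.hom_ext' _ _ fun j ↦ by
    rw [Preadditive.comp_sum, Finset.sum_eq_single j]
    · simp
    · intro i _ h
      rw [biproduct.ι_π_ne_assoc _ h.symm, zero_comp]
    · simp

variable [F.Additive]

theorem map_biproduct_hom_ext [Finite J] {Z : C} {f f' : F.obj (⨁ A) ⟶ Z}
    (h : ∀ j, F.map (biproduct.ι A j) ≫ f = F.map (biproduct.ι A j) ≫ f') : f = f' := by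
  have := Fintype.ofFinite J
  have t : ∑ j, F.map (biproduct.π A j) ≫ F.map (biproduct.ι A j) = 𝟙 _ := by
    simp only [← Functor.map_comp, ← Functor.map_sum]
    rw [sum_π_ι_eq_id, CategoryTheory.Functor.map_id]
  rw [← Category.id_comp f, ← Category.id_comp f', ← t, Preadditive.sum_comp, Preadditive.sum_comp]
  exact Finset.sum_congr rfl fun j _ ↦ by rw [Category.assoc, h, Category.assoc]

variable [Fintype J]

theorem map_ι_sum (e : J ≃ J') (w : ∀ j, F.obj (A j) ⟶ B (e j)) (j : J) :
    F.map (biproduct.ι A j) ≫ ∑ i, F.map (biproduct.π A i) ≫ w i ≫ biproduct.ι B (e i) =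
      w j ≫ biproduct.ι B (e j) := by
  rw [Preadditive.comp_sum, Finset.sum_eq_single j]
  · rw [← Functor.map_comp_assoc]
    simp
  · intro i _ h
    rw [← Functor.map_comp_assoc, biproduct.ι_π_ne _ h.symm]
    simp
  · simp

/-- An additive functor commutes with finite direct sums. -/
noncomputable def mapBiproductIso (e : J ≃ J') (w : ∀ j, F.obj (A j) ≅ B (e j)) :
    F.obj (⨁ A) ≅ ⨁ B where
  hom := ∑ i, F.map (biproduct.π A i) ≫ (w i).hom ≫ biproduct.ι B (e i)
  inv := ∑ i, biproduct.π B (e i) ≫ (w i).inv ≫ F.map (biproduct.ι A i)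
  hom_inv_id := map_biproduct_hom_ext F fun j ↦ by
    rw [← Category.assoc, map_ι_sum, Category.assoc, ι_sum_map]
    simp
  inv_hom_id := biproduct.hom_ext' _ _ fun k ↦ by
    obtain ⟨j, rfl⟩ := e.surjective k
    rw [← Category.assoc, ι_sum_map, Category.assoc, map_ι_sum]
    simp

theorem map_ι_mapBiproductIso_hom (e : J ≃ J') (w : ∀ j, F.obj (A j) ≅ B (e j)) (j : J) :
    F.map (biproduct.ι A j) ≫ (mapBiproductIso F e w).hom = (w j).hom ≫ biproduct.ι B (e j) :=
  map_ι_sum F e _ j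

end Biproduct

/-! ### Galois descent for stable objects -/

section Stable

variable {K L : Type w} [Field K] [Field L] [Algebra K L]
  {C : Type u} [Category.{v} C] [Preadditive C] [Linear L C]

namespace GaloisData

variable (d : GaloisData K L C)

/-- The isomorphisms `Φ g ∘ Φ h ≅ Φ k` for `k = g * h`. -/
def isoOfEq {g h k : L ≃ₐ[K] L} (e : g * h = k) : d.Φ h ⋙ d.Φ g ≅ d.Φ k :=
  d.J g h ≪≫ eqToIso (congrArg d.Φ e)

/-- The coherence of the data of a splitting. -/
structure IsCoherent : Prop where
  assoc {g h k a b c : L ≃ₐ[K] L} (e₁ : g * h = a) (e₂ : a * k = c) (e₃ : h * k = b)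
    (e₄ : g * b = c) (X : C) :
    (d.isoOfEq e₁).hom.app ((d.Φ k).obj X) ≫ (d.isoOfEq e₂).hom.app X =
      (d.Φ g).map ((d.isoOfEq e₃).hom.app X) ≫ (d.isoOfEq e₄).hom.app X
  unit : Nonempty (d.Φ 1 ≅ 𝟭 C)

end GaloisData

namespace StableObj

variable {d : GaloisData K L C}

section action

variable {X Y Z : StableObj d}

/-- The action of the Galois group on the morphisms of `C` between stable objects. -/
def act (X Y : StableObj d) (g : L ≃ₐ[K] L) : (X.obj ⟶ Y.obj) →+ (X.obj ⟶ Y.obj) :=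
  AddMonoidHom.mk' (fun f ↦ (X.α g).inv ≫ (d.Φ g).map f ≫ (Y.α g).hom) fun f f' ↦ by simp

theorem act_apply (g : L ≃ₐ[K] L) (f : X.obj ⟶ Y.obj) :
    act X Y g f = (X.α g).inv ≫ (d.Φ g).map f ≫ (Y.α g).hom := rfl

theorem act_smul (g : L ≃ₐ[K] L) (a : L) (f : X.obj ⟶ Y.obj) :
    act X Y g (a • f) = g a • act X Y g f := by
  simp [act_apply, d.map_smul]

theorem act_comp (g : L ≃ₐ[K] L) (f : X.obj ⟶ Y.obj) (f' : Y.obj ⟶ Z.obj) :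
    act X Z g (f ≫ f') = act X Y g f ≫ act Y Z g f' := by
  simp [act_apply]

theorem act_hom (g : L ≃ₐ[K] L) (f : X ⟶ Y) : act X Y g f.hom = f.hom := f.comm g

/-- The condition on `α (g * h)` makes the maps multiplicative in `g`; the isomorphisms `J g h`
cancel by naturality. -/
theorem act_mul (g h : L ≃ₐ[K] L) (f : X.obj ⟶ Y.obj) :
    act X Y g (act X Y h f) = act X Y (g * h) f := by
  have hX : (X.α (g * h)).hom = (d.J g h).inv.app X.obj ≫ (d.Φ g).map (X.α h).hom ≫ (X.α g).hom := by
    rw [← X.α_mul]; simp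
  have hY : (Y.α (g * h)).hom = (d.J g h).inv.app Y.obj ≫ (d.Φ g).map (Y.α h).hom ≫ (Y.α g).hom := by
    rw [← Y.α_mul]; simp
  have e : X.α (g * h) = (d.J g h).symm.app X.obj ≪≫ (d.Φ g).mapIso (X.α h) ≪≫ X.α g := Iso.ext hX
  simp [act_apply, hY, e]

/-- No normalisation of `α 1` is required of a stable object. The action of `1` is idempotent by
`act_mul`, and injective because `Φ 1`, being isomorphic to the identity, is faithful. -/
theorem act_one (hd : d.IsCoherent) (f : X.obj ⟶ Y.obj) : act X Y 1 f = f := by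
  obtain ⟨e⟩ := hd.unit
  have h := act_mul 1 1 f
  rw [mul_one, act_apply _ (act X Y 1 f), act_apply _ f, Iso.cancel_iso_inv_left,
    Iso.cancel_iso_hom_right] at h
  have n : ∀ {A B : C} {f f' : A ⟶ B}, (d.Φ 1).map f = (d.Φ 1).map f' → f = f' := fun h ↦ by
    rw [← cancel_epi (e.hom.app _)]
    simpa using congrArg (· ≫ e.hom.app _) h
  exact n h

/-- The map `L ⊗ Hom(X, Y) ⟶ Hom(X.obj, Y.obj)`, `a ⊗ f ↦ a • f`. -/
def extHom (X Y : StableObj d) : L ⊗[K] (X ⟶ Y) →+ (X.obj ⟶ Y.obj) :=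
  TensorProduct.liftAddHom
    (AddMonoidHom.mk' (fun a ↦ AddMonoidHom.mk' (fun f : X ⟶ Y ↦ a • f.hom) fun f f' ↦ by simp)
      fun a b ↦ by ext f; simp [add_smul])
    fun r a f ↦ by simp [smul_smul, Algebra.smul_def, mul_comm]

variable [FiniteDimensional K L]

/-- Averaging a morphism of `C` over the Galois group. -/
noncomputable def avg (X Y : StableObj d) : (X.obj ⟶ Y.obj) →+ (X ⟶ Y) :=
  AddMonoidHom.mk' (fun f ↦ ⟨∑ g, act X Y g f, fun g ↦ by
    change act X Y g _ = _
    rw [map_sum]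
    simp only [act_mul]
    exact Fintype.sum_equiv (Equiv.mulLeft g) _ _ fun _ ↦ rfl⟩) fun f f' ↦ by
      ext
      simp [Finset.sum_add_distrib]

theorem avg_hom (f : X.obj ⟶ Y.obj) : (avg X Y f).hom = ∑ g, act X Y g f := rfl

theorem avg_smul_hom [IsGalois K L] (a : L) (f : X ⟶ Y) :
    avg X Y (a • f.hom) = Algebra.trace K L a • f := by
  ext
  rw [avg_hom, smul_hom, trace_eq_sum_automorphisms, Finset.sum_smul]
  simp [act_smul, act_hom]

/-- In the double sum over `b` and `g` the coefficient of `act X Y g f` is the sum of the `c b * g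
b`, which selects `g = 1`. So every morphism is an `L`-combination of invariant ones. -/
theorem sum_smul_avg_hom (hd : d.IsCoherent) [DecidableEq (L ≃ₐ[K] L)] {s : Finset L} {c : L → L}
    (hc : ∀ g : L ≃ₐ[K] L, ∑ b ∈ s, c b * g b = if g = 1 then 1 else 0) (f : X.obj ⟶ Y.obj) :
    ∑ b ∈ s, c b • (avg X Y (b • f)).hom = f := by
  simp only [avg_hom, act_smul, Finset.smul_sum, smul_smul]
  rw [Finset.sum_comm]
  simp only [← Finset.sum_smul, hc]
  simp [act_one hd]

/-- An element of trace 1 exists because the extension is separable. Weighting by it gives a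
projection to the invariants in every characteristic. -/
theorem exists_avg_eq [IsGalois K L] (d : GaloisData K L C) : ∃ a : L, ∀ {X Y : StableObj d}
    (f : X ⟶ Y), avg X Y (a • f.hom) = f := by
  obtain ⟨a, ha⟩ := Algebra.trace_surjective K L 1
  exact ⟨a, fun f ↦ by rw [avg_smul_hom, ha, one_smul]⟩

/-- Descent for the semilinear action on morphisms. The inverse `R` comes from the dual family `c`
of Dedekind's lemma; one composite is `sum_smul_avg_hom`. -/
theorem extHom_bijective [IsGalois K L] (hd : d.IsCoherent) (X Y : StableObj d) :
    Function.Bijective (extHom X Y) := by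
  classical
  obtain ⟨s, c, hc⟩ := exists_sum_mul_apply_eq_ite K L
  let R : (X.obj ⟶ Y.obj) →+ L ⊗[K] (X ⟶ Y) :=
    AddMonoidHom.mk' (fun f ↦ ∑ b ∈ s, c b ⊗ₜ avg X Y (b • f)) fun f f' ↦ by
      simp [TensorProduct.tmul_add, Finset.sum_add_distrib]
  refine Function.bijective_iff_has_inverse.2 ⟨R, fun t ↦ ?_, fun f ↦ ?_⟩
  · induction t with
    | zero => simp
    | add t t' h h' => rw [map_add, map_add, h, h']
    | tmul a f =>
      -- On an invariant `f` averaging multiplies by a trace in `K`, which crosses the tensor sign;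
      -- expanding the trace again isolates `g = 1` and returns `a`.
      have e : ∀ b ∈ s, c b ⊗ₜ[K] avg X Y (b • a • f.hom) =
          (c b * algebraMap K L (Algebra.trace K L (b * a))) ⊗ₜ f := fun b _ ↦ by
        rw [smul_smul, avg_smul_hom, ← TensorProduct.smul_tmul, Algebra.smul_def, mul_comm]
      change ∑ b ∈ s, c b ⊗ₜ[K] avg X Y (b • a • f.hom) = _
      rw [Finset.sum_congr rfl e, ← TensorProduct.sum_tmul]
      congr 1
      simp only [trace_eq_sum_automorphisms, map_mul, Finset.mul_sum]
      rw [Finset.sum_comm]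
      simp only [← mul_assoc, ← Finset.sum_mul, hc]
      simp
  · change extHom X Y (∑ b ∈ s, c b ⊗ₜ avg X Y (b • f)) = f
    rw [map_sum]
    exact sum_smul_avg_hom hd hc f

end action

/-- Composition with invariant morphisms commutes with averaging. If `r` is a quasi-inverse of `f`
in `C` and `a` has trace 1, then `f ≫ avg (a • r) ≫ f` is the average of `a • (f ≫ r ≫ f) = a • f`,
which is `f`. -/
theorem isRegularMor [FiniteDimensional K L] [IsGalois K L]
    (reg : ∀ {X Y : C} (f : X ⟶ Y), IsRegularMor f) {X Y : StableObj d} (f : X ⟶ Y) :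
    IsRegularMor f := by
  obtain ⟨a, ha⟩ := exists_avg_eq d
  obtain ⟨r, hr⟩ := reg f.hom
  refine ⟨avg Y X (a • r), ?_⟩
  rw [← ha f]
  ext
  conv_rhs => rw [← hr]
  rw [ha f]
  simp only [comp_hom, avg_hom, Preadditive.sum_comp, Preadditive.comp_sum]
  refine Finset.sum_congr rfl fun g _ ↦ ?_
  rw [← Linear.comp_smul, ← Linear.smul_comp, act_comp (Y := Y), act_comp (Y := X), act_hom]

theorem homFinite [FiniteDimensional K L] [HomFinite L C] : HomFinite K (StableObj d) where
  finite X Y := by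
    let _ := Module.compHom (X.obj ⟶ Y.obj) (algebraMap K L)
    have : IsScalarTower K L (X.obj ⟶ Y.obj) := ⟨fun a b f ↦ by
      change (a • b) • f = algebraMap K L a • b • f
      rw [smul_smul, Algebra.smul_def]⟩
    have : Module.Finite L (X.obj ⟶ Y.obj) := HomFinite.finite X.obj Y.obj
    have : Module.Finite K (X.obj ⟶ Y.obj) := .trans L _
    let φ : (X ⟶ Y) →ₗ[K] (X.obj ⟶ Y.obj) :=
      { toFun f := f.hom
        map_add' _ _ := rfl
        map_smul' _ _ := rfl }
    exact Module.Finite.of_injective φ fun f f' h ↦ hom_ext h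

/-- The image of an invariant idempotent in `C` inherits the stable structure by compressing `α g`
between inclusion and projection; invariance of the idempotent makes the compression invertible and
multiplicative. -/
theorem isIdempotentComplete [IsIdempotentComplete C] : IsIdempotentComplete (StableObj d) where
  idempotents_split X p hp := by
    obtain ⟨Y, i, e, hie, hei⟩ := IsIdempotentComplete.idempotents_split X.obj p.hom
      (congrArg Hom.hom hp)
    have hm : ∀ g, (d.Φ g).map e ≫ (d.Φ g).map i ≫ (X.α g).hom = (X.α g).hom ≫ e ≫ i :=
      fun g ↦ by rw [← Functor.map_comp_assoc, hei, Hom.comm']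
    have h1 : ∀ g, (d.Φ g).map i ≫ (X.α g).hom ≫ e ≫ i = (d.Φ g).map i ≫ (X.α g).hom := fun g ↦ by
      rw [← hm g, ← Functor.map_comp_assoc, hie, CategoryTheory.Functor.map_id, Category.id_comp]
    have h2 : ∀ g, e ≫ i ≫ (X.α g).inv ≫ (d.Φ g).map e = (X.α g).inv ≫ (d.Φ g).map e := fun g ↦ by
      have : e ≫ i ≫ (X.α g).inv = (X.α g).inv ≫ (d.Φ g).map e ≫ (d.Φ g).map i := by
        rw [Iso.eq_inv_comp, ← reassoc_of% hm g]; simp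
      rw [reassoc_of% this, ← Functor.map_comp, hie, CategoryTheory.Functor.map_id, Category.comp_id]
    refine ⟨⟨Y, fun g ↦ ⟨(d.Φ g).map i ≫ (X.α g).hom ≫ e, i ≫ (X.α g).inv ≫ (d.Φ g).map e, ?_, ?_⟩,
      fun g h ↦ ?_⟩, ⟨i, fun g ↦ ?_⟩, ⟨e, fun g ↦ ?_⟩, hom_ext hie, hom_ext hei⟩
    · simp only [Category.assoc, h2, Iso.hom_inv_id_assoc]
      rw [← Functor.map_comp, hie, CategoryTheory.Functor.map_id]
    · simp only [Category.assoc]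
      rw [reassoc_of% hm, Iso.inv_hom_id_assoc, reassoc_of% hie, hie]
    · simp only [Functor.map_comp, Category.assoc]
      rw [reassoc_of% hm, hie, Category.comp_id, ← reassoc_of% X.α_mul]
      exact ((d.J g h).hom.naturality_assoc i _).symm
    · simp only [Category.assoc]
      rw [hm, Iso.inv_hom_id_assoc, reassoc_of% hie]
    · rw [reassoc_of% hm, Iso.inv_hom_id_assoc]
      exact (congrArg (e ≫ ·) hie).trans (Category.comp_id e)

theorem hasFiniteBiproducts [HasFiniteBiproducts C] : HasFiniteBiproducts (StableObj d) where
  out n := ⟨fun X ↦ by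
    let A i := (X i).obj
    have key : ∀ g i, (d.Φ g).map (biproduct.ι A i) ≫
        (mapBiproductIso (d.Φ g) (.refl _) (fun i ↦ (X i).α g)).hom =
          ((X i).α g).hom ≫ biproduct.ι A i := fun g i ↦ map_ι_mapBiproductIso_hom _ _ _ i
    let B : StableObj d :=
      { obj := ⨁ A
        α g := mapBiproductIso (d.Φ g) (.refl _) (fun i ↦ (X i).α g)
        α_mul g h := map_biproduct_hom_ext (d.Φ h ⋙ d.Φ g) fun i ↦ by
          rw [(d.J g h).hom.naturality_assoc (biproduct.ι A i), key]
          simp only [Functor.comp_map, Functor.comp_obj]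
          rw [← Functor.map_comp_assoc, key, Functor.map_comp_assoc, key, ← reassoc_of% (X i).α_mul] }
    let b : Bicone X :=
      { pt := B
        ι i := ⟨biproduct.ι A i, fun g ↦ by rw [key, Iso.inv_hom_id_assoc]⟩
        π i := ⟨biproduct.π A i, fun g ↦ by
          rw [Iso.inv_comp_eq]
          refine map_biproduct_hom_ext (d.Φ g) fun j ↦ ?_
          rw [← Functor.map_comp_assoc, reassoc_of% key]
          by_cases h : j = i
          · subst h
            rw [biproduct.ι_π_self, CategoryTheory.Functor.map_id]
            simp [A]
          · simp [biproduct.ι_π_ne _ h]⟩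
        ι_π i j := by
          ext
          split_ifs with h
          · subst h
            exact biproduct.ι_π_self _ _
          · simp [biproduct.ι_π_ne _ h] }
    have sum_hom : ∀ (s : Finset (Fin n)) (f : Fin n → (B ⟶ B)),
        (∑ i ∈ s, f i).hom = ∑ i ∈ s, (f i).hom := fun s f ↦
      map_sum (AddMonoidHom.mk' (fun t : B ⟶ B ↦ t.hom) fun _ _ ↦ rfl) f s
    refine HasBiproduct.mk ⟨b, isBilimitOfTotal b (hom_ext ?_)⟩
    rw [sum_hom]
    exact biproduct.total⟩

theorem isSemisimpleAbelian [FiniteDimensional K L] [IsGalois K L] [IsSemisimpleAbelian C]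
    [HomFinite L C] : IsSemisimpleAbelian (StableObj d) :=
  have := IsSemisimpleAbelian.isIdempotentComplete (C := C)
  have := IsSemisimpleAbelian.hasFiniteBiproducts (C := C)
  have := isIdempotentComplete (d := d)
  have := hasFiniteBiproducts (d := d)
  have := homFinite (d := d)
  isSemisimpleAbelian_of_regular K
    (isRegularMor (d := d) fun f ↦ IsSemisimpleAbelian.isRegularMor f)

/-- The stable object induced by an object of `C`. -/
noncomputable def ind [FiniteDimensional K L] [HasFiniteBiproducts C] (hd : d.IsCoherent) (X : C) :
    StableObj d where
  obj := ⨁ fun g ↦ (d.Φ g).obj X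
  α g := mapBiproductIso (d.Φ g) (A := fun g ↦ (d.Φ g).obj X) (B := fun g ↦ (d.Φ g).obj X)
    (Equiv.mulLeft g) (fun h ↦ (d.J g h).app X)
  α_mul g h := map_biproduct_hom_ext (d.Φ h ⋙ d.Φ g) fun k ↦ by
    let A g := (d.Φ g).obj X
    -- On each summand the structure map is a `J`, so the condition on a stable object becomes
    -- associativity of `J` for `(g, h, k)`.
    have key : ∀ g {h k} (e : g * h = k), (d.Φ g).map (biproduct.ι A h) ≫
        (mapBiproductIso (d.Φ g) (A := A) (B := A) (Equiv.mulLeft g)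
          (fun h ↦ (d.J g h).app X)).hom = (d.isoOfEq e).hom.app X ≫ biproduct.ι A k :=
      fun g {h k} e ↦ by
        subst e
        simpa [GaloisData.isoOfEq] using map_ι_mapBiproductIso_hom (d.Φ g) (A := A) (B := A)
          (Equiv.mulLeft g) (fun h ↦ (d.J g h).app X) h
    rw [(d.J g h).hom.naturality_assoc (biproduct.ι A k), key (g * h) rfl]
    simp only [Functor.comp_map, Functor.comp_obj]
    rw [← Functor.map_comp_assoc, key h rfl, Functor.map_comp_assoc,
      key g (mul_assoc g h k).symm]
    have a := hd.assoc (rfl : g * h = _) rfl rfl (mul_assoc g h k).symm X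
    simp only [← Category.assoc]
    congr 1
    simpa [GaloisData.isoOfEq] using a

/-- `X` is, up to the isomorphism of `Φ 1` with the identity, the summand at `1` of the induced
object. This is what makes the extended forgetful functor essentially surjective. -/
theorem exists_retract [FiniteDimensional K L] [HasFiniteBiproducts C] (hd : d.IsCoherent) (X : C) :
    ∃ (Y : StableObj d) (i : X ⟶ Y.obj) (p : Y.obj ⟶ X), i ≫ p = 𝟙 X := by
  obtain ⟨e⟩ := hd.unit
  refine ⟨ind hd X, e.inv.app X ≫ biproduct.ι (fun g ↦ (d.Φ g).obj X) 1,
    biproduct.π (fun g ↦ (d.Φ g).obj X) 1 ≫ e.hom.app X, ?_⟩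
  erw [Category.assoc, biproduct.ι_π_self_assoc, e.inv_hom_id_app]
  rfl

end StableObj

end Stable

/-! ### Extension of functors to the Karoubian envelope -/

namespace KaroubiExtension

open Idempotents

variable {E : Type*} [Category* E] {C : Type*} [Category* C] [IsIdempotentComplete C] (F : E ⥤ C)

theorem exists_splitting (P : Karoubi E) : ∃ (Y : C) (i : Y ⟶ F.obj P.X) (e : F.obj P.X ⟶ Y),
    i ≫ e = 𝟙 Y ∧ e ≫ i = F.map P.p :=
  IsIdempotentComplete.idempotents_split _ _ (by rw [← F.map_comp, P.idem])

/-- The extension of a functor to the Karoubian envelope. -/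
noncomputable def functor : Karoubi E ⥤ C where
  obj P := (exists_splitting F P).choose
  map {P Q} f := (exists_splitting F P).choose_spec.choose ≫ F.map f.f ≫
    (exists_splitting F Q).choose_spec.choose_spec.choose
  map_id P := by
    have h := (exists_splitting F P).choose_spec.choose_spec.choose_spec
    refine (congrArg (fun t ↦ (exists_splitting F P).choose_spec.choose ≫ t ≫
      (exists_splitting F P).choose_spec.choose_spec.choose) h.2.symm).trans ?_
    rw [Category.assoc, h.1, Category.comp_id, h.1]
  map_comp {P Q R} f g := by
    have h := (exists_splitting F Q).choose_spec.choose_spec.choose_spec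
    simp only [Category.assoc, reassoc_of% h.2, ← F.map_comp_assoc, Karoubi.comp_f, Karoubi.p_comp]

/-- The inclusion of the image of `F(p)`. -/
noncomputable def ι (P : Karoubi E) : (functor F).obj P ⟶ F.obj P.X :=
  (exists_splitting F P).choose_spec.choose

/-- The projection to the image of `F(p)`. -/
noncomputable def π (P : Karoubi E) : F.obj P.X ⟶ (functor F).obj P :=
  (exists_splitting F P).choose_spec.choose_spec.choose

theorem map_eq {P Q : Karoubi E} (f : P ⟶ Q) :
    (functor F).map f = ι F P ≫ F.map f.f ≫ π F Q := rfl

@[simp]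
theorem ι_π (P : Karoubi E) : ι F P ≫ π F P = 𝟙 _ :=
  (exists_splitting F P).choose_spec.choose_spec.choose_spec.1

@[simp]
theorem ι_π_assoc (P : Karoubi E) {Z : C} (f : (functor F).obj P ⟶ Z) :
    ι F P ≫ π F P ≫ f = f := by
  rw [← Category.assoc, ι_π, Category.id_comp]

theorem π_ι (P : Karoubi E) : π F P ≫ ι F P = F.map P.p :=
  (exists_splitting F P).choose_spec.choose_spec.choose_spec.2

theorem π_ι_assoc (P : Karoubi E) {Z : C} (f : F.obj P.X ⟶ Z) :
    π F P ≫ ι F P ≫ f = F.map P.p ≫ f := by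
  rw [← Category.assoc, π_ι]

@[simp]
theorem ι_map_p (P : Karoubi E) : ι F P ≫ F.map P.p = ι F P := by
  rw [← π_ι, ι_π_assoc]

@[simp]
theorem ι_map_p_assoc (P : Karoubi E) {Z : C} (f : F.obj P.X ⟶ Z) :
    ι F P ≫ F.map P.p ≫ f = ι F P ≫ f := by
  rw [← Category.assoc, ι_map_p]

instance (P : Karoubi E) : Mono (ι F P) := mono_of_mono_fac (ι_π F P)

@[simp]
theorem map_ι {P Q : Karoubi E} (f : P ⟶ Q) :
    (functor F).map f ≫ ι F Q = ι F P ≫ F.map f.f := by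
  simp only [map_eq, Category.assoc, π_ι, ← F.map_comp, Karoubi.comp_p]

/-- The extension extends. -/
noncomputable def iso : toKaroubi E ⋙ functor F ≅ F :=
  NatIso.ofComponents (fun X ↦ ⟨ι F ((toKaroubi E).obj X), π F ((toKaroubi E).obj X), ι_π _ _,
    by rw [π_ι]; simp⟩) fun f ↦ by simp

theorem iso_hom_app (X : E) : (iso F).hom.app X = ι F ((toKaroubi E).obj X) := rfl

instance [F.Faithful] : (functor F).Faithful where
  map_injective {P Q} f g h := by
    have h' := congrArg (fun t ↦ π F P ≫ t ≫ ι F Q) h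
    simp only [map_ι, π_ι_assoc, ← F.map_comp, Karoubi.p_comp] at h'
    exact Karoubi.hom_ext _ _ (F.map_injective h')

instance [F.Full] [F.Faithful] : (functor F).Full where
  map_surjective {P Q} h := by
    obtain ⟨f, hf⟩ := F.map_surjective (π F P ≫ h ≫ ι F Q)
    refine ⟨⟨f, F.map_injective ?_⟩, ?_⟩
    · simp only [F.map_comp, hf, Category.assoc, ι_map_p]
      rw [← π_ι F P, Category.assoc, ι_π_assoc]
    · rw [← cancel_mono (ι F Q), map_ι, hf, ι_π_assoc]

/-- The idempotent on `F.obj Y` that cuts out `X` lifts to an idempotent of `E`, whose image in the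
envelope is sent to `X`. -/
theorem essSurj [F.Full] [F.Faithful]
    (h : ∀ X : C, ∃ (Y : E) (i : X ⟶ F.obj Y) (p : F.obj Y ⟶ X), i ≫ p = 𝟙 X) :
    (functor F).EssSurj where
  mem_essImage X := by
    obtain ⟨Y, i, p, hip⟩ := h X
    obtain ⟨q, hq⟩ := F.map_surjective (p ≫ i)
    let P : Karoubi E := ⟨Y, q, F.map_injective (by
      rw [F.map_comp, hq, Category.assoc, reassoc_of% hip])⟩
    have e : π F P ≫ ι F P = p ≫ i := (π_ι F P).trans hq
    refine ⟨P, ⟨⟨ι F P ≫ p, i ≫ π F P, ?_, ?_⟩⟩⟩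
    · rw [Category.assoc, ← reassoc_of% e, ι_π, Category.comp_id, ι_π]
    · rw [Category.assoc, reassoc_of% e, hip, Category.comp_id, hip]

section Preadditive

variable [Preadditive E] [Preadditive C] [F.Additive]

instance : (functor F).Additive where
  map_add {P Q f g} := by simp [map_eq]

instance (k : Type*) [Semiring k] [Linear k E] [Linear k C] [F.Linear k] :
    (functor F).Linear k where
  map_smul {P Q} f a := by
    have : (a • f).f = a • f.f := rfl
    simp [map_eq, this]

end Preadditive

section Monoidal

open Functor.LaxMonoidal Functor.OplaxMonoidal Functor.Monoidal

variable [MonoidalCategory E] [MonoidalCategory C] [F.Monoidal]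

theorem tensor_ι_comp_μ_map {P Q : Karoubi E} :
    (ι F P ⊗ₘ ι F Q) ≫ μ F P.X Q.X ≫ F.map (P.p ⊗ₘ Q.p) = (ι F P ⊗ₘ ι F Q) ≫ μ F P.X Q.X := by
  rw [← μ_natural, tensorHom_comp_tensorHom_assoc, ι_map_p, ι_map_p]

/-- The tensor structure of the extension. -/
noncomputable def μIso (P Q : Karoubi E) : (functor F).obj P ⊗ (functor F).obj Q ≅ (functor F).obj (P ⊗ Q) where
  hom := (ι F P ⊗ₘ ι F Q) ≫ μ F P.X Q.X ≫ π F (P ⊗ Q)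
  inv := ι F (P ⊗ Q) ≫ δ F P.X Q.X ≫ (π F P ⊗ₘ π F Q)
  hom_inv_id := by
    have h := π_ι F (P ⊗ Q)
    rw [Category.assoc, Category.assoc, reassoc_of% h]
    erw [reassoc_of% tensor_ι_comp_μ_map F (P := P) (Q := Q)]
    simp
  inv_hom_id := by
    have h : (π F P ⊗ₘ π F Q) ≫ (ι F P ⊗ₘ ι F Q) ≫ μ F P.X Q.X = μ F P.X Q.X ≫
        F.map (P ⊗ Q).p := by
      rw [tensorHom_comp_tensorHom_assoc, π_ι, π_ι, μ_natural]
      rfl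
    rw [Category.assoc, Category.assoc, reassoc_of% h, δ_μ_assoc, ι_map_p_assoc, ι_π]

@[simp]
theorem μIso_hom_ι (P Q : Karoubi E) :
    (μIso F P Q).hom ≫ ι F (P ⊗ Q) = (ι F P ⊗ₘ ι F Q) ≫ μ F P.X Q.X := by
  simp only [μIso, Category.assoc, π_ι]
  exact tensor_ι_comp_μ_map F

theorem μIso_hom_ι_assoc (P Q : Karoubi E) {Z : C} (f : F.obj (P ⊗ Q).X ⟶ Z) :
    (μIso F P Q).hom ≫ ι F (P ⊗ Q) ≫ f = (ι F P ⊗ₘ ι F Q) ≫ μ F P.X Q.X ≫ f := by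
  rw [← Category.assoc, μIso_hom_ι, Category.assoc]

/-- The unit structure of the extension. -/
noncomputable def εIso : 𝟙_ C ≅ (functor F).obj (𝟙_ (Karoubi E)) where
  hom := ε F ≫ π F (𝟙_ (Karoubi E))
  inv := ι F (𝟙_ (Karoubi E)) ≫ η F
  hom_inv_id := by
    rw [Category.assoc, π_ι_assoc]
    erw [F.map_id]
    simp
  inv_hom_id := by simp

@[simp]
theorem εIso_hom_ι : (εIso F).hom ≫ ι F (𝟙_ (Karoubi E)) = ε F := by
  simp only [εIso, Category.assoc, π_ι]
  erw [F.map_id, Category.comp_id]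

/-- Each axiom is tested after composing with the monomorphism `ι`. There the structure maps become
those of `F` preceded by tensor products of the `ι`, and the idempotents are absorbed because `ι F P
≫ F.map P.p = ι F P`. -/
noncomputable instance monoidal : (functor F).Monoidal :=
  Functor.CoreMonoidal.toMonoidal
    { εIso := εIso F
      μIso := μIso F
      μIso_hom_natural_left {P Q} f R := by
        rw [← cancel_mono (ι F _)]
        have h : (f ▷ R).f = f.f ⊗ₘ R.p := rfl
        rw [Category.assoc, Category.assoc, μIso_hom_ι, map_ι, μIso_hom_ι_assoc, h, ← μ_natural,
          ← tensorHom_id, tensorHom_comp_tensorHom_assoc, tensorHom_comp_tensorHom_assoc, map_ι,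
          Category.id_comp, ι_map_p]
      μIso_hom_natural_right {P Q} R f := by
        rw [← cancel_mono (ι F _)]
        have h : (R ◁ f).f = R.p ⊗ₘ f.f := rfl
        rw [Category.assoc, Category.assoc, μIso_hom_ι, map_ι, μIso_hom_ι_assoc, h, ← μ_natural,
          ← id_tensorHom, tensorHom_comp_tensorHom_assoc, tensorHom_comp_tensorHom_assoc, map_ι,
          Category.id_comp, ι_map_p]
      associativity P Q R := by
        rw [← cancel_mono (ι F _)]
        have h : (α_ P Q R).hom.f = ((P.p ⊗ₘ Q.p) ⊗ₘ R.p) ≫ (α_ P.X Q.X R.X).hom := rfl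
        simp only [Category.assoc]
        rw [map_ι, μIso_hom_ι_assoc, μIso_hom_ι, h, F.map_comp]
        have e₁ : (μIso F P Q).hom ▷ (functor F).obj R ≫ (ι F (P ⊗ Q) ⊗ₘ ι F R) =
            ((ι F P ⊗ₘ ι F Q) ⊗ₘ ι F R) ≫ μ F P.X Q.X ▷ F.obj R.X := by
          rw [← tensorHom_id, ← tensorHom_id, tensorHom_comp_tensorHom, tensorHom_comp_tensorHom,
            μIso_hom_ι, Category.id_comp, Category.comp_id]
        have e₂ : (functor F).obj P ◁ (μIso F Q R).hom ≫ (ι F P ⊗ₘ ι F (Q ⊗ R)) =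
            (ι F P ⊗ₘ (ι F Q ⊗ₘ ι F R)) ≫ F.obj P.X ◁ μ F Q.X R.X := by
          rw [← id_tensorHom, ← id_tensorHom, tensorHom_comp_tensorHom, tensorHom_comp_tensorHom,
            μIso_hom_ι, Category.id_comp, Category.comp_id]
        have e₃ : μ F P.X Q.X ▷ F.obj R.X ≫ μ F (P.X ⊗ Q.X) R.X ≫
            F.map ((P.p ⊗ₘ Q.p) ⊗ₘ R.p) = ((F.map P.p ⊗ₘ F.map Q.p) ⊗ₘ F.map R.p) ≫
              μ F P.X Q.X ▷ F.obj R.X ≫ μ F (P.X ⊗ Q.X) R.X := by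
          rw [← μ_natural, ← tensorHom_id, tensorHom_comp_tensorHom_assoc,
            tensorHom_comp_tensorHom_assoc, Category.id_comp, Category.comp_id, μ_natural]
        rw [reassoc_of% e₁, reassoc_of% e₂]
        change _ ≫ _ ≫ μ F (P.X ⊗ Q.X) R.X ≫ _ = _
        rw [reassoc_of% e₃, tensorHom_comp_tensorHom_assoc, tensorHom_comp_tensorHom, ι_map_p, ι_map_p, ι_map_p,
          Functor.LaxMonoidal.associativity, associator_naturality_assoc]
        rfl
      left_unitality P := by
        rw [← cancel_mono (ι F _)]
        have h : (λ_ P).hom.f = (𝟙_ E ◁ P.p) ≫ (λ_ P.X).hom := rfl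
        have e : (εIso F).hom ▷ (functor F).obj P ≫ (ι F (𝟙_ (Karoubi E)) ⊗ₘ ι F P) =
            (𝟙_ C ◁ ι F P) ≫ ε F ▷ F.obj P.X := by
          rw [← tensorHom_id, tensorHom_comp_tensorHom, εIso_hom_ι, Category.id_comp,
            whisker_exchange, ← MonoidalCategory.tensorHom_def]
        simp only [Category.assoc]
        rw [map_ι, μIso_hom_ι_assoc, reassoc_of% e, h, F.map_comp, ← leftUnitor_naturality]
        have e' : ε F ▷ F.obj P.X ≫ μ F (𝟙_ E) P.X ≫ F.map (𝟙_ E ◁ P.p) =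
            (𝟙_ C ◁ F.map P.p) ≫ ε F ▷ F.obj P.X ≫ μ F (𝟙_ E) P.X := by
          rw [← μ_natural_right, whisker_exchange_assoc]
        change _ = _ ≫ _ ≫ μ F (𝟙_ E) P.X ≫ _
        rw [reassoc_of% e', ← whiskerLeft_comp_assoc, ι_map_p, Functor.LaxMonoidal.left_unitality]
      right_unitality P := by
        rw [← cancel_mono (ι F _)]
        have h : (ρ_ P).hom.f = (P.p ▷ 𝟙_ E) ≫ (ρ_ P.X).hom := rfl
        have e : (functor F).obj P ◁ (εIso F).hom ≫ (ι F P ⊗ₘ ι F (𝟙_ (Karoubi E))) =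
            (ι F P ▷ 𝟙_ C) ≫ F.obj P.X ◁ ε F := by
          rw [← id_tensorHom, tensorHom_comp_tensorHom, εIso_hom_ι, Category.id_comp,
            ← whisker_exchange, ← MonoidalCategory.tensorHom_def']
        simp only [Category.assoc]
        rw [map_ι, μIso_hom_ι_assoc, reassoc_of% e, h, F.map_comp, ← rightUnitor_naturality]
        have e' : F.obj P.X ◁ ε F ≫ μ F P.X (𝟙_ E) ≫ F.map (P.p ▷ 𝟙_ E) =
            (F.map P.p ▷ 𝟙_ C) ≫ F.obj P.X ◁ ε F ≫ μ F P.X (𝟙_ E) := by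
          rw [← μ_natural_left, whisker_exchange_assoc]
        change _ = _ ≫ _ ≫ μ F P.X (𝟙_ E) ≫ _
        rw [reassoc_of% e', ← comp_whiskerRight_assoc, ι_map_p, Functor.LaxMonoidal.right_unitality] }

theorem μ_ι (P Q : Karoubi E) :
    μ (functor F) P Q ≫ ι F (P ⊗ Q) = (ι F P ⊗ₘ ι F Q) ≫ μ F P.X Q.X := μIso_hom_ι F P Q

theorem ε_ι : ε (functor F) ≫ ι F (𝟙_ (Karoubi E)) = ε F := εIso_hom_ι F

theorem isBraided [BraidedCategory E] [BraidedCategory C] (h : IsBraidedFunctor F) :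
    IsBraidedFunctor (functor F) := fun P Q ↦ by
  rw [← cancel_mono (ι F _)]
  have e : (β_ P Q).hom.f = (P.p ⊗ₘ Q.p) ≫ (β_ P.X Q.X).hom := rfl
  have e' := μ_ι F P Q
  rw [Category.assoc, Category.assoc, map_ι, μ_ι, reassoc_of% e', e, F.map_comp,
    reassoc_of% tensor_ι_comp_μ_map F (P := P) (Q := Q), h, BraidedCategory.braiding_naturality_assoc]

instance : NatTrans.IsMonoidal (iso F).hom where
  unit := by
    rw [Functor.LaxMonoidal.comp_ε, Category.assoc, iso_hom_app]
    have e : ε (toKaroubi E) = 𝟙 _ := rfl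
    erw [e, CategoryTheory.Functor.map_id, Category.id_comp]
    exact ε_ι F
  tensor X Y := by
    rw [Functor.LaxMonoidal.comp_μ, Category.assoc, iso_hom_app]
    have e : (μ (toKaroubi E) X Y).f = 𝟙 (X ⊗ Y) := rfl
    rw [map_ι, e]
    erw [F.map_id]
    rw [Category.comp_id]
    exact μ_ι F _ _

end Monoidal

end KaroubiExtension

/-! ### The stable objects form a form -/

section Form

variable {K L : Type w} [Field K] [Field L] [Algebra K L]
  {C : Type u} [Category.{v} C] [Preadditive C] [Linear L C]

namespace StableObj

section

variable (d : GaloisData K L C)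

theorem extHom_comp {X Y Z : ExtScalars K L (StableObj d)} (f : X ⟶ Y) (f' : Y ⟶ Z) :
    extHom X.of Z.of (f ≫ f') = extHom X.of Y.of f ≫ extHom Y.of Z.of f' := by
  induction f using ExtScalars.induction with
  | zero => rw [zero_comp]; erw [map_zero, map_zero]; rw [zero_comp]
  | add f g hf hg =>
    rw [Preadditive.add_comp]; erw [map_add, map_add]; rw [Preadditive.add_comp, hf, hg]
  | tmul a f =>
    induction f' using ExtScalars.induction with
    | zero => rw [comp_zero]; erw [map_zero, map_zero]; rw [comp_zero]
    | add f' g hf hg =>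
      rw [Preadditive.comp_add]; erw [map_add, map_add]; rw [Preadditive.comp_add, hf, hg]
    | tmul b f' =>
      rw [ExtScalars.tmul_comp]
      change (a * b) • (f.hom ≫ f'.hom) = (a • f.hom) ≫ (b • f'.hom)
      rw [Linear.smul_comp, Linear.comp_smul, smul_smul]

/-- The extension of the forgetful functor to `L`-linear combinations of morphisms. -/
noncomputable def extForget : ExtScalars K L (StableObj d) ⥤ C where
  obj X := X.of.obj
  map {X Y} f := extHom X.of Y.of f
  map_id X := one_smul L (𝟙 X.of.obj)
  map_comp f f' := extHom_comp d f f'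

theorem extForget_map_tmul {X Y : ExtScalars K L (StableObj d)} (a : L) (f : X.of ⟶ Y.of) :
    (extForget d).map (ExtScalars.tmul a f : X ⟶ Y) = a • f.hom := rfl

instance : (extForget d).Additive where
  map_add {X Y f g} := map_add (extHom X.of Y.of) f g

instance : (extForget d).Linear L where
  map_smul {X Y} f a := by
    induction f using ExtScalars.induction with
    | zero =>
      rw [smul_zero, Functor.map_zero]
      exact (smul_zero a).symm
    | add f g hf hg => rw [smul_add, Functor.map_add, hf, hg, Functor.map_add, smul_add]
    | tmul b f => rw [ExtScalars.smul_tmul', extForget_map_tmul, extForget_map_tmul, mul_smul]; rfl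

/-- `extForget` extends the forgetful functor. -/
noncomputable def inclExtForget : ExtScalars.incl K L (StableObj d) ⋙ extForget d ≅ forget d :=
  NatIso.ofComponents (fun X ↦ Iso.refl X.obj) fun {X Y} f ↦ by
    change ((1 : L) • f.hom) ≫ 𝟙 Y.obj = 𝟙 X.obj ≫ f.hom
    simp

variable {d}
variable [FiniteDimensional K L] [IsGalois K L]

theorem extForget_faithful (hd : d.IsCoherent) : (extForget d).Faithful where
  map_injective {X Y} _ _ h := (extHom_bijective hd X.of Y.of).1 h

theorem extForget_full (hd : d.IsCoherent) : (extForget d).Full where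
  map_surjective {X Y} f := (extHom_bijective hd X.of Y.of).2 f

variable [IsSemisimpleAbelian C]

/-- The stable objects are a form. -/
noncomputable def formEquivalence (hd : d.IsCoherent) :
    FormEquivalence K L (StableObj d) C :=
  have := IsSemisimpleAbelian.isIdempotentComplete (C := C)
  have := IsSemisimpleAbelian.hasFiniteBiproducts (C := C)
  have := extForget_faithful hd
  have := extForget_full hd
  -- Full faithfulness is descent of morphisms; retracts of induced objects give essential
  -- surjectivity.
  have : (KaroubiExtension.functor (extForget d)).EssSurj := KaroubiExtension.essSurj _ fun X ↦ by
    obtain ⟨Y, i, p, h⟩ := exists_retract hd X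
    exact ⟨⟨Y⟩, i, p, h⟩
  { functor := KaroubiExtension.functor (extForget d)
    isEquivalence := { } }

/-- The equivalence extends the forgetful functor. -/
noncomputable def formEquivalenceIso (hd : d.IsCoherent) :
    toScalarExtension K L (StableObj d) ⋙ (formEquivalence hd).functor ≅ forget d :=
  have := IsSemisimpleAbelian.isIdempotentComplete (C := C)
  Functor.associator _ _ _ ≪≫
    Functor.isoWhiskerLeft (ExtScalars.incl K L (StableObj d)) (KaroubiExtension.iso (extForget d)) ≪≫
    inclExtForget d

end

section Tensor

open Functor.LaxMonoidal Functor.OplaxMonoidal Functor.Monoidal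

variable [MonoidalCategory C] [MonoidalPreadditive C] [MonoidalLinear L C]
  (d : TensorGaloisData K L C)

theorem extForget_whiskerLeft (X : ExtScalars K L (StableObj d.toGaloisData))
    {Y Z : ExtScalars K L (StableObj d.toGaloisData)} (f : Y ⟶ Z) :
    (extForget d.toGaloisData).map (X ◁ f) = X.of.obj ◁ (extForget d.toGaloisData).map f := by
  induction f using ExtScalars.induction with
  | zero => rw [ExtScalars.whiskerLeft_zero', Functor.map_zero, Functor.map_zero,
      MonoidalPreadditive.whiskerLeft_zero]; rfl
  | add f g hf hg => rw [ExtScalars.whiskerLeft_add', Functor.map_add, Functor.map_add, hf, hg,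
      MonoidalPreadditive.whiskerLeft_add]; rfl
  | tmul a f =>
    rw [ExtScalars.whiskerLeft_tmul, extForget_map_tmul, extForget_map_tmul, hom_whiskerLeft]
    exact (MonoidalLinear.whiskerLeft_smul _ _ _).symm

theorem extForget_whiskerRight {Y Z : ExtScalars K L (StableObj d.toGaloisData)} (f : Y ⟶ Z)
    (X : ExtScalars K L (StableObj d.toGaloisData)) :
    (extForget d.toGaloisData).map (f ▷ X) = (extForget d.toGaloisData).map f ▷ X.of.obj := by
  induction f using ExtScalars.induction with
  | zero => rw [ExtScalars.zero_whiskerRight', Functor.map_zero, Functor.map_zero,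
      MonoidalPreadditive.zero_whiskerRight]; rfl
  | add f g hf hg => rw [ExtScalars.add_whiskerRight', Functor.map_add, Functor.map_add, hf, hg,
      MonoidalPreadditive.add_whiskerRight]; rfl
  | tmul a f =>
    rw [ExtScalars.tmul_whiskerRight, extForget_map_tmul, extForget_map_tmul, hom_whiskerRight]
    exact (MonoidalLinear.smul_whiskerRight _ _ _).symm

/-- Tensor products of stable objects are formed on underlying objects, so the structure maps are
identities; only the scalar `1` has to be removed. -/
noncomputable instance : (extForget d.toGaloisData).Monoidal :=
  Functor.CoreMonoidal.toMonoidal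
    { εIso := Iso.refl (𝟙_ C)
      μIso := fun X Y ↦ Iso.refl (X.of.obj ⊗ Y.of.obj)
      μIso_hom_natural_left {X Y} f Z := by
        rw [extForget_whiskerRight]
        exact (Category.comp_id _).trans (Category.id_comp _).symm
      μIso_hom_natural_right {X Y} Z f := by
        rw [extForget_whiskerLeft]
        exact (Category.comp_id _).trans (Category.id_comp _).symm
      associativity X Y Z := by
        change 𝟙 (X.of.obj ⊗ Y.of.obj) ▷ Z.of.obj ≫ 𝟙 ((X.of.obj ⊗ Y.of.obj) ⊗ Z.of.obj) ≫
          ((1 : L) • (α_ X.of.obj Y.of.obj Z.of.obj).hom) =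
          (α_ X.of.obj Y.of.obj Z.of.obj).hom ≫ X.of.obj ◁ 𝟙 (Y.of.obj ⊗ Z.of.obj) ≫
            𝟙 (X.of.obj ⊗ Y.of.obj ⊗ Z.of.obj)
        simp
      left_unitality X := by
        change (λ_ X.of.obj).hom = 𝟙 (𝟙_ C) ▷ X.of.obj ≫ 𝟙 (𝟙_ C ⊗ X.of.obj) ≫
          ((1 : L) • (λ_ X.of.obj).hom)
        simp
      right_unitality X := by
        change (ρ_ X.of.obj).hom = X.of.obj ◁ 𝟙 (𝟙_ C) ≫ 𝟙 (X.of.obj ⊗ 𝟙_ C) ≫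
          ((1 : L) • (ρ_ X.of.obj).hom)
        simp }

instance : NatTrans.IsMonoidal (inclExtForget d.toGaloisData).hom where
  unit := by
    change (𝟙 (𝟙_ C) ≫ ((1 : L) • 𝟙 (𝟙_ C))) ≫ 𝟙 (𝟙_ C) = 𝟙 (𝟙_ C)
    simp
  tensor X Y := by
    change (𝟙 (X.obj ⊗ Y.obj) ≫ ((1 : L) • 𝟙 (X.obj ⊗ Y.obj))) ≫ 𝟙 (X.obj ⊗ Y.obj) =
      (𝟙 X.obj ⊗ₘ 𝟙 Y.obj) ≫ 𝟙 (X.obj ⊗ Y.obj)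
    simp

variable {d}
variable [FiniteDimensional K L] [IsGalois K L] [IsSemisimpleAbelian C]

/-- The stable objects are a form, in the case of tensor categories. -/
noncomputable def tensorFormEquivalence (hd : d.IsCoherent) :
    TensorFormEquivalence K L (StableObj d.toGaloisData) C :=
  have := IsSemisimpleAbelian.isIdempotentComplete (C := C)
  { toFormEquivalence := formEquivalence hd
    monoidal := KaroubiExtension.monoidal (extForget d.toGaloisData) }

/-- The tensor equivalence extends the forgetful functor. -/
noncomputable def tensorFormEquivalenceIso (hd : d.IsCoherent) :
    toScalarExtension K L (StableObj d.toGaloisData) ⋙ (tensorFormEquivalence hd).functor ≅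
      forget d.toGaloisData :=
  formEquivalenceIso hd

theorem isMonoidal_tensorFormEquivalenceIso (hd : d.IsCoherent) :
    NatTrans.IsMonoidal (tensorFormEquivalenceIso hd).hom := by
  have := IsSemisimpleAbelian.isIdempotentComplete (C := C)
  let e := extForget d.toGaloisData
  have h₁ : NatTrans.IsMonoidal (Functor.whiskerLeft (ExtScalars.incl K L
      (StableObj d.toGaloisData)) (KaroubiExtension.iso e).hom) := inferInstance
  have h₂ : NatTrans.IsMonoidal (Functor.associator (ExtScalars.incl K L
      (StableObj d.toGaloisData)) (Idempotents.toKaroubi _) (KaroubiExtension.functor e)).hom :=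
    inferInstance
  exact inferInstanceAs (NatTrans.IsMonoidal ((Functor.associator _ _ _).hom ≫
    Functor.whiskerLeft (ExtScalars.incl K L (StableObj d.toGaloisData))
      (KaroubiExtension.iso e).hom ≫ (inclExtForget d.toGaloisData).hom))

end Tensor

section Braided

open Functor.LaxMonoidal Functor.OplaxMonoidal Functor.Monoidal

variable [MonoidalCategory C] [MonoidalPreadditive C] [MonoidalLinear L C] [BraidedCategory C]
  (d : BraidedGaloisData K L C)

theorem isBraided_extForget : IsBraidedFunctor (extForget d.toGaloisData) := fun X Y ↦ by
  change 𝟙 (X.of.obj ⊗ Y.of.obj) ≫ ((1 : L) • (β_ X.of.obj Y.of.obj).hom) =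
    (β_ X.of.obj Y.of.obj).hom ≫ 𝟙 (Y.of.obj ⊗ X.of.obj)
  simp

variable {d}
variable [FiniteDimensional K L] [IsGalois K L] [IsSemisimpleAbelian C]

theorem isBraided_tensorFormEquivalence (hd : d.IsCoherent) :
    IsBraidedFunctor (tensorFormEquivalence hd).functor :=
  have := IsSemisimpleAbelian.isIdempotentComplete (C := C)
  KaroubiExtension.isBraided _ (isBraided_extForget d)

end Braided

end StableObj
end Form

/-! ### Duals and the unit object of the category of stable objects -/

section Duals

open Functor.LaxMonoidal Functor.OplaxMonoidal Functor.Monoidal ExactPairing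

section

variable {C D : Type*} [Category* C] [MonoidalCategory C] [Category* D] [MonoidalCategory D]

/-- The coevaluation of the image of a pairing. -/
def mapCoevaluation (F : C ⥤ D) [F.Monoidal] {X Y : C} (c : 𝟙_ C ⟶ X ⊗ Y) :
    𝟙_ D ⟶ F.obj X ⊗ F.obj Y := ε F ≫ F.map c ≫ δ F X Y

/-- The evaluation of the image of a pairing. -/
def mapEvaluation (F : C ⥤ D) [F.Monoidal] {X Y : C} (e : Y ⊗ X ⟶ 𝟙_ C) :
    F.obj Y ⊗ F.obj X ⟶ 𝟙_ D := μ F Y X ≫ F.map e ≫ η F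

/-- Monoidal functors preserve exact pairings. -/
@[reducible]
def mapExactPairing (F : C ⥤ D) [F.Monoidal] (X Y : C) [ExactPairing X Y] :
    ExactPairing (F.obj X) (F.obj Y) where
  coevaluation' := mapCoevaluation F (η_ X Y)
  evaluation' := mapEvaluation F (ε_ X Y)
  coevaluation_evaluation' := by
    -- This brings the associator inside `F`, where the zigzag identity of the original pairing
    -- applies.
    have h : F.obj Y ◁ δ F X Y ≫ (α_ _ _ _).inv ≫ μ F Y X ▷ F.obj Y =
        μ F Y (X ⊗ Y) ≫ F.map (α_ Y X Y).inv ≫ δ F (Y ⊗ X) Y := by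
      rw [← cancel_epi (F.obj Y ◁ μ F X Y), whiskerLeft_μ_δ_assoc,
        Functor.LaxMonoidal.associativity_inv_assoc, μ_δ, Category.comp_id]
    have z := congrArg F.map (coevaluation_evaluation X Y)
    simp only [F.map_comp] at z
    simp only [mapCoevaluation, mapEvaluation, MonoidalCategory.whiskerLeft_comp, comp_whiskerRight,
      Category.assoc, reassoc_of% h]
    rw [μ_natural_right_assoc, δ_natural_left_assoc, reassoc_of% z]
    simp
  evaluation_coevaluation' := by
    have h : δ F X Y ▷ F.obj X ≫ (α_ _ _ _).hom ≫ F.obj X ◁ μ F Y X =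
        μ F (X ⊗ Y) X ≫ F.map (α_ X Y X).hom ≫ δ F X (Y ⊗ X) := by
      rw [← cancel_epi (μ F X Y ▷ F.obj X), whiskerRight_μ_δ_assoc,
        Functor.LaxMonoidal.associativity_assoc, μ_δ, Category.comp_id]
    have z := congrArg F.map (evaluation_coevaluation X Y)
    simp only [F.map_comp] at z
    simp only [mapCoevaluation, mapEvaluation, MonoidalCategory.whiskerLeft_comp, comp_whiskerRight,
      Category.assoc, reassoc_of% h]
    rw [μ_natural_left_assoc, δ_natural_right_assoc, reassoc_of% z]
    simp

theorem mapCoevaluation_comp (F : C ⥤ D) [F.Monoidal] {X Y X' Y' : C} (c : 𝟙_ C ⟶ X ⊗ Y)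
    (a : X ⟶ X') (b : Y ⟶ Y') :
    mapCoevaluation F c ≫ (F.map a ⊗ₘ F.map b) = mapCoevaluation F (c ≫ (a ⊗ₘ b)) := by
  simp [mapCoevaluation]

theorem mapCoevaluation_natTrans {F G : C ⥤ D} [F.Monoidal] [G.Monoidal] (τ : F ⟶ G)
    [NatTrans.IsMonoidal τ] {X Y : C} (c : 𝟙_ C ⟶ X ⊗ Y) :
    mapCoevaluation F c ≫ (τ.app X ⊗ₘ τ.app Y) = mapCoevaluation G c := by
  have h : δ F X Y ≫ (τ.app X ⊗ₘ τ.app Y) = τ.app (X ⊗ Y) ≫ δ G X Y := by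
    rw [← cancel_epi (μ F X Y), μ_δ_assoc, NatTrans.IsMonoidal.tensor_assoc, μ_δ,
      Category.comp_id]
  simp only [mapCoevaluation, Category.assoc, h]
  rw [τ.naturality_assoc, NatTrans.IsMonoidal.unit_assoc]

theorem mapCoevaluation_comp_functor {E : Type*} [Category* E] [MonoidalCategory E] (F : C ⥤ D)
    (G : D ⥤ E) [F.Monoidal] [G.Monoidal] {X Y : C} (c : 𝟙_ C ⟶ X ⊗ Y) :
    mapCoevaluation (F ⋙ G) c = mapCoevaluation G (mapCoevaluation F c) := by
  simp [mapCoevaluation]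

/-- Nondegeneracy of the pairing: a morphism out of `Y` is determined by its composite with the
coevaluation, through the tensor-hom adjunction. -/
theorem left_cancel_of_coevaluation {X Y A B : C} [ExactPairing X Y] {a : X ⟶ A} [IsIso a]
    {b b' : Y ⟶ B} (h : η_ X Y ≫ (a ⊗ₘ b) = η_ X Y ≫ (a ⊗ₘ b')) : b = b' := by
  rw [MonoidalCategory.tensorHom_def', MonoidalCategory.tensorHom_def', ← Category.assoc,
    ← Category.assoc, cancel_mono] at h
  have e := congrArg (tensorLeftHomEquiv _ X Y _).symm h
  rwa [tensorLeftHomEquiv_symm_coevaluation_comp_whiskerLeft,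
    tensorLeftHomEquiv_symm_coevaluation_comp_whiskerLeft, cancel_epi] at e

theorem right_cancel_of_coevaluation {X Y A B : C} [ExactPairing X Y] {a a' : X ⟶ A}
    {b : Y ⟶ B} [IsIso b] (h : η_ X Y ≫ (a ⊗ₘ b) = η_ X Y ≫ (a' ⊗ₘ b)) : a = a' := by
  rw [MonoidalCategory.tensorHom_def, MonoidalCategory.tensorHom_def, ← Category.assoc,
    ← Category.assoc, cancel_mono] at h
  have e := congrArg (tensorRightHomEquiv _ X Y _).symm h
  rwa [tensorRightHomEquiv_symm_coevaluation_comp_whiskerRight,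
    tensorRightHomEquiv_symm_coevaluation_comp_whiskerRight, cancel_epi] at e

/-- Isomorphisms `a` and `b` are compatible with exact pairings. -/
structure IsPairingIso {X Y X' Y' : C} (p : ExactPairing X Y) (p' : ExactPairing X' Y')
    (a : X ≅ X') (b : Y ≅ Y') : Prop where
  coevaluation : p.coevaluation' ≫ (a.hom ⊗ₘ b.hom) = p'.coevaluation'
  evaluation : (b.hom ⊗ₘ a.hom) ≫ p'.evaluation' = p.evaluation'

/-- Duals are unique: `b` is the adjoint mate of `a.inv`, the contragredient of `a`. -/
theorem exists_isPairingIso_right {X Y X' Y' : C} (p : ExactPairing X Y) (p' : ExactPairing X' Y')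
    (a : X ≅ X') : ∃ b : Y ≅ Y', IsPairingIso p p' a b := by
  let _ : HasRightDual X := ⟨Y⟩
  let _ : HasRightDual X' := ⟨Y'⟩
  refine ⟨⟨rightAdjointMate a.inv, rightAdjointMate a.hom, ?_, ?_⟩, ⟨?_, ?_⟩⟩
  · exact (comp_rightAdjointMate (f := a.hom) (g := a.inv)).symm.trans (by
      rw [a.hom_inv_id, rightAdjointMate_id]; rfl)
  · exact (comp_rightAdjointMate (f := a.inv) (g := a.hom)).symm.trans (by
      rw [a.inv_hom_id, rightAdjointMate_id]; rfl)
  · have h : p.coevaluation' ≫ X ◁ rightAdjointMate a.inv = p'.coevaluation' ≫ a.inv ▷ Y' :=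
      coevaluation_comp_rightAdjointMate a.inv
    rw [MonoidalCategory.tensorHom_def', reassoc_of% h]
    simp
  · have h : rightAdjointMate a.inv ▷ X' ≫ p'.evaluation' = Y ◁ a.inv ≫ p.evaluation' :=
      rightAdjointMate_comp_evaluation a.inv
    rw [MonoidalCategory.tensorHom_def', Category.assoc, h]
    simp

theorem exists_isPairingIso_left {X Y X' Y' : C} (p : ExactPairing X Y) (p' : ExactPairing X' Y')
    (b : Y ≅ Y') : ∃ a : X ≅ X', IsPairingIso p p' a b := by
  let _ : HasLeftDual Y := ⟨X⟩
  let _ : HasLeftDual Y' := ⟨X'⟩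
  refine ⟨⟨leftAdjointMate b.inv, leftAdjointMate b.hom, ?_, ?_⟩, ⟨?_, ?_⟩⟩
  · exact (comp_leftAdjointMate (f := b.hom) (g := b.inv)).symm.trans (by
      rw [b.hom_inv_id, leftAdjointMate_id]; rfl)
  · exact (comp_leftAdjointMate (f := b.inv) (g := b.hom)).symm.trans (by
      rw [b.inv_hom_id, leftAdjointMate_id]; rfl)
  · have h : p.coevaluation' ≫ leftAdjointMate b.inv ▷ Y = p'.coevaluation' ≫ X' ◁ b.inv :=
      coevaluation_comp_leftAdjointMate b.inv
    rw [MonoidalCategory.tensorHom_def, reassoc_of% h]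
    simp
  · have h : Y' ◁ leftAdjointMate b.inv ≫ p'.evaluation' = b.inv ▷ X ≫ p.evaluation' :=
      leftAdjointMate_comp_evaluation b.inv
    rw [MonoidalCategory.tensorHom_def, Category.assoc, h]
    simp

end

section

variable {K L : Type w} [Field K] [Field L] [Algebra K L]
  {C : Type u} [Category.{v} C] [Preadditive C] [Linear L C] [MonoidalCategory C]
  {d : TensorGaloisData K L C}

namespace StableObj

/-- The two sides of the condition on a stable object, for the objects of an exact pairing. -/
theorem coevaluation_comp {A B : C} (p : ExactPairing A B) (a : ∀ g, (d.Φ g).obj A ≅ A)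
    (b : ∀ g, (d.Φ g).obj B ≅ B)
    (h : ∀ g, IsPairingIso (mapExactPairing (d.Φ g) A B) p (a g) (b g)) (g k : L ≃ₐ[K] L) :
    p.coevaluation' ≫ (((a g).inv ≫ (d.Φ g).map (a k).inv ≫ (d.J g k).hom.app A ≫ (a (g * k)).hom) ⊗ₘ
      ((b g).inv ≫ (d.Φ g).map (b k).inv ≫ (d.J g k).hom.app B ≫ (b (g * k)).hom)) =
      p.coevaluation' := by
  have e₂ : ∀ g, mapCoevaluation (d.Φ g) p.coevaluation' ≫ ((a g).hom ⊗ₘ (b g).hom) =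
      p.coevaluation' := fun g ↦ (h g).coevaluation
  have e₁ : ∀ g, p.coevaluation' ≫ ((a g).inv ⊗ₘ (b g).inv) =
      mapCoevaluation (d.Φ g) p.coevaluation' := fun g ↦ by
    conv_lhs => rw [← e₂ g]
    rw [Category.assoc, tensorHom_comp_tensorHom]
    simp
  have e₃ := mapCoevaluation_natTrans (d.J g k).hom p.coevaluation'
  simp only [← tensorHom_comp_tensorHom, reassoc_of% e₁]
  rw [← Category.assoc, mapCoevaluation_comp, e₁, ← mapCoevaluation_comp_functor, reassoc_of% e₃,
    e₂]

/-- The defects of the stability condition for `a` and `b` together fix the coevaluation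
(`coevaluation_comp`). If the defect of `a` is trivial, nondegeneracy makes that of `b` trivial. -/
theorem isPairing_of_left {A B : C} (p : ExactPairing A B) (a : ∀ g, (d.Φ g).obj A ≅ A)
    (b : ∀ g, (d.Φ g).obj B ≅ B)
    (h : ∀ g, IsPairingIso (mapExactPairing (d.Φ g) A B) p (a g) (b g))
    (ha : ∀ g h, (d.J g h).hom.app A ≫ (a (g * h)).hom = (d.Φ g).map (a h).hom ≫ (a g).hom)
    (g h' : L ≃ₐ[K] L) :
    (d.J g h').hom.app B ≫ (b (g * h')).hom = (d.Φ g).map (b h').hom ≫ (b g).hom := by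
  have e := coevaluation_comp p a b h g h'
  have t : (a g).inv ≫ (d.Φ g).map (a h').inv ≫ (d.J g h').hom.app A ≫ (a (g * h')).hom = 𝟙 A := by
    rw [ha, ← Functor.map_comp_assoc]
    simp
  rw [t] at e
  have e' := left_cancel_of_coevaluation (b' := 𝟙 B)
    (e.trans (by rw [id_tensorHom_id, Category.comp_id]; rfl))
  rw [Iso.inv_comp_eq, Category.comp_id, ← Functor.mapIso_inv, Iso.inv_comp_eq,
    Functor.mapIso_hom] at e'
  exact e'

theorem isPairing_of_right {A B : C} (p : ExactPairing A B) (a : ∀ g, (d.Φ g).obj A ≅ A)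
    (b : ∀ g, (d.Φ g).obj B ≅ B)
    (h : ∀ g, IsPairingIso (mapExactPairing (d.Φ g) A B) p (a g) (b g))
    (hb : ∀ g h, (d.J g h).hom.app B ≫ (b (g * h)).hom = (d.Φ g).map (b h).hom ≫ (b g).hom)
    (g h' : L ≃ₐ[K] L) :
    (d.J g h').hom.app A ≫ (a (g * h')).hom = (d.Φ g).map (a h').hom ≫ (a g).hom := by
  have e := coevaluation_comp p a b h g h'
  have t : (b g).inv ≫ (d.Φ g).map (b h').inv ≫ (d.J g h').hom.app B ≫ (b (g * h')).hom = 𝟙 B := by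
    rw [hb, ← Functor.map_comp_assoc]
    simp
  rw [t] at e
  have e' := right_cancel_of_coevaluation (a' := 𝟙 A)
    (e.trans (by rw [id_tensorHom_id, Category.comp_id]; rfl))
  rw [Iso.inv_comp_eq, Category.comp_id, ← Functor.mapIso_inv, Iso.inv_comp_eq,
    Functor.mapIso_hom] at e'
  exact e'

/-- An exact pairing of stable objects. -/
@[reducible]
def exactPairing (X Y : StableObj d.toGaloisData) (p : ExactPairing X.obj Y.obj)
    (h : ∀ g, IsPairingIso (mapExactPairing (d.Φ g) X.obj Y.obj) p (X.α g) (Y.α g)) :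
    ExactPairing X Y where
  coevaluation' := ⟨p.coevaluation', fun g ↦ by
    have e : mapCoevaluation (d.Φ g) p.coevaluation' ≫ ((X.α g).hom ⊗ₘ (Y.α g).hom) =
      p.coevaluation' := (h g).coevaluation
    change ε (d.Φ g) ≫ (d.Φ g).map p.coevaluation' ≫ δ (d.Φ g) X.obj Y.obj ≫
      ((X.α g).hom ⊗ₘ (Y.α g).hom) = p.coevaluation'
    simpa [mapCoevaluation] using e⟩
  evaluation' := ⟨p.evaluation', fun g ↦ by
    have e : ((Y.α g).hom ⊗ₘ (X.α g).hom) ≫ p.evaluation' =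
      mapEvaluation (d.Φ g) p.evaluation' := (h g).evaluation
    rw [Iso.inv_comp_eq]
    change (d.Φ g).map p.evaluation' ≫ η (d.Φ g) = (δ (d.Φ g) Y.obj X.obj ≫
      ((Y.α g).hom ⊗ₘ (X.α g).hom)) ≫ p.evaluation'
    rw [Category.assoc, e]
    simp [mapEvaluation]⟩
  coevaluation_evaluation' := by
    ext
    have := p.coevaluation_evaluation'
    simp only [comp_hom, hom_whiskerLeft, hom_whiskerRight]
    exact this
  evaluation_coevaluation' := by
    ext
    have := p.evaluation_coevaluation'
    simp only [comp_hom, hom_whiskerLeft, hom_whiskerRight]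
    exact this

/-- As `Φ g` preserves duals, each `X.α g` has a contragredient on the dual of `X.obj`. These make
the dual stable, and evaluation and coevaluation invariant. -/
theorem isRigid (hC : IsRigid C) : IsRigid (StableObj d.toGaloisData) := fun X ↦ by
  obtain ⟨⟨l⟩, ⟨r⟩⟩ := hC X.obj
  constructor
  · choose a ha using fun g ↦ exists_isPairingIso_left
      (mapExactPairing (d.Φ g) l.leftDual X.obj) l.exact (X.α g)
    let Y : StableObj d.toGaloisData := ⟨l.leftDual, a, isPairing_of_right _ a X.α ha X.α_mul⟩
    exact ⟨{ leftDual := Y, exact := exactPairing Y X l.exact ha }⟩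
  · choose b hb using fun g ↦ exists_isPairingIso_right
      (mapExactPairing (d.Φ g) X.obj r.rightDual) r.exact (X.α g)
    let Y : StableObj d.toGaloisData := ⟨r.rightDual, b, isPairing_of_left _ X.α b hb X.α_mul⟩
    exact ⟨{ rightDual := Y, exact := exactPairing X Y r.exact hb }⟩

theorem endUnitIsScalar [FiniteDimensional K L] [IsGalois K L] (hC : EndUnitIsScalar L C) :
    EndUnitIsScalar K (StableObj d.toGaloisData) := by
  constructor
  · intro a b h
    apply (algebraMap K L).injective
    exact hC.1 (congrArg Hom.hom h)
  · intro f
    obtain ⟨a, ha⟩ := hC.2 f.hom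
    have ha : a • 𝟙 (𝟙_ C) = f.hom := ha
    -- An invariant endomorphism of the unit is a scalar fixed by Γ, hence a scalar from `K`.
    have h : ∀ g : L ≃ₐ[K] L, g a = a := fun g ↦ hC.1 (by
      have e : ε (d.Φ g) ≫ (d.Φ g).map f.hom ≫ η (d.Φ g) = f.hom := f.comm g
      rw [← ha, d.map_smul, CategoryTheory.Functor.map_id] at e
      simpa using e)
    obtain ⟨b, hb⟩ := (IsGalois.mem_bot_iff_fixed (F := K) a).2 h
    exact ⟨b, hom_ext ((congrArg (· • 𝟙 (𝟙_ C)) hb).trans ha)⟩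

end StableObj

end

end Duals

/-! ### Coherence of the data of a splitting -/

section Coherence

variable {K L : Type w} [Field K] [Field L] [Algebra K L]
  {C : Type u} [Category.{v} C] [Preadditive C] [Linear L C]

theorem Splitting.isoOfEq_galoisData (s : Splitting (TwistedAut.toGalois K L C))
    {g h k : L ≃ₐ[K] L} (e : g * h = k) :
    s.galoisData.isoOfEq e = ((MulData.ofSplitting s).iso e).hom.iso := by
  subst e
  have : ((MulData.ofSplitting s).iso (rfl : g * h = g * h)).hom =
      Functor.LaxMonoidal.μ s.functor ⟨g⟩ ⟨h⟩ := by
    simp [MulData.ofSplitting]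
  rw [this]
  exact Iso.ext (Category.comp_id _)

/-- Associativity of the monoidal functor is read off componentwise; the associator of twisted
auto-equivalences has identity components. The unit constraint provides the isomorphism of `Φ 1`
with the identity. -/
theorem Splitting.isCoherent_galoisData (s : Splitting (TwistedAut.toGalois K L C)) :
    s.galoisData.IsCoherent where
  assoc {g h k a b c} e₁ e₂ e₃ e₄ X := by
    have a := congrArg (fun f ↦ (TwistedAut.Hom.iso f).hom.app X)
      ((MulData.ofSplitting s).assoc e₁ e₂ e₃ e₄)
    simp only [isoOfEq_galoisData]
    exact a.trans (Category.id_comp _)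
  unit := ⟨(MulData.unitOfSplitting s).iso.inv.iso⟩

theorem Splitting.isCoherent_tensorGaloisData [MonoidalCategory C]
    (s : Splitting (TwistedTensorAut.toGalois K L C)) :
    s.tensorGaloisData.IsCoherent where
  assoc {g h k a b c} e₁ e₂ e₃ e₄ X := by
    have key {g h k : L ≃ₐ[K] L} (e : g * h = k) : s.tensorGaloisData.isoOfEq e =
        ((MulData.ofSplitting s).iso e).hom.hom.iso := by
      subst e
      have : ((MulData.ofSplitting s).iso (rfl : g * h = g * h)).hom =
          Functor.LaxMonoidal.μ s.functor ⟨g⟩ ⟨h⟩ := by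
        simp [MulData.ofSplitting]
      rw [this]
      exact Iso.ext (Category.comp_id _)
    have a := congrArg (fun f ↦ (TwistedTensorAut.Hom.hom f).iso.hom.app X)
      ((MulData.ofSplitting s).assoc e₁ e₂ e₃ e₄)
    simp only [key]
    exact a.trans (Category.id_comp _)
  unit := ⟨(MulData.unitOfSplitting s).iso.inv.hom.iso⟩

theorem Splitting.isCoherent_braidedGaloisData [MonoidalCategory C] [BraidedCategory C]
    (s : Splitting (TwistedBraidedAut.toGalois K L C)) :
    s.braidedGaloisData.IsCoherent where
  assoc {g h k a b c} e₁ e₂ e₃ e₄ X := by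
    have key {g h k : L ≃ₐ[K] L} (e : g * h = k) : s.braidedGaloisData.isoOfEq e =
        ((MulData.ofSplitting s).iso e).hom.hom.hom.iso := by
      subst e
      have : ((MulData.ofSplitting s).iso (rfl : g * h = g * h)).hom =
          Functor.LaxMonoidal.μ s.functor ⟨g⟩ ⟨h⟩ := by
        simp [MulData.ofSplitting]
      rw [this]
      exact Iso.ext (Category.comp_id _)
    have a := congrArg (fun f ↦ (TwistedTensorAut.Hom.hom f.hom).iso.hom.app X)
      ((MulData.ofSplitting s).assoc e₁ e₂ e₃ e₄)
    simp only [key]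
    exact a.trans (Category.id_comp _)
  unit := ⟨(MulData.unitOfSplitting s).iso.inv.hom.hom.iso⟩

end Coherence

/-! ### Transport of a group action along an equivalence -/

section Transport

variable {Γ : Type w} {A C : Type*} [Category* A] [Category* C] (e : A ≌ C)
  (T : Γ → A ⥤ A)

/-- Transport of an endofunctor along an equivalence. -/
abbrev transportFunctor (g : Γ) : C ⥤ C := (e.inverse ⋙ T g) ⋙ e.functor

variable {T}

/-- Transport of a composition isomorphism along an equivalence. -/
abbrev transportIso {g h k : Γ} (κ : T h ⋙ T g ≅ T k) :
    transportFunctor e T h ⋙ transportFunctor e T g ≅ transportFunctor e T k :=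
  Functor.associator (e.inverse ⋙ T h) e.functor (transportFunctor e T g) ≪≫
  Functor.isoWhiskerLeft (e.inverse ⋙ T h)
    (Functor.isoWhiskerLeft e.functor (Functor.associator e.inverse (T g) e.functor) ≪≫
      (Functor.associator e.functor e.inverse (T g ⋙ e.functor)).symm ≪≫
      Functor.isoWhiskerRight e.unitIso.symm (T g ⋙ e.functor) ≪≫
      Functor.leftUnitor (T g ⋙ e.functor)) ≪≫
  (Functor.associator (e.inverse ⋙ T h) (T g) e.functor).symm ≪≫
  Functor.isoWhiskerRight (Functor.associator e.inverse (T h) (T g) ≪≫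
    Functor.isoWhiskerLeft e.inverse κ) e.functor

theorem transportIso_hom_app {g h k : Γ} (κ : T h ⋙ T g ≅ T k) (X : C) :
    (transportIso e κ).hom.app X =
      e.functor.map ((T g).map (e.unitInv.app ((T h).obj (e.inverse.obj X))) ≫
        κ.hom.app (e.inverse.obj X)) := by
  simp [transportIso]

/-- Naturality of `κ₁` and of the inverse unit of `e` moves the two inserted units together on both
sides; associativity of the `κ` finishes. -/
theorem transportIso_assoc {g h k a b c : Γ} {κ₁ : T h ⋙ T g ≅ T a} {κ₂ : T k ⋙ T a ≅ T c}
    {κ₃ : T k ⋙ T h ≅ T b} {κ₄ : T b ⋙ T g ≅ T c}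
    (hκ : ∀ Y, κ₁.hom.app ((T k).obj Y) ≫ κ₂.hom.app Y = (T g).map (κ₃.hom.app Y) ≫ κ₄.hom.app Y)
    (X : C) :
    (transportIso e κ₁).hom.app ((transportFunctor e T k).obj X) ≫ (transportIso e κ₂).hom.app X =
      (transportFunctor e T g).map ((transportIso e κ₃).hom.app X) ≫
        (transportIso e κ₄).hom.app X := by
  have n := κ₁.hom.naturality (e.unitInv.app ((T k).obj (e.inverse.obj X)))
  have n' := e.unitInv.naturality ((T h).map (e.unitInv.app ((T k).obj (e.inverse.obj X))) ≫
    κ₃.hom.app (e.inverse.obj X))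
  simp only [Functor.comp_map, Functor.id_map, Functor.comp_obj, Functor.id_obj] at n n'
  simp only [transportIso_hom_app, Functor.comp_map, Functor.comp_obj, ← Functor.map_comp]
  congr 1
  simp only [Category.assoc, ← Functor.map_comp_assoc, n']
  rw [← reassoc_of% n, hκ]
  simp only [Functor.map_comp, Category.assoc]

/-- Since `transportIso` is assembled from associators, unitors and whiskerings of `κ` and the unit
of `e`, each factor is monoidal. -/
theorem isMonoidal_transportIso [MonoidalCategory A] [MonoidalCategory C] [e.functor.Monoidal]
    [e.inverse.Monoidal] [e.IsMonoidal] [∀ g, (T g).Monoidal] {g h k : Γ} (κ : T h ⋙ T g ≅ T k)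
    [NatTrans.IsMonoidal κ.hom] : NatTrans.IsMonoidal (transportIso e κ).hom := by
  have : NatTrans.IsMonoidal e.unitIso.inv := inferInstanceAs (NatTrans.IsMonoidal e.unitInv)
  simp only [transportIso, Iso.trans_hom, Iso.symm_hom, Functor.isoWhiskerLeft_hom,
    Functor.isoWhiskerRight_hom]
  infer_instance

end Transport

/-! ### The action of the Galois group on the extension of scalars -/

namespace ExtScalars

open Idempotents

variable {K L : Type w} [Field K] [Field L] [Algebra K L]
variable {D : Type u} [Category.{v} D] [Preadditive D] [Linear K D]

/-- The action of an automorphism of `L` on morphisms: `a ⊗ f ↦ g a ⊗ f`. -/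
noncomputable def twistHom (g : L ≃ₐ[K] L) {X Y : ExtScalars K L D} : (X ⟶ Y) →+ (X ⟶ Y) :=
  (LinearMap.rTensor (X.of ⟶ Y.of) g.toLinearMap).toAddMonoidHom

theorem twistHom_tmul (g : L ≃ₐ[K] L) {X Y : ExtScalars K L D} (a : L) (f : X.of ⟶ Y.of) :
    twistHom g (tmul a f : X ⟶ Y) = tmul (g a) f := rfl

theorem twistHom_one_tmul (g : L ≃ₐ[K] L) {X Y : ExtScalars K L D} (f : X.of ⟶ Y.of) :
    twistHom g (tmul 1 f : X ⟶ Y) = tmul 1 f := by rw [twistHom_tmul, map_one]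

theorem twistHom_id (g : L ≃ₐ[K] L) (X : ExtScalars K L D) : twistHom g (𝟙 X) = 𝟙 X :=
  twistHom_one_tmul g _

theorem twistHom_comp (g : L ≃ₐ[K] L) {X Y Z : ExtScalars K L D} (f : X ⟶ Y) (f' : Y ⟶ Z) :
    twistHom g (f ≫ f') = twistHom g f ≫ twistHom g f' := by
  induction f using induction with
  | zero => simp
  | add f₁ f₂ h₁ h₂ => simp [h₁, h₂]
  | tmul a f =>
    induction f' using induction with
    | zero => simp
    | add f₁ f₂ h₁ h₂ => simp [h₁, h₂]
    | tmul b f' => simp only [twistHom_tmul, tmul_comp, map_mul]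

theorem twistHom_mul {g h k : L ≃ₐ[K] L} (e : g * h = k) {X Y : ExtScalars K L D} (f : X ⟶ Y) :
    twistHom g (twistHom h f) = twistHom k f := by
  subst e
  induction f using induction with
  | zero => simp
  | add f₁ f₂ h₁ h₂ => simp [h₁, h₂]
  | tmul a f => simp only [twistHom_tmul, AlgEquiv.mul_apply]

theorem twistHom_one {X Y : ExtScalars K L D} (f : X ⟶ Y) :
    twistHom (1 : L ≃ₐ[K] L) f = f := by
  induction f using induction with
  | zero => simp
  | add f₁ f₂ h₁ h₂ => rw [map_add, h₁, h₂]
  | tmul a f => rfl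

theorem twistHom_smul (g : L ≃ₐ[K] L) {X Y : ExtScalars K L D} (a : L) (f : X ⟶ Y) :
    twistHom g (a • f) = g a • twistHom g f := by
  induction f using induction with
  | zero => simp
  | add f₁ f₂ h₁ h₂ => simp [h₁, h₂]
  | tmul b f => simp only [twistHom_tmul, smul_tmul', map_mul]

theorem twistHom_idem (g : L ≃ₐ[K] L) {X : ExtScalars K L D} {p : X ⟶ X} (hp : p ≫ p = p) :
    twistHom g p ≫ twistHom g p = twistHom g p := by rw [← twistHom_comp, hp]

/-- The action of an automorphism of `L` on `D ⊗_K L`. -/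
@[reducible]
noncomputable def twist (g : L ≃ₐ[K] L) : ScalarExtension K L D ⥤ ScalarExtension K L D where
  obj P := ⟨P.X, twistHom g P.p, twistHom_idem g P.idem⟩
  map f := ⟨twistHom g f.f, by simp only [← twistHom_comp, f.comm]⟩
  map_id P := rfl
  map_comp f f' := Karoubi.hom_ext _ _ (twistHom_comp g f.f f'.f)

instance (g : L ≃ₐ[K] L) : (twist (D := D) g).Additive where
  map_add {_ _ f f'} := Karoubi.hom_ext _ _ (map_add (twistHom g) f.f f'.f)

theorem twist_map_smul (g : L ≃ₐ[K] L) {P Q : ScalarExtension K L D} (a : L) (f : P ⟶ Q) :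
    (twist g).map (a • f) = g a • (twist g).map f :=
  Karoubi.hom_ext _ _ (twistHom_smul g a f.f)

/-- The objects of the Karoubian envelope defined by equal idempotents are isomorphic. -/
def isoOfIdemEq {E : Type*} [Category* E] (X : E) {p q : X ⟶ X} (hp : p ≫ p = p) (hq : q ≫ q = q)
    (e : p = q) : (⟨X, p, hp⟩ : Karoubi E) ≅ ⟨X, q, hq⟩ where
  hom := ⟨q, by subst e; simp [hp]⟩
  inv := ⟨q, by subst e; simp [hp]⟩
  hom_inv_id := by subst e; ext; simp [hp]
  inv_hom_id := by ext; simp [hq]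

/-- The action of `Γ` on `D ⊗_K L` is associative. -/
noncomputable def twistMul {g h k : L ≃ₐ[K] L} (e : g * h = k) :
    twist (D := D) h ⋙ twist g ≅ twist k :=
  -- The objects agree except for their idempotents, which are only propositionally equal; the
  -- comparison is the idempotent itself.
  NatIso.ofComponents (fun P ↦ isoOfIdemEq P.X (twistHom_idem g (twistHom_idem h P.idem))
      (twistHom_idem k P.idem) (twistHom_mul e P.p)) fun {P Q} f ↦ Karoubi.hom_ext _ _ (by
    change twistHom g (twistHom h f.f) ≫ twistHom k Q.p = twistHom k P.p ≫ twistHom k f.f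
    rw [twistHom_mul e, ← twistHom_comp, ← twistHom_comp, Karoubi.comp_p f, Karoubi.p_comp f])

theorem twistMul_assoc {g h k a b c : L ≃ₐ[K] L} (e₁ : g * h = a) (e₂ : a * k = c) (e₃ : h * k = b)
    (e₄ : g * b = c) (P : ScalarExtension K L D) :
    (twistMul e₁).hom.app ((twist k).obj P) ≫ (twistMul e₂).hom.app P =
      (twist g).map ((twistMul e₃).hom.app P) ≫ (twistMul e₄).hom.app P := by
  refine Karoubi.hom_ext _ _ ?_
  change twistHom a (twistHom k P.p) ≫ twistHom c P.p = twistHom g (twistHom b P.p) ≫ twistHom c P.p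
  rw [twistHom_mul e₂, twistHom_mul e₄]

/-- The identity of `L` acts on `D ⊗_K L` as the identity. -/
noncomputable def twistOne : twist (K := K) (L := L) (D := D) 1 ≅ 𝟭 _ :=
  NatIso.ofComponents (fun P ↦ isoOfIdemEq P.X (twistHom_idem 1 P.idem) P.idem (twistHom_one P.p))
    fun {P Q} f ↦ Karoubi.hom_ext _ _ (by
      change twistHom 1 f.f ≫ Q.p = P.p ≫ f.f
      rw [twistHom_one, Karoubi.comp_p f, Karoubi.p_comp f])

instance (g : L ≃ₐ[K] L) : (twist (D := D) g).IsEquivalence :=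
  .mk' (twist g⁻¹) ((twistMul (inv_mul_cancel g)) ≪≫ twistOne).symm
    ((twistMul (mul_inv_cancel g)) ≪≫ twistOne)

section Monoidal

variable [MonoidalCategory D] [MonoidalPreadditive D] [MonoidalLinear K D]

theorem twistHom_whiskerLeft (g : L ≃ₐ[K] L) (X : ExtScalars K L D) {Y Z : ExtScalars K L D}
    (f : Y ⟶ Z) : twistHom g (X ◁ f) = X ◁ twistHom g f := by
  induction f using induction with
  | zero => simp [whiskerLeft_zero']
  | add f₁ f₂ h₁ h₂ => simp [whiskerLeft_add', h₁, h₂]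
  | tmul a f => simp only [twistHom_tmul, whiskerLeft_tmul]

theorem twistHom_whiskerRight (g : L ≃ₐ[K] L) {Y Z : ExtScalars K L D} (f : Y ⟶ Z)
    (X : ExtScalars K L D) : twistHom g (f ▷ X) = twistHom g f ▷ X := by
  induction f using induction with
  | zero => simp [zero_whiskerRight']
  | add f₁ f₂ h₁ h₂ => simp [add_whiskerRight', h₁, h₂]
  | tmul a f => simp only [twistHom_tmul, tmul_whiskerRight]

theorem twistHom_tensorHom (g : L ≃ₐ[K] L) {X Y X' Y' : ExtScalars K L D} (f : X ⟶ Y)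
    (f' : X' ⟶ Y') : twistHom g (f ⊗ₘ f') = twistHom g f ⊗ₘ twistHom g f' := by
  rw [tensorHom_def', twistHom_comp, twistHom_whiskerRight, twistHom_whiskerLeft, tensorHom_def']

/-- The compatibility of the action with tensor products. -/
noncomputable def twistμIso (g : L ≃ₐ[K] L) (P Q : ScalarExtension K L D) :
    (twist g).obj P ⊗ (twist g).obj Q ≅ (twist g).obj (P ⊗ Q) :=
  isoOfIdemEq (P.X ⊗ Q.X) ((twist g).obj P ⊗ (twist g).obj Q).idem ((twist g).obj (P ⊗ Q)).idem
    (twistHom_tensorHom g P.p Q.p).symm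

/-- The compatibility of the action with the unit. -/
noncomputable def twistεIso (g : L ≃ₐ[K] L) :
    𝟙_ (ScalarExtension K L D) ≅ (twist g).obj (𝟙_ (ScalarExtension K L D)) :=
  isoOfIdemEq (𝟙_ (ExtScalars K L D)) (𝟙_ (ScalarExtension K L D)).idem
    ((twist g).obj (𝟙_ (ScalarExtension K L D))).idem (twistHom_id g _).symm

/-- Associators and unitors of the extended category have coefficient `1`, so the twist fixes them,
and each axiom is the image under `twistHom g` of an identity in the untwisted category. -/
noncomputable instance twistMonoidal (g : L ≃ₐ[K] L) : (twist (D := D) g).Monoidal :=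
  Functor.CoreMonoidal.toMonoidal
    { εIso := twistεIso g
      μIso := twistμIso g
      μIso_hom_natural_left {P Q} f R := Karoubi.hom_ext _ _ (by
        change (twistHom g f.f ⊗ₘ twistHom g R.p) ≫ twistHom g (Q.p ⊗ₘ R.p) =
          twistHom g (P.p ⊗ₘ R.p) ≫ twistHom g (f.f ⊗ₘ R.p)
        simp only [← twistHom_tensorHom, ← twistHom_comp, tensorHom_comp_tensorHom, Karoubi.comp_p f,
          Karoubi.p_comp f])
      μIso_hom_natural_right {P Q} R f := Karoubi.hom_ext _ _ (by
        change (twistHom g R.p ⊗ₘ twistHom g f.f) ≫ twistHom g (R.p ⊗ₘ Q.p) =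
          twistHom g (R.p ⊗ₘ P.p) ≫ twistHom g (R.p ⊗ₘ f.f)
        simp only [← twistHom_tensorHom, ← twistHom_comp, tensorHom_comp_tensorHom, Karoubi.comp_p f,
          Karoubi.p_comp f])
      associativity P Q R := Karoubi.hom_ext _ _ (by
        change (twistHom g (P.p ⊗ₘ Q.p) ⊗ₘ twistHom g R.p) ≫
            twistHom g ((P.p ⊗ₘ Q.p) ⊗ₘ R.p) ≫
            twistHom g (((P.p ⊗ₘ Q.p) ⊗ₘ R.p) ≫ (α_ P.X Q.X R.X).hom) =
          (((twistHom g P.p ⊗ₘ twistHom g Q.p) ⊗ₘ twistHom g R.p) ≫ (α_ P.X Q.X R.X).hom) ≫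
            (twistHom g P.p ⊗ₘ twistHom g (Q.p ⊗ₘ R.p)) ≫ twistHom g (P.p ⊗ₘ (Q.p ⊗ₘ R.p))
        have e : (α_ P.X Q.X R.X).hom = twistHom g (α_ P.X Q.X R.X).hom :=
          (twistHom_one_tmul g (α_ P.X.of Q.X.of R.X.of).hom).symm
        conv_rhs => rw [e]
        simp only [← twistHom_tensorHom, ← twistHom_comp]
        refine congrArg (twistHom g) ?_
        simp only [Category.assoc, tensorHom_comp_tensorHom, tensorHom_comp_tensorHom_assoc, P.idem,
          Q.idem, R.idem]
        rw [← associator_naturality, tensorHom_comp_tensorHom_assoc, tensorHom_comp_tensorHom, P.idem,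
          Q.idem, R.idem])
      left_unitality P := Karoubi.hom_ext _ _ (by
        change 𝟙_ (ExtScalars K L D) ◁ twistHom g P.p ≫ (λ_ P.X).hom =
          (twistHom g (𝟙 (𝟙_ (ExtScalars K L D))) ⊗ₘ twistHom g P.p) ≫
            twistHom g (𝟙 (𝟙_ (ExtScalars K L D)) ⊗ₘ P.p) ≫
            twistHom g (𝟙_ (ExtScalars K L D) ◁ P.p ≫ (λ_ P.X).hom)
        have e : (λ_ P.X).hom = twistHom g (λ_ P.X).hom :=
          (twistHom_one_tmul g (λ_ P.X.of).hom).symm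
        conv_lhs => rw [e]
        simp only [← twistHom_tensorHom, ← twistHom_comp, ← twistHom_whiskerLeft]
        congr 1
        simp)
      right_unitality P := Karoubi.hom_ext _ _ (by
        change twistHom g P.p ▷ 𝟙_ (ExtScalars K L D) ≫ (ρ_ P.X).hom =
          (twistHom g P.p ⊗ₘ twistHom g (𝟙 (𝟙_ (ExtScalars K L D)))) ≫
            twistHom g (P.p ⊗ₘ 𝟙 (𝟙_ (ExtScalars K L D))) ≫
            twistHom g (P.p ▷ 𝟙_ (ExtScalars K L D) ≫ (ρ_ P.X).hom)
        have e : (ρ_ P.X).hom = twistHom g (ρ_ P.X).hom :=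
          (twistHom_one_tmul g (ρ_ P.X.of).hom).symm
        conv_lhs => rw [e]
        simp only [← twistHom_tensorHom, ← twistHom_comp, ← twistHom_whiskerRight]
        congr 1
        simp) }

instance isMonoidal_twistMul {g h k : L ≃ₐ[K] L} (e : g * h = k) :
    NatTrans.IsMonoidal (twistMul (D := D) e).hom where
  unit := Karoubi.hom_ext _ _ (by
    change (twistHom g (𝟙 (𝟙_ (ExtScalars K L D))) ≫
      twistHom g (twistHom h (𝟙 (𝟙_ (ExtScalars K L D))))) ≫ twistHom k (𝟙 _) = twistHom k (𝟙 _)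
    simp [twistHom_id])
  tensor P Q := Karoubi.hom_ext _ _ (by
    change (twistHom g (twistHom h P.p ⊗ₘ twistHom h Q.p) ≫ twistHom g (twistHom h (P.p ⊗ₘ Q.p))) ≫
      twistHom k (P.p ⊗ₘ Q.p) = (twistHom k P.p ⊗ₘ twistHom k Q.p) ≫ twistHom k (P.p ⊗ₘ Q.p)
    simp only [← twistHom_tensorHom, twistHom_mul e, ← twistHom_comp, tensorHom_comp_tensorHom,
      P.idem, Q.idem])

theorem isBraided_twist [BraidedCategory D] (g : L ≃ₐ[K] L) :
    IsBraidedFunctor (twist (D := D) g) := fun P Q ↦ Karoubi.hom_ext _ _ (by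
  change twistHom g (P.p ⊗ₘ Q.p) ≫ twistHom g ((P.p ⊗ₘ Q.p) ≫ (β_ P.X Q.X).hom) =
    ((twistHom g P.p ⊗ₘ twistHom g Q.p) ≫ (β_ P.X Q.X).hom) ≫ twistHom g (Q.p ⊗ₘ P.p)
  have e : (β_ P.X Q.X).hom = twistHom g (β_ P.X Q.X).hom :=
    (twistHom_one_tmul g (β_ P.X.of Q.X.of).hom).symm
  conv_rhs => rw [e]
  simp only [← twistHom_tensorHom, ← twistHom_comp]
  congr 1
  simp [← BraidedCategory.braiding_naturality])

end Monoidal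
end ExtScalars

/-! ### Braided functors between different categories -/

section Braided

variable {A B C : Type*} [Category* A] [MonoidalCategory A] [BraidedCategory A]
  [Category* B] [MonoidalCategory B] [BraidedCategory B]
  [Category* C] [MonoidalCategory C] [BraidedCategory C]

theorem IsBraidedFunctor.comp' {F : A ⥤ B} {G : B ⥤ C} [F.Monoidal] [G.Monoidal]
    (hF : IsBraidedFunctor F) (hG : IsBraidedFunctor G) : IsBraidedFunctor (F ⋙ G) := fun X Y ↦ by
  simp only [Functor.comp_obj, Functor.LaxMonoidal.comp_μ, Functor.comp_map, Category.assoc]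
  rw [← G.map_comp, hF, G.map_comp, reassoc_of% (hG (F.obj X) (F.obj Y))]

/-- The equation may be tested after applying the faithful functor `e.functor` and the counit, which
is monoidal; it then becomes naturality of the braiding in `B`. -/
theorem IsBraidedFunctor.inverse (e : A ≌ B) [e.functor.Monoidal] [e.inverse.Monoidal]
    [e.toAdjunction.IsMonoidal] (h : IsBraidedFunctor e.functor) :
    IsBraidedFunctor e.inverse := fun X Y ↦ by
  apply e.functor.map_injective
  rw [← cancel_mono (e.toAdjunction.counit.app (Y ⊗ X))]
  have n := e.toAdjunction.counit.naturality (β_ X Y).hom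
  simp only [Functor.comp_map, Functor.id_map] at n
  simp only [Functor.map_comp, Category.assoc, n,
    e.toAdjunction.map_μ_comp_counit_app_tensor,
    e.toAdjunction.map_μ_comp_counit_app_tensor_assoc, BraidedCategory.braiding_naturality]
  rw [← cancel_epi (Functor.LaxMonoidal.μ e.functor _ _), reassoc_of% (h _ _)]
  simp

end Braided

/-! ### From forms to splittings -/

section SplittingOfForm

variable {K L : Type w} [Field K] [Field L] [Algebra K L]
  {C : Type u} [Category.{v} C] [Preadditive C] [Linear L C]
  {D : Type*} [Category* D] [Preadditive D] [Linear K D]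

section

variable (e : ScalarExtension K L D ≌ C)

theorem inverse_map_smul [e.functor.Linear L] {X Y : C} (a : L) (f : X ⟶ Y) :
    e.inverse.map (a • f) = a • e.inverse.map f := by
  apply e.functor.map_injective
  simp

variable [e.functor.Additive] [e.functor.Linear L]

/-- The twisted auto-equivalences of `C` defined by a form. -/
@[reducible]
noncomputable def formAut (g : L ≃ₐ[K] L) : TwistedAut K L C where
  g := g
  functor := transportFunctor e ExtScalars.twist g
  isEquivalence := inferInstance
  additive := inferInstance
  linear := TwistedAut.linear_of_map_smul _ _ fun a f ↦ by
    change e.functor.map ((ExtScalars.twist g).map (e.inverse.map (a • f))) =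
      g a • e.functor.map ((ExtScalars.twist g).map (e.inverse.map f))
    rw [inverse_map_smul, ExtScalars.twist_map_smul, Functor.map_smul]

/-- The composition of the twisted auto-equivalences defined by a form. -/
noncomputable def formMulData : MulData (L ≃ₐ[K] L) (TwistedAut K L C) where
  obj := formAut e
  iso m := TwistedAut.mkIso m (transportIso e (ExtScalars.twistMul m))
  assoc e₁ e₂ e₃ e₄ := TwistedAut.hom_ext fun X ↦
    (transportIso_assoc e (ExtScalars.twistMul_assoc e₁ e₂ e₃ e₄) X).trans (Category.id_comp _).symm

end

section Monoidal

variable [MonoidalCategory C] [MonoidalCategory D] [MonoidalPreadditive D] [MonoidalLinear K D]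
  (e : ScalarExtension K L D ≌ C) [e.functor.Additive] [e.functor.Linear L]
  [e.functor.Monoidal] [e.inverse.Monoidal] [e.IsMonoidal]

/-- The twisted tensor auto-equivalences of `C` defined by a tensor form. -/
@[reducible]
noncomputable def formTensorAut (g : L ≃ₐ[K] L) : TwistedTensorAut K L C where
  toTwistedAut := formAut e g
  monoidal := inferInstanceAs (transportFunctor e ExtScalars.twist g).Monoidal

/-- The composition of the twisted tensor auto-equivalences defined by a tensor form. -/
noncomputable def formTensorMulData : MulData (L ≃ₐ[K] L) (TwistedTensorAut K L C) where
  obj := formTensorAut e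
  iso {g h k} m :=
    have := isMonoidal_transportIso e (ExtScalars.twistMul m)
    TwistedTensorAut.mkIso (X := (formTensorAut e g).tensor (formTensorAut e h))
      (Y := formTensorAut e k) m (transportIso e (ExtScalars.twistMul m))
  assoc e₁ e₂ e₃ e₄ := TwistedTensorAut.hom_ext ((formMulData e).assoc e₁ e₂ e₃ e₄)

end Monoidal

/-- The coefficient action on `D ⊗_K L`, conjugated with the equivalence to `C`, is `MulData` lying
over the identity of Γ by construction. -/
theorem nonempty_splitting_of_hasForm (h : HasForm K L C) :
    Nonempty (Splitting (TwistedAut.toGalois K L C)) := by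
  obtain ⟨D, _, _, _, -, -, ⟨Ξ⟩⟩ := h
  have := Ξ.isEquivalence
  have : Ξ.functor.asEquivalence.functor.Additive := Ξ.additive
  have : Ξ.functor.asEquivalence.functor.Linear L := Ξ.linear
  exact ((formMulData Ξ.functor.asEquivalence).exists_splitting fun _ ↦ rfl).nonempty

theorem nonempty_splitting_of_hasTensorForm [MonoidalCategory C] (h : HasTensorForm K L C) :
    Nonempty (Splitting (TwistedTensorAut.toGalois K L C)) := by
  obtain ⟨D, _, _, _, _, _, _, -, -, ⟨Ξ⟩⟩ := h
  have := Ξ.isEquivalence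
  have : Ξ.functor.asEquivalence.functor.Additive := Ξ.additive
  have : Ξ.functor.asEquivalence.functor.Linear L := Ξ.linear
  let _ : Ξ.functor.asEquivalence.functor.Monoidal := Ξ.monoidal
  let _ : Ξ.functor.asEquivalence.inverse.Monoidal := Ξ.functor.asEquivalence.inverseMonoidal
  have : Ξ.functor.asEquivalence.IsMonoidal := ⟨rfl, fun _ _ ↦ rfl⟩
  exact ((formTensorMulData Ξ.functor.asEquivalence).exists_splitting fun _ ↦ rfl).nonempty

theorem nonempty_splitting_of_hasBraidedForm [MonoidalCategory C] [BraidedCategory C]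
    (h : HasBraidedForm K L C) :
    Nonempty (Splitting (TwistedBraidedAut.toGalois K L C)) := by
  obtain ⟨D, _, _, _, _, _, _, _, -, -, Ξ, hΞ⟩ := h
  have := Ξ.isEquivalence
  let e := Ξ.functor.asEquivalence
  have : e.functor.Additive := Ξ.additive
  have : e.functor.Linear L := Ξ.linear
  let _ : e.functor.Monoidal := Ξ.monoidal
  let _ : e.inverse.Monoidal := Ξ.functor.asEquivalence.inverseMonoidal
  have : e.IsMonoidal := ⟨rfl, fun _ _ ↦ rfl⟩
  have : e.toAdjunction.IsMonoidal := ⟨rfl, fun _ _ ↦ rfl⟩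
  have hb : ∀ g, isBraided K L C (formTensorAut e g) := fun g ↦
    ((IsBraidedFunctor.inverse e hΞ).comp' (ExtScalars.isBraided_twist g)).comp' hΞ
  -- Braided auto-equivalences form a full subcategory, so the tensor data lift as soon as their
  -- objects are braided.
  let m : MulData (L ≃ₐ[K] L) (TwistedBraidedAut K L C) :=
    { obj g := ⟨formTensorAut e g, hb g⟩
      iso m := (isBraided K L C).fullyFaithfulι.preimageIso ((formTensorMulData e).iso m)
      assoc e₁ e₂ e₃ e₄ := (isBraided K L C).ι.map_injective
        ((formTensorMulData e).assoc e₁ e₂ e₃ e₄) }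
  exact (m.exists_splitting fun _ ↦ rfl).nonempty

end SplittingOfForm
end CategoricalDescent

/-! ### Assembly of the three settings -/

theorem mainTheorem7 {K L : Type w} [Field K] [Field L] [Algebra K L] [FiniteDimensional K L]
    [IsGalois K L] (C : Type u) [Category.{v} C] [Preadditive C] [Linear L C]
    (hC : IsSemisimpleAbelian C) (hfin : HomFinite L C) :
    -- the case of a linear category without additional structure
    ((HasForm K L C ↔ Nonempty (Splitting (TwistedAut.toGalois K L C))) ∧
      (Nonempty (Splitting (TwistedAut.toGalois K L C)) ↔
        HasSection (TwistedAut.toGalois K L C)) ∧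
      (∀ Φ : WeakSplitting (TwistedAut.toGalois K L C), ∃ act, Φ.IsConjugation act ∧
        ∃ o : H₃ act, Φ.IsObstruction act o ∧
          (o = 1 ↔ ∃ S : Splitting (TwistedAut.toGalois K L C), Φ.IsRefinedBy S)) ∧
      (∀ s : Splitting (TwistedAut.toGalois K L C),
        IsSemisimpleAbelian (StableObj s.galoisData) ∧
        HomFinite K (StableObj s.galoisData) ∧
        ∃ Ξ : FormEquivalence K L (StableObj s.galoisData) C,
          Nonempty (toScalarExtension K L (StableObj s.galoisData) ⋙ Ξ.functor ≅
            StableObj.forget s.galoisData))) ∧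
    -- the case of a tensor category
    (∀ [MonoidalCategory C] [MonoidalPreadditive C] [MonoidalLinear L C],
      (HasTensorForm K L C ↔ Nonempty (Splitting (TwistedTensorAut.toGalois K L C))) ∧
      (Nonempty (Splitting (TwistedTensorAut.toGalois K L C)) ↔
        HasSection (TwistedTensorAut.toGalois K L C)) ∧
      (∀ Φ : WeakSplitting (TwistedTensorAut.toGalois K L C), ∃ act, Φ.IsConjugation act ∧
        ∃ o : H₃ act, Φ.IsObstruction act o ∧
          (o = 1 ↔ ∃ S : Splitting (TwistedTensorAut.toGalois K L C), Φ.IsRefinedBy S)) ∧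
      (∀ s : Splitting (TwistedTensorAut.toGalois K L C),
        IsSemisimpleAbelian (StableObj s.tensorGaloisData.toGaloisData) ∧
        HomFinite K (StableObj s.tensorGaloisData.toGaloisData) ∧
        (IsRigid C → IsRigid (StableObj s.tensorGaloisData.toGaloisData)) ∧
        (EndUnitIsScalar L C →
          EndUnitIsScalar K (StableObj s.tensorGaloisData.toGaloisData)) ∧
        ∃ (Ξ : TensorFormEquivalence K L (StableObj s.tensorGaloisData.toGaloisData) C)
          (i : toScalarExtension K L (StableObj s.tensorGaloisData.toGaloisData) ⋙ Ξ.functor ≅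
            StableObj.forget s.tensorGaloisData.toGaloisData),
          NatTrans.IsMonoidal i.hom)) ∧
    -- the case of a braided (or symmetric) tensor category
    (∀ [MonoidalCategory C] [MonoidalPreadditive C] [MonoidalLinear L C] [BraidedCategory C],
      (HasBraidedForm K L C ↔ Nonempty (Splitting (TwistedBraidedAut.toGalois K L C))) ∧
      (Nonempty (Splitting (TwistedBraidedAut.toGalois K L C)) ↔
        HasSection (TwistedBraidedAut.toGalois K L C)) ∧
      (∀ Φ : WeakSplitting (TwistedBraidedAut.toGalois K L C), ∃ act, Φ.IsConjugation act ∧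
        ∃ o : H₃ act, Φ.IsObstruction act o ∧
          (o = 1 ↔ ∃ S : Splitting (TwistedBraidedAut.toGalois K L C), Φ.IsRefinedBy S)) ∧
      (∀ s : Splitting (TwistedBraidedAut.toGalois K L C),
        IsSemisimpleAbelian (StableObj s.braidedGaloisData.toGaloisData) ∧
        HomFinite K (StableObj s.braidedGaloisData.toGaloisData) ∧
        (IsRigid C → IsRigid (StableObj s.braidedGaloisData.toGaloisData)) ∧
        (EndUnitIsScalar L C →
          EndUnitIsScalar K (StableObj s.braidedGaloisData.toGaloisData)) ∧
        ((∀ X Y : C, (β_ X Y).hom ≫ (β_ Y X).hom = 𝟙 (X ⊗ Y)) →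
          ∀ X Y : StableObj s.braidedGaloisData.toGaloisData,
            (β_ X Y).hom ≫ (β_ Y X).hom = 𝟙 (X ⊗ Y)) ∧
        ∃ (Ξ : TensorFormEquivalence K L (StableObj s.braidedGaloisData.toGaloisData) C)
          (i : toScalarExtension K L (StableObj s.braidedGaloisData.toGaloisData) ⋙ Ξ.functor ≅
            StableObj.forget s.braidedGaloisData.toGaloisData),
          IsBraidedFunctor Ξ.functor ∧ NatTrans.IsMonoidal i.hom)) := by
  have := IsSemisimpleAbelian.isIdempotentComplete (C := C)
  refine ⟨⟨⟨nonempty_splitting_of_hasForm, ?_⟩, nonempty_splitting_iff_hasSection _, ?_, ?_⟩,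
    ?_, ?_⟩
  · rintro ⟨s⟩
    have hd := s.isCoherent_galoisData
    exact ⟨StableObj s.galoisData, inferInstance, inferInstance, inferInstance,
      StableObj.isSemisimpleAbelian, StableObj.homFinite, ⟨StableObj.formEquivalence hd⟩⟩
  · exact fun Φ ↦ ⟨Φ.act, Φ.isConjugation_act, Φ.exists_isObstruction⟩
  · intro s
    have hd := s.isCoherent_galoisData
    exact ⟨StableObj.isSemisimpleAbelian, StableObj.homFinite, StableObj.formEquivalence hd,
      ⟨StableObj.formEquivalenceIso hd⟩⟩
  · intro _ _ _
    refine ⟨⟨nonempty_splitting_of_hasTensorForm, ?_⟩, nonempty_splitting_iff_hasSection _, ?_, ?_⟩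
    · rintro ⟨s⟩
      have hd := s.isCoherent_tensorGaloisData
      exact ⟨StableObj s.tensorGaloisData.toGaloisData, inferInstance, inferInstance, inferInstance,
        inferInstance, inferInstance, inferInstance,
        StableObj.isSemisimpleAbelian, StableObj.homFinite, ⟨StableObj.tensorFormEquivalence hd⟩⟩
    · exact fun Φ ↦ ⟨Φ.act, Φ.isConjugation_act, Φ.exists_isObstruction⟩
    · intro s
      have hd := s.isCoherent_tensorGaloisData
      exact ⟨StableObj.isSemisimpleAbelian, StableObj.homFinite, StableObj.isRigid,
        StableObj.endUnitIsScalar, StableObj.tensorFormEquivalence hd,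
        StableObj.tensorFormEquivalenceIso hd, StableObj.isMonoidal_tensorFormEquivalenceIso hd⟩
  · intro _ _ _ _
    refine ⟨⟨nonempty_splitting_of_hasBraidedForm, ?_⟩, nonempty_splitting_iff_hasSection _, ?_, ?_⟩
    · rintro ⟨s⟩
      have hd := s.isCoherent_braidedGaloisData
      exact ⟨StableObj s.braidedGaloisData.toGaloisData, inferInstance, inferInstance, inferInstance,
        inferInstance, inferInstance, inferInstance, inferInstance,
        StableObj.isSemisimpleAbelian, StableObj.homFinite, StableObj.tensorFormEquivalence hd,
        StableObj.isBraided_tensorFormEquivalence hd⟩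
    · exact fun Φ ↦ ⟨Φ.act, Φ.isConjugation_act, Φ.exists_isObstruction⟩
    · intro s
      have hd := s.isCoherent_braidedGaloisData
      -- Symmetry is inherited because the braiding of stable objects is that of the underlying
      -- objects and the forgetful functor is faithful.
      refine ⟨StableObj.isSemisimpleAbelian, StableObj.homFinite, StableObj.isRigid,
        StableObj.endUnitIsScalar, fun h X Y ↦ StableObj.hom_ext (h X.obj Y.obj), ?_⟩
      exact ⟨StableObj.tensorFormEquivalence hd, StableObj.tensorFormEquivalenceIso hd,
        StableObj.isBraided_tensorFormEquivalence hd, StableObj.isMonoidal_tensorFormEquivalenceIso hd⟩
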